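/- Let $q\ge 1$, $h\ge 0$ be real, $p=1/q$, $c\in\mathbb C$; powers $a^{b}$ of a real $a>0$ are $\exp(b\ln a)$. Put $(x;p)_\infty=\prod_{j\ge 0}(1-p^jx)$, $\Theta_q(x)=\sum_{n\in\mathbb Z}(-1)^nq^{-n(n-1)/2}x^n$ and $\Theta_{q,\alpha}(x)=\Theta_q(\alpha^{-1}x)$. The character $e_c^{(q,h)}$ is $$e_c^{(q,h)}(x)=\begin{cases}\left(\frac{h}{1-p}\right)^c\dfrac{((1-p)\frac xh+p;p)_\infty}{(p^c((1-p)\frac xh+p);p)_\infty}& q>1,\ h>0,\\[2mm] h^c\,\dfrac{\Gamma(1+c-\frac xh)}{\Gamma(1-\frac xh)}& q=1,\ h>0,\\[2mm] \dfrac{\Theta_q(x)}{\Theta_{q,q^c}(x)}& q>1,\ h=0,\\[2mm] (-x)^c& (q,h)=(1,0),\end{cases}$$ a meromorphic function of $x$ on $\mathbb C$ in the first two cases and on $\mathbb C^*$ in the third (removable singularities being removed); in the last case the principal determination of $\log(-x)$ on $\mathbb C\setminus\mathbb R^+$ is used. Here $\mathbb R^+=[0,+\infty[$ and $\mathbb N^*=\{1,2,\dots\}$.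 Then, for every $c\in\mathbb C$: **C1.** Let $q_0>1$, $p_0=1/q_0$. (a) For every $\varepsilon>0$ the family $(e_c^{(q_0,h)})_{0<h\le\varepsilon}$ is a normal family of meromorphic functions on $\mathbb C\setminus q_0^c\mathbb R^+$ (every sequence of members has a subsequence converging, uniformly on compact subsets for the chordal distance of the Riemann sphere, to a meromorphic function or to $\infty$). Moreover, for every compact $K\subset\mathbb C\setminus q_0^c\mathbb R^+$ there are $\eta>0$ and $M$ such that for $0<h\le\eta$ the function $e_c^{(q_0,h)}$ has no pole on $K$ and $|e_c^{(q_0,h)}|\le M$ on $K$. (b) For $\xi\in[0,1[$ and $h_n=(1-p_0)p_0^{\xi+n}$, the sequence $(e_c^{(q_0,h_n)})_{n\ge0}$ converges, uniformly on every compact subset of $\mathbb C\setminus q_0^c\mathbb R^+$, to $$\tilde e_c^{(q_0,\xi)}=p_0^{\xi c}\,\frac{\Theta_{q_0,p_0^\xi}}{\Theta_{q_0,p_0^\xi p_0^{-c}}}=p_0^{\xi c}\,\frac{e_{c-\xi}^{(q_0,0)}}{e_{-\xi}^{(q_0,0)}},$$ the second equality being one of meromorphic functions on $\mathbb C^*$.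 (c) Conversely, if $h_n>0$, $h_n\to0$ and $(e_c^{(q_0,h_n)})_{n\ge0}$ converges pointwise on $\mathbb C\setminus q_0^c\mathbb R^+$, then there is $\xi\in[0,1[$ such that its limit is $\tilde e_c^{(q_0,\xi)}$ on $\mathbb C\setminus q_0^c\mathbb R^+$. **C2.** Let $h_0>0$. When $(q,h)\to(1,h_0)$ with $q>1$, $h>0$, $e_c^{(q,h)}$ converges to $e_c^{(1,h_0)}(x)=h_0^c\,\Gamma(1+c-x/h_0)/\Gamma(1-x/h_0)$, uniformly on every compact subset of $\mathbb C\setminus h_0(c+\mathbb N^*)$. **C3.** Let $\ell\in\,]0,+\infty]$. When $(q,h)\to(1,0)$ with $q\ge1$, $h\ge0$, $(q,h)\ne(1,0)$, in such a way that $h/(q-1)\to\ell$ (where $h/(q-1)=+\infty$ if $q=1$ and $h>0$), $e_c^{(q,h)}$ converges to $e_c^{(1,0)}(x)=(-x)^c$, uniformly on every compact subset of $\mathbb C\setminus\mathbb R^+$. -/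

import Mathlib

open Filter Topology Set

noncomputable section

/-- The infinite product `(x;p)_∞ = ∏_{j ≥ 0} (1 - p^j x)`. -/
def qPochInf (p : ℝ) (x : ℂ) : ℂ :=
  ∏' j : ℕ, (1 - (p : ℂ) ^ j * x)

/-- The theta function `Θ_q(x) = ∑_{n ∈ ℤ} (-1)^n q^{-n(n-1)/2} x^n`
(the integer `n(n-1)` is even, so the integer division is exact). -/
def theta (q : ℝ) (x : ℂ) : ℂ :=
  ∑' n : ℤ, (-1 : ℂ) ^ n * (q : ℂ) ^ (-(n * (n - 1) / 2)) * x ^ n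

/-- `Θ_{q,α}(x) = Θ_q(α⁻¹ x)`. -/
def thetaShift (q : ℝ) (α : ℂ) (x : ℂ) : ℂ :=
  theta q (α⁻¹ * x)

/-- The character `e_c^{(q,h)}` for `q ≥ 1`, `h ≥ 0`, with `p = 1/q`.
For `(q,h) ≠ (1,0)` it is a meromorphic function (on `ℂ` if `h > 0`, on `ℂ \ {0}` if `h = 0`):
`toMeromorphicNFOn` gives the displayed quotient its true value at removable singularities,
and the value `0` at poles. For `(q,h) = (1,0)` it is `(-x)^c`, with the principal
determination of `log (-x)`, which is holomorphic on `ℂ \ [0,∞)`. -/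
def qhChar (q h : ℝ) (c : ℂ) : ℂ → ℂ :=
  if 1 < q then
    if 0 < h then
      toMeromorphicNFOn
        (fun x : ℂ =>
          ((h / (1 - q⁻¹) : ℝ) : ℂ) ^ c *
            (qPochInf q⁻¹ ((1 - (q⁻¹ : ℝ)) * (x / h) + (q⁻¹ : ℝ)) /
              qPochInf q⁻¹
                (((q⁻¹ : ℝ) : ℂ) ^ c * ((1 - (q⁻¹ : ℝ)) * (x / h) + (q⁻¹ : ℝ)))))
        Set.univ
    else
      toMeromorphicNFOn
        (fun x : ℂ => theta q x / thetaShift q ((q : ℂ) ^ c) x) {(0 : ℂ)}ᶜ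
  else
    if 0 < h then
      toMeromorphicNFOn
        (fun x : ℂ =>
          (h : ℂ) ^ c * (Complex.Gamma (1 + c - x / h) / Complex.Gamma (1 - x / h)))
        Set.univ
    else
      fun x : ℂ => (-x) ^ c

/-- `ẽ_c^{(q,ξ)}(x) = p^{ξ c} Θ_{q, p^ξ}(x) / Θ_{q, p^ξ p^{-c}}(x)`, with `p = 1/q`. -/
def limitChar (q ξ : ℝ) (c : ℂ) (x : ℂ) : ℂ :=
  ((q⁻¹ : ℝ) : ℂ) ^ ((ξ : ℂ) * c) *
    (thetaShift q (((q⁻¹ : ℝ) : ℂ) ^ (ξ : ℂ)) x /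
      thetaShift q (((q⁻¹ : ℝ) : ℂ) ^ (ξ : ℂ) * ((q⁻¹ : ℝ) : ℂ) ^ (-c)) x)

/-- The closed half-line `q^c ℝ⁺ = {q^c t | t ≥ 0}`. -/
def ray (q : ℝ) (c : ℂ) : Set ℂ :=
  {x | ∃ t : ℝ, 0 ≤ t ∧ x = (q : ℂ) ^ c * t}

/-- The set `h₀ (c + ℕ*) = {h₀ (c + n) | n ≥ 1}`. -/
def poleSet (h₀ : ℝ) (c : ℂ) : Set ℂ :=
  {x | ∃ n : ℕ, 1 ≤ n ∧ x = (h₀ : ℂ) * (c + n)}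

/-- The half-line `ℝ⁺ = [0,∞)` in the complex plane. -/
def posRealAxis : Set ℂ :=
  {x | ∃ t : ℝ, 0 ≤ t ∧ x = t}

/-- The parameter set `𝒬 = ]1,∞[ × ]0,∞[`. -/
def paramQ : Set (ℝ × ℝ) :=
  {a | 1 < a.1 ∧ 0 < a.2}

/-- The parameter set `𝒬* = ([1,∞[ × [0,∞[) \ {(1,0)}`. -/
def paramQStar : Set (ℝ × ℝ) :=
  {a | 1 ≤ a.1 ∧ 0 ≤ a.2 ∧ a ≠ (1, 0)}

/-- `h / (q - 1) ∈ [0,∞]`, equal to `∞` when `q = 1` and `h > 0`. -/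
def confluenceRatio (a : ℝ × ℝ) : ENNReal :=
  ENNReal.ofReal a.2 / ENNReal.ofReal (a.1 - 1)

/-- The chordal distance on the Riemann sphere `ℂ ∪ {∞}`. -/
def chordalDist : OnePoint ℂ → OnePoint ℂ → ℝ
  | .some z, .some w => 2 * ‖z - w‖ / (√(1 + ‖z‖ ^ 2) * √(1 + ‖w‖ ^ 2))
  | .some z, .infty => 2 / √(1 + ‖z‖ ^ 2)
  | .infty, .some w => 2 / √(1 + ‖w‖ ^ 2)
  | .infty, .infty => 0

open Classical in
/-- The value in the Riemann sphere of a meromorphic function in normal form: `∞` at a pole. -/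
def sphereValue (f : ℂ → ℂ) (x : ℂ) : OnePoint ℂ :=
  if meromorphicOrderAt f x < 0 then OnePoint.infty else OnePoint.some (f x)

/-- A family of meromorphic functions (in normal form) is normal on `U`: every sequence of
members has a subsequence which converges, uniformly on every compact subset of `U` for the
chordal distance, to a meromorphic function on `U` or to the constant `∞`. -/
def MeromorphicNormalOn {ι : Type*} (F : ι → ℂ → ℂ) (U : Set ℂ) : Prop :=
  (∀ i, MeromorphicNFOn (F i) U) ∧
    ∀ s : ℕ → ι, ∃ φ : ℕ → ℕ, StrictMono φ ∧ ∃ g : ℂ → OnePoint ℂ,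
      ((∃ f : ℂ → ℂ, MeromorphicNFOn f U ∧ ∀ x ∈ U, g x = sphereValue f x) ∨
        ∀ x ∈ U, g x = OnePoint.infty) ∧
      ∀ K ⊆ U, IsCompact K → ∀ δ > (0 : ℝ), ∀ᶠ k in atTop, ∀ x ∈ K,
        chordalDist (sphereValue (F (s (φ k))) x) (g x) < δ

end

/-!
# Degeneration and confluence of the characters `e_c^{(q,h)}`

Write `p = 1/q` and `s = h/(q-1)`.

**Fixed `q > 1`.** Jacobi's triple product (`theta_eq_mul`) gives `Θ(x) = -x Θ(px)` and expresses
`(u;p)_∞` through `Θ(u)` and `(p/u;p)_∞`. As the argument of the infinite product is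
`u = (p/s)(x+s)`, for `h = (1-p) p^(ξ+n)` this yields the exact identity
`e_c^{(q,h)}(x) = ẽ_c^{(q,ξ)}(x+s) · (p^{-c} s/(x+s);p)_∞ / (s/(x+s);p)_∞`
(`rawChar_eq_limitChar_mul`), whose right-hand side is jointly continuous in `(ξ, x, s)` near
`s = 0`. Compactness of `[0,1]` and of the set of the `x` then gives the local bounds, the
convergence along `h_n` and, since `ẽ^{(q,1)} = ẽ^{(q,0)}`, the list of all limits
(`eventually_qhChar_close`, `exists_subseq_qhChar`). For normality, a sequence of steps has a
subsequence which tends to `0`, where the previous result applies, or to some `h₀ > 0`. In the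
second case all members come from one meromorphic function of `u` by an affine change of variable;
writing this function locally as a quotient `A/B` of analytic functions without common zero, the
chordal distance in the homogeneous coordinates `[A : B]` is jointly continuous in `(h, x)`
(`eventually_chordalDist_qhChar_lt`).

**`q → 1`.** For `0 < p ≤ 1` put `w_j = [j+1]_p - p^j x/h`, `k_j = w_{j+1} - w_j` and
`d = [c]_p = (1-p^c)/(1-p)` (`d = c` if `p = 1`). Then, for `q > 1` and for `q = 1` alike,
`e_c^{(q,h)}(x) = lim_N E_N`, where `E_N = h^c ∏_{j<N} w_j/(w_j + d k_j) · w_N^c`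
(`tendsto_eulerApprox`); for `q = 1` this is Euler's limit formula for the Gamma function. With
`ρ_j = k_j/w_j` one has `E_{j+1}/E_j = (1+ρ_j)^c/(1+dρ_j) = 1 + O(|ρ_j|² + |d-c||ρ_j|)`, so the
relative error of `E_N` is uniformly small once the `ρ_j`, `j ≥ N`, are of the size `1/(j-N+B)`
with `B` large (`exists_norm_qhChar_sub_le`). When `h → h₀ > 0` this holds for large `N`, and the
finite product `E_N` is continuous in all the parameters. When `h → 0` with `h/(q-1)` bounded
below, it holds already for `N = 0`, with `B` of the order of `1/h`, and `E_0 = (h-x)^c`.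
-/

noncomputable section

/-! ### The infinite product `(x;p)_∞` -/

lemma summable_norm_pow_mul {p : ℝ} (hp : 0 < p) (hp1 : p < 1) (x : ℂ) :
    Summable fun j : ℕ => ‖-((p : ℂ) ^ j * x)‖ := by
  have h : Summable fun j : ℕ => p ^ j * ‖x‖ :=
    (summable_geometric_of_lt_one hp.le hp1).mul_right _
  refine h.congr fun j => ?_
  simp [abs_of_pos hp]

lemma multipliable_one_sub_pow_mul {p : ℝ} (hp : 0 < p) (hp1 : p < 1) (x : ℂ) :
    Multipliable fun j : ℕ => 1 - (p : ℂ) ^ j * x := by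
  simpa [sub_eq_add_neg] using
    multipliable_one_add_of_summable (summable_norm_pow_mul hp hp1 x)

lemma tendsto_prod_qPochInf {p : ℝ} (hp : 0 < p) (hp1 : p < 1) (x : ℂ) :
    Tendsto (fun N : ℕ => ∏ j ∈ Finset.range N, (1 - (p : ℂ) ^ j * x)) atTop
      (𝓝 (qPochInf p x)) :=
  (multipliable_one_sub_pow_mul hp hp1 x).hasProd.tendsto_prod_nat

lemma qPochInf_eq_mul {p : ℝ} (hp : 0 < p) (hp1 : p < 1) (x : ℂ) :
    qPochInf p x = (1 - x) * qPochInf p (p * x) := by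
  have h := tprod_eq_zero_mul' (f := fun j : ℕ => 1 - (p : ℂ) ^ j * x)
    (by simpa [pow_succ, mul_assoc] using multipliable_one_sub_pow_mul hp hp1 (p * x))
  simpa [qPochInf, pow_succ, mul_assoc] using h

lemma qPochInf_ne_zero {p : ℝ} (hp : 0 < p) (hp1 : p < 1) {x : ℂ}
    (hx : ∀ j : ℕ, (p : ℂ) ^ j * x ≠ 1) : qPochInf p x ≠ 0 := by
  have h := tprod_one_add_ne_zero_of_summable (f := fun j : ℕ => -((p : ℂ) ^ j * x))
    (fun j h => hx j (by linear_combination -h)) (summable_norm_pow_mul hp hp1 x)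
  simpa [qPochInf, sub_eq_add_neg] using h

lemma differentiable_qPochInf {p : ℝ} (hp : 0 < p) (hp1 : p < 1) :
    Differentiable ℂ (qPochInf p) := by
  have key : ∀ R : ℝ, DifferentiableOn ℂ (qPochInf p) (Metric.ball 0 R) := by
    intro R
    have hs : Summable fun j : ℕ => p ^ j * R :=
      (summable_geometric_of_lt_one hp.le hp1).mul_right _
    have h := Summable.hasProdLocallyUniformlyOn_nat_one_add
      (f := fun (j : ℕ) (x : ℂ) => -((p : ℂ) ^ j * x)) (Metric.isOpen_ball (α := ℂ) (x := 0) (ε := R))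
      hs (.of_forall fun j x hx => by
        rw [mem_ball_zero_iff] at hx
        simp only [norm_neg, norm_mul, norm_pow, Complex.norm_real, Real.norm_eq_abs,
          abs_of_pos hp]
        gcongr) (fun j => by fun_prop)
    have h2 := h.differentiableOn
      (.of_forall fun s => by
        simpa [Finset.prod_fn] using DifferentiableOn.finsetProd (fun _ _ => by fun_prop))
      Metric.isOpen_ball
    exact h2.congr fun x _ => by simp [qPochInf, sub_eq_add_neg]
  intro x
  exact (key (‖x‖ + 1)).differentiableAt (Metric.isOpen_ball.mem_nhds (by simp))

lemma analyticAt_qPochInf {p : ℝ} (hp : 0 < p) (hp1 : p < 1) (x : ℂ) :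
    AnalyticAt ℂ (qPochInf p) x :=
  (differentiable_qPochInf hp hp1).analyticAt x

lemma continuous_qPochInf {p : ℝ} (hp : 0 < p) (hp1 : p < 1) : Continuous (qPochInf p) :=
  (differentiable_qPochInf hp hp1).continuous

@[simp] lemma qPochInf_zero (p : ℝ) : qPochInf p 0 = 1 := by simp [qPochInf]

/-! ### The triple product formula for the theta function -/

/-- The finite product `(p;p)_k = ∏_{j < k} (1 - p^(j+1))`. -/
def qFact (p : ℝ) (k : ℕ) : ℂ := ∏ j ∈ Finset.range k, (1 - (p : ℂ) ^ (j + 1))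

/-- The Gaussian binomial coefficient, equal to `0` for `k > M`. -/
def qChoose (p : ℝ) (M k : ℕ) : ℂ :=
  if k ≤ M then qFact p M / (qFact p k * qFact p (M - k)) else 0

lemma one_sub_pow_ne_zero {p : ℝ} (hp : 0 < p) (hp1 : p < 1) (j : ℕ) :
    1 - (p : ℂ) ^ (j + 1) ≠ 0 := by
  have : p ^ (j + 1) < 1 := pow_lt_one₀ hp.le hp1 (by omega)
  rw [sub_ne_zero]
  exact_mod_cast this.ne'

lemma qFact_ne_zero {p : ℝ} (hp : 0 < p) (hp1 : p < 1) (k : ℕ) : qFact p k ≠ 0 :=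
  Finset.prod_ne_zero_iff.2 fun j _ => one_sub_pow_ne_zero hp hp1 j

lemma qFact_succ (p : ℝ) (k : ℕ) : qFact p (k + 1) = qFact p k * (1 - (p : ℂ) ^ (k + 1)) :=
  Finset.prod_range_succ _ _

@[simp] lemma qFact_zero (p : ℝ) : qFact p 0 = 1 := by simp [qFact]

lemma qChoose_zero_right {p : ℝ} (hp : 0 < p) (hp1 : p < 1) (M : ℕ) : qChoose p M 0 = 1 := by
  simp [qChoose, qFact_ne_zero hp hp1]

lemma qChoose_succ_succ {p : ℝ} (hp : 0 < p) (hp1 : p < 1) {M k : ℕ} (hk : k ≤ M) :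
    qChoose p (M + 1) (k + 1) = qChoose p M (k + 1) + (p : ℂ) ^ (M - k) * qChoose p M k := by
  rcases hk.eq_or_lt with rfl | hlt
  · simp [qChoose, qFact_ne_zero hp hp1]
  · obtain ⟨d, rfl⟩ := Nat.exists_eq_add_of_lt hlt
    have e1 : k + d + 1 + 1 - (k + 1) = d + 1 := by omega
    have e2 : k + d + 1 - (k + 1) = d := by omega
    have e3 : k + d + 1 - k = d + 1 := by omega
    have h1 : k + 1 ≤ k + d + 1 + 1 := by omega
    have h2 : k + 1 ≤ k + d + 1 := by omega
    have h3 : k ≤ k + d + 1 := by omega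
    simp only [qChoose, e1, e2, e3, h1, h2, h3, if_true]
    rw [qFact_succ p (k + d + 1), qFact_succ p k, qFact_succ p d]
    have a1 := qFact_ne_zero hp hp1 k
    have a2 := qFact_ne_zero hp hp1 d
    have a3 := one_sub_pow_ne_zero hp hp1 k
    have a4 := one_sub_pow_ne_zero hp hp1 d
    field_simp
    ring

/-- The `q`-binomial theorem for finite products. -/
lemma prod_one_sub_pow_mul {p : ℝ} (hp : 0 < p) (hp1 : p < 1) (M : ℕ) (t : ℂ) :
    ∏ j ∈ Finset.range M, (1 - (p : ℂ) ^ j * t) =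
      ∑ k ∈ Finset.range (M + 1), (-1) ^ k * (p : ℂ) ^ (k.choose 2) * qChoose p M k * t ^ k := by
  induction M with
  | zero => simp [qChoose]
  | succ M ih =>
    rw [Finset.prod_range_succ, Finset.sum_range_succ']
    have hlast : ∑ k ∈ Finset.range (M + 1), (-1) ^ k * (p : ℂ) ^ (k.choose 2) *
        qChoose p M k * t ^ k = ∑ k ∈ Finset.range (M + 1), (-1) ^ (k + 1) *
          (p : ℂ) ^ ((k + 1).choose 2) * qChoose p M (k + 1) * t ^ (k + 1) + 1 := by
      have h := Finset.sum_range_succ' (fun k => (-1) ^ k * (p : ℂ) ^ (k.choose 2) *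
        qChoose p M k * t ^ k) (M + 1)
      rw [Finset.sum_range_succ] at h
      simpa [qChoose_zero_right hp hp1, qChoose.eq_1 p M (M + 1)] using h
    have hterm : ∀ k ∈ Finset.range (M + 1), (-1) ^ (k + 1) * (p : ℂ) ^ ((k + 1).choose 2) *
        qChoose p (M + 1) (k + 1) * t ^ (k + 1) =
        (-1) ^ (k + 1) * (p : ℂ) ^ ((k + 1).choose 2) * qChoose p M (k + 1) * t ^ (k + 1) +
          -((p : ℂ) ^ M * t) *
            ((-1) ^ k * (p : ℂ) ^ (k.choose 2) * qChoose p M k * t ^ k) := by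
      intro k hk
      have hk' : k ≤ M := by simpa [Nat.lt_succ_iff] using hk
      rw [qChoose_succ_succ hp hp1 hk']
      have hM : (p : ℂ) ^ M = (p : ℂ) ^ k * (p : ℂ) ^ (M - k) := by
        rw [← pow_add]; congr 1; omega
      have hc : (k + 1).choose 2 = k + k.choose 2 := by
        rw [Nat.choose_succ_succ' k 1, Nat.choose_one_right]
      rw [hM, hc, pow_add]
      ring
    rw [Finset.sum_congr rfl hterm, Finset.sum_add_distrib, ← Finset.mul_sum, ih]
    simp only [Nat.choose_zero_succ, pow_zero, qChoose_zero_right hp hp1, mul_one]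
    linear_combination hlast

/-- The coefficient `q^(-n(n-1)/2)` of the theta series. -/
def thetaCoeff (q : ℝ) (n : ℤ) : ℂ := (q : ℂ) ^ (-(n * (n - 1) / 2))

lemma thetaCoeff_succ {q : ℝ} (hq : 1 < q) (n : ℤ) :
    thetaCoeff q (n + 1) = thetaCoeff q n * ((q⁻¹ : ℝ) : ℂ) ^ n := by
  have hq0 : (q : ℂ) ≠ 0 := by exact_mod_cast (by linarith : q ≠ 0)
  have e : (n + 1) * (n + 1 - 1) / 2 = n * (n - 1) / 2 + n := by
    rw [show (n + 1) * (n + 1 - 1) = n * (n - 1) + n * 2 by ring,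
      Int.add_mul_ediv_right _ _ (by norm_num)]
  rw [thetaCoeff, thetaCoeff, e, Complex.ofReal_inv, inv_zpow', ← zpow_add₀ hq0]
  congr 1
  ring

@[simp] lemma thetaCoeff_zero (q : ℝ) : thetaCoeff q 0 = 1 := by simp [thetaCoeff]

lemma thetaCoeff_ne_zero {q : ℝ} (hq : 1 < q) (n : ℤ) : thetaCoeff q n ≠ 0 :=
  zpow_ne_zero _ (by exact_mod_cast (by linarith : q ≠ 0))

lemma thetaCoeff_neg_succ {q : ℝ} (hq : 1 < q) (N : ℕ) :
    thetaCoeff q (-((N : ℤ) + 1)) = thetaCoeff q (-(N : ℤ)) * ((q⁻¹ : ℝ) : ℂ) ^ (N + 1) := by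
  have h := thetaCoeff_succ hq (-((N : ℤ) + 1))
  have hq0 : ((q⁻¹ : ℝ) : ℂ) ≠ 0 := by exact_mod_cast (by positivity : q⁻¹ ≠ 0)
  rw [show -((N : ℤ) + 1) + 1 = -(N : ℤ) by ring] at h
  rw [h, mul_assoc, ← zpow_natCast, ← zpow_add₀ hq0]
  simp

lemma summable_thetaCoeff {q : ℝ} (hq : 1 < q) {x : ℂ} (hx : x ≠ 0) :
    Summable fun n : ℤ => ‖thetaCoeff q n * x ^ n‖ := by
  have hp : 0 < q⁻¹ := by positivity
  have hp1 : q⁻¹ < 1 := inv_lt_one_of_one_lt₀ hq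
  have hT : ∀ n : ℤ, ‖thetaCoeff q n‖ ≠ 0 := fun n => norm_ne_zero_iff.2 (thetaCoeff_ne_zero hq n)
  have hx' : ‖x‖ ≠ 0 := norm_ne_zero_iff.2 hx
  have hpow := tendsto_pow_atTop_nhds_zero_of_lt_one hp.le hp1
  refine Summable.of_nat_of_neg ?_ ?_
  · refine summable_of_ratio_test_tendsto_lt_one (l := 0) one_pos
      (.of_forall fun n => by simp [thetaCoeff_ne_zero hq, hx]) ?_
    have : Tendsto (fun n : ℕ => (q⁻¹) ^ n * ‖x‖) atTop (𝓝 (0 * ‖x‖)) := hpow.mul_const _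
    rw [zero_mul] at this
    refine this.congr fun n => ?_
    have := hT n
    rw [norm_norm, norm_norm, Nat.cast_succ, thetaCoeff_succ hq, ← Nat.cast_succ, zpow_natCast,
      zpow_natCast, zpow_natCast, Nat.succ_eq_add_one, pow_succ]
    simp only [norm_mul, norm_pow, Complex.norm_real, Real.norm_eq_abs, abs_of_pos hp]
    field_simp
  · refine summable_of_ratio_test_tendsto_lt_one (l := 0) one_pos
      (.of_forall fun n => by simp [thetaCoeff_ne_zero hq, hx]) ?_
    have : Tendsto (fun n : ℕ => (q⁻¹) ^ n * (q⁻¹ * ‖x‖⁻¹)) atTop (𝓝 (0 * (q⁻¹ * ‖x‖⁻¹))) :=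
      hpow.mul_const _
    rw [zero_mul] at this
    refine this.congr fun n => ?_
    have := hT (-n)
    rw [norm_norm, norm_norm, Nat.cast_succ, thetaCoeff_neg_succ hq, ← Nat.cast_succ, zpow_neg,
      zpow_neg, zpow_natCast, zpow_natCast, Nat.succ_eq_add_one, pow_succ, pow_succ]
    simp only [norm_mul, norm_inv, norm_pow, Complex.norm_real, Real.norm_of_nonneg hp.le]
    generalize q⁻¹ = p at hp
    field_simp

/-- The coefficient of `thetaCoeff q n * (-x)^n` in the finite form of the triple product. -/
def tripleCoeff (p : ℝ) (N : ℕ) (n : ℤ) : ℂ :=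
  if -(N : ℤ) ≤ n then qChoose p (2 * N) (n + N).toNat else 0

/-- The factors `1 - p^(-j) x` are rewritten as `-p^(-j) x (1 - p^j/x)`; the powers of `p` make up
the inverse of `q^(-N(N+1)/2)`. -/
lemma prod_mul_thetaCoeff {q : ℝ} (hq : 1 < q) {x : ℂ} (hx : x ≠ 0) (N : ℕ) :
    (∏ j ∈ Finset.range N, (1 - ((q⁻¹ : ℝ) : ℂ) ^ (-((j : ℤ) + 1)) * x)) * thetaCoeff q (-N) =
      (-x) ^ N * ∏ j ∈ Finset.range N, (1 - ((q⁻¹ : ℝ) : ℂ) ^ j * ((q⁻¹ : ℝ) / x)) := by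
  have hp0 : ((q⁻¹ : ℝ) : ℂ) ≠ 0 := by exact_mod_cast (by positivity : q⁻¹ ≠ 0)
  induction N with
  | zero => simp
  | succ N ih =>
    rw [Finset.prod_range_succ, Finset.prod_range_succ, Nat.cast_add, Nat.cast_one,
      thetaCoeff_neg_succ hq, pow_succ (-x)]
    have e : (1 - ((q⁻¹ : ℝ) : ℂ) ^ (-((N : ℤ) + 1)) * x) * ((q⁻¹ : ℝ) : ℂ) ^ (N + 1) =
        -x * (1 - ((q⁻¹ : ℝ) : ℂ) ^ N * ((q⁻¹ : ℝ) / x)) := by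
      rw [zpow_neg, ← Nat.cast_succ, zpow_natCast, Nat.succ_eq_add_one]
      generalize ((q⁻¹ : ℝ) : ℂ) = p at hp0
      field_simp
      ring
    linear_combination (1 - ((q⁻¹ : ℝ) : ℂ) ^ (-((N : ℤ) + 1)) * x) *
      ((q⁻¹ : ℝ) : ℂ) ^ (N + 1) * ih + ((-x) ^ N *
        ∏ j ∈ Finset.range N, (1 - ((q⁻¹ : ℝ) : ℂ) ^ j * ((q⁻¹ : ℝ) / x))) * e

lemma pow_choose_mul_thetaCoeff {q : ℝ} (hq : 1 < q) (N k : ℕ) :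
    ((q⁻¹ : ℝ) : ℂ) ^ (k.choose 2) * ((q⁻¹ : ℝ) : ℂ) ^ (-((N : ℤ) * k)) * thetaCoeff q (-N) =
      thetaCoeff q (k - N) := by
  have hp0 : ((q⁻¹ : ℝ) : ℂ) ≠ 0 := by exact_mod_cast (by positivity : q⁻¹ ≠ 0)
  induction k with
  | zero => simp
  | succ k ih =>
    have hc : (k + 1).choose 2 = k + k.choose 2 := by
      rw [Nat.choose_succ_succ' k 1, Nat.choose_one_right]
    rw [show ((k + 1 : ℕ) : ℤ) - N = (k - N : ℤ) + 1 by push_cast; ring, thetaCoeff_succ hq, ← ih,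
      hc, pow_add, show -((N : ℤ) * ((k + 1 : ℕ) : ℤ)) = -((N : ℤ) * k) + -N by push_cast; ring,
      zpow_add₀ hp0, sub_eq_add_neg, zpow_add₀ hp0 (k : ℤ), zpow_natCast]
    ring

/-- The finite form of the triple product formula. -/
lemma prod_mul_prod_eq_tsum {q : ℝ} (hq : 1 < q) {x : ℂ} (hx : x ≠ 0) (N : ℕ) :
    (∏ j ∈ Finset.range N, (1 - ((q⁻¹ : ℝ) : ℂ) ^ j * x)) *
        ∏ j ∈ Finset.range N, (1 - ((q⁻¹ : ℝ) : ℂ) ^ j * ((q⁻¹ : ℝ) / x)) =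
      ∑' n : ℤ, (-1) ^ n * thetaCoeff q n * x ^ n * tripleCoeff q⁻¹ N n := by
  have hp : 0 < q⁻¹ := by positivity
  have hp1 : q⁻¹ < 1 := inv_lt_one_of_one_lt₀ hq
  have hp0 : ((q⁻¹ : ℝ) : ℂ) ≠ 0 := by exact_mod_cast (by positivity : q⁻¹ ≠ 0)
  have hinj : Function.Injective fun k : ℕ => (k : ℤ) - N := fun a b h => by
    simpa using h
  rw [tsum_eq_sum (s := (Finset.range (2 * N + 1)).map ⟨_, hinj⟩)]
  · rw [Finset.sum_map]
    have hx' : (-x) ^ N ≠ 0 := pow_ne_zero _ (neg_ne_zero.2 hx)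
    refine mul_left_cancel₀ hx' ?_
    have h1 := prod_one_sub_pow_mul hp hp1 (2 * N) (((q⁻¹ : ℝ) : ℂ) ^ (-(N : ℤ)) * x)
    rw [two_mul, Finset.prod_range_add] at h1
    have h2 : ∏ j ∈ Finset.range N,
        (1 - ((q⁻¹ : ℝ) : ℂ) ^ (N + j) * (((q⁻¹ : ℝ) : ℂ) ^ (-(N : ℤ)) * x)) =
        ∏ j ∈ Finset.range N, (1 - ((q⁻¹ : ℝ) : ℂ) ^ j * x) := by
      refine Finset.prod_congr rfl fun j _ => ?_
      rw [pow_add, zpow_neg, zpow_natCast]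
      generalize ((q⁻¹ : ℝ) : ℂ) = p at hp0
      field_simp
    have h3 : ∏ j ∈ Finset.range N,
        (1 - ((q⁻¹ : ℝ) : ℂ) ^ j * (((q⁻¹ : ℝ) : ℂ) ^ (-(N : ℤ)) * x)) =
        ∏ j ∈ Finset.range N, (1 - ((q⁻¹ : ℝ) : ℂ) ^ (-((j : ℤ) + 1)) * x) := by
      rw [← Finset.prod_range_reflect]
      refine Finset.prod_congr rfl fun j hj => ?_
      have hj' := Finset.mem_range.1 hj
      rw [← zpow_natCast, ← mul_assoc, ← zpow_add₀ hp0]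
      congr 3
      omega
    rw [h2, h3] at h1
    have h4 := prod_mul_thetaCoeff hq hx N
    calc (-x) ^ N * ((∏ j ∈ Finset.range N, (1 - ((q⁻¹ : ℝ) : ℂ) ^ j * x)) *
        ∏ j ∈ Finset.range N, (1 - ((q⁻¹ : ℝ) : ℂ) ^ j * ((q⁻¹ : ℝ) / x)))
        = ((∏ j ∈ Finset.range N, (1 - ((q⁻¹ : ℝ) : ℂ) ^ (-((j : ℤ) + 1)) * x)) *
          ∏ j ∈ Finset.range N, (1 - ((q⁻¹ : ℝ) : ℂ) ^ j * x)) * thetaCoeff q (-N) := by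
          linear_combination -(∏ j ∈ Finset.range N, (1 - ((q⁻¹ : ℝ) : ℂ) ^ j * x)) * h4
      _ = _ := by
          rw [h1, Finset.sum_mul, Finset.mul_sum, ← two_mul]
          refine Finset.sum_congr rfl fun k hk => ?_
          have hk' := Finset.mem_range.1 hk
          simp only [Function.Embedding.coeFn_mk]
          have e1 : tripleCoeff q⁻¹ N ((k : ℤ) - N) = qChoose q⁻¹ (2 * N) k := by
            simp [tripleCoeff]
          have e2 := pow_choose_mul_thetaCoeff hq N k
          have e3 : (((q⁻¹ : ℝ) : ℂ) ^ (-(N : ℤ)) * x) ^ k =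
              ((q⁻¹ : ℝ) : ℂ) ^ (-((N : ℤ) * k)) * x ^ k := by
            rw [mul_pow, ← zpow_natCast (_ ^ _), ← zpow_mul, neg_mul]
          have e4 : (-1 : ℂ) ^ k * x ^ k = (-x) ^ N * ((-1) ^ ((k : ℤ) - N) * x ^ ((k : ℤ) - N)) := by
            rw [← mul_zpow, ← mul_pow, neg_one_mul, zpow_sub₀ (neg_ne_zero.2 hx), zpow_natCast,
              zpow_natCast]
            field_simp
          rw [e1, e3, ← e2]
          linear_combination (((q⁻¹ : ℝ) : ℂ) ^ (k.choose 2) * ((q⁻¹ : ℝ) : ℂ) ^ (-((N : ℤ) * k)) *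
            thetaCoeff q (-N) * qChoose q⁻¹ (2 * N) k) * e4
  · intro n hn
    have : tripleCoeff q⁻¹ N n = 0 := by
      unfold tripleCoeff
      split_ifs with h
      · rw [qChoose, if_neg]
        intro h'
        refine hn (Finset.mem_map.2 ⟨(n + N).toNat, Finset.mem_range.2 (by omega), ?_⟩)
        simp only [Function.Embedding.coeFn_mk]
        omega
      · rfl
    rw [this, mul_zero]

/-- Jacobi's triple product formula. -/
theorem theta_eq_mul {q : ℝ} (hq : 1 < q) {x : ℂ} (hx : x ≠ 0) :
    theta q x = qPochInf q⁻¹ (q⁻¹ : ℝ) * (qPochInf q⁻¹ x * qPochInf q⁻¹ ((q⁻¹ : ℝ) / x)) := by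
  have hp : 0 < q⁻¹ := by positivity
  have hp1 : q⁻¹ < 1 := inv_lt_one_of_one_lt₀ hq
  set p : ℝ := q⁻¹
  have hF : Tendsto (qFact p) atTop (𝓝 (qPochInf p p)) := by
    refine (tendsto_prod_qPochInf hp hp1 p).congr fun N => ?_
    simp [qFact, pow_succ]
  have hF0 : qPochInf p p ≠ 0 := qPochInf_ne_zero hp hp1 fun j h =>
    one_sub_pow_ne_zero hp hp1 j (by rw [pow_succ, h, sub_self])
  obtain ⟨A, hA⟩ : ∃ A, ∀ k, ‖qFact p k‖ ≤ A := by
    obtain ⟨A, hA⟩ := (Metric.isBounded_range_of_tendsto _ hF).exists_norm_le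
    exact ⟨A, fun k => hA _ ⟨k, rfl⟩⟩
  obtain ⟨B, hB⟩ : ∃ B, ∀ k, ‖(qFact p k)⁻¹‖ ≤ B := by
    obtain ⟨B, hB⟩ := (Metric.isBounded_range_of_tendsto _ (hF.inv₀ hF0)).exists_norm_le
    exact ⟨B, fun k => hB _ ⟨k, rfl⟩⟩
  have hA0 : 0 ≤ A := (norm_nonneg _).trans (hA 0)
  have hB0 : 0 ≤ B := (norm_nonneg _).trans (hB 0)
  have hT : ∀ N n, ‖tripleCoeff p N n‖ ≤ A * (B * B) := by
    intro N n
    unfold tripleCoeff qChoose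
    split_ifs
    · rw [div_eq_mul_inv, mul_inv, norm_mul, norm_mul]
      gcongr
      exacts [hA _, hB _, hB _]
    · simpa using by positivity
    · simpa using by positivity
  have hlim : Tendsto (fun N : ℕ => ∑' n : ℤ, (-1) ^ n * thetaCoeff q n * x ^ n *
      tripleCoeff p N n) atTop
      (𝓝 (∑' n : ℤ, (-1) ^ n * thetaCoeff q n * x ^ n * (qPochInf p p)⁻¹)) := by
    refine tendsto_tsum_of_dominated_convergence
      (bound := fun n => ‖thetaCoeff q n * x ^ n‖ * (A * (B * B)))
      ((summable_thetaCoeff hq hx).mul_right _) ?_ (.of_forall fun N n => ?_)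
    · intro n
      refine Tendsto.const_mul _ ?_
      have t1 : Tendsto (fun N : ℕ => (n + N).toNat) atTop atTop := by
        refine tendsto_atTop.2 fun b => ?_
        filter_upwards [eventually_ge_atTop (b + n.natAbs)] with N hN
        omega
      have t2 : Tendsto (fun N : ℕ => 2 * N - (n + N).toNat) atTop atTop := by
        refine tendsto_atTop.2 fun b => ?_
        filter_upwards [eventually_ge_atTop (b + n.natAbs)] with N hN
        omega
      have t3 : Tendsto (fun N : ℕ => 2 * N) atTop atTop :=
        tendsto_id.const_mul_atTop' (by norm_num)
      have h := (hF.comp t3).div ((hF.comp t1).mul (hF.comp t2)) (mul_ne_zero hF0 hF0)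
      have e : qPochInf p p / (qPochInf p p * qPochInf p p) = (qPochInf p p)⁻¹ := by
        field_simp
      rw [e] at h
      refine h.congr' ?_
      filter_upwards [eventually_ge_atTop n.natAbs] with N hN
      have h1 : -(N : ℤ) ≤ n := by omega
      have h2 : (n + N).toNat ≤ 2 * N := by omega
      simp [tripleCoeff, qChoose, h1, h2]
    · rw [norm_mul]
      refine mul_le_mul (le_of_eq ?_) (hT N n) (norm_nonneg _) (norm_nonneg _)
      simp [norm_zpow]
  have hlim2 := (tendsto_prod_qPochInf hp hp1 x).mul (tendsto_prod_qPochInf hp hp1 (p / x))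
  have heq := tendsto_nhds_unique hlim2
    (hlim.congr fun N => (prod_mul_prod_eq_tsum hq hx N).symm)
  rw [heq, tsum_mul_right, mul_comm _ (qPochInf p p)⁻¹, ← mul_assoc, mul_inv_cancel₀ hF0, one_mul]
  rfl

/-! ### Meromorphic normal forms -/

lemma toMeromorphicNFOn_apply_of_analyticAt {f : ℂ → ℂ} {U : Set ℂ} {x : ℂ}
    (hf : MeromorphicOn f U) (hx : x ∈ U) (h : AnalyticAt ℂ f x) :
    toMeromorphicNFOn f U x = f x := by
  rw [toMeromorphicNFOn_eq_toMeromorphicNFAt hf hx,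
    toMeromorphicNFAt_eq_self.2 h.meromorphicNFAt]

lemma analyticAt_toMeromorphicNFOn {f : ℂ → ℂ} {U : Set ℂ} {x : ℂ}
    (hf : MeromorphicOn f U) (hx : x ∈ U) (h : AnalyticAt ℂ f x) :
    AnalyticAt ℂ (toMeromorphicNFOn f U) x := by
  rw [← (meromorphicNFOn_toMeromorphicNFOn f U hx).meromorphicOrderAt_nonneg_iff_analyticAt,
    meromorphicOrderAt_toMeromorphicNFOn hf hx]
  exact h.meromorphicOrderAt_nonneg

/-! ### The theta function away from the origin -/

lemma analyticAt_theta {q : ℝ} (hq : 1 < q) {x : ℂ} (hx : x ≠ 0) : AnalyticAt ℂ (theta q) x := by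
  have hp : 0 < q⁻¹ := by positivity
  have hp1 : q⁻¹ < 1 := inv_lt_one_of_one_lt₀ hq
  have h : AnalyticAt ℂ (fun x => qPochInf q⁻¹ (q⁻¹ : ℝ) *
      (qPochInf q⁻¹ x * qPochInf q⁻¹ ((q⁻¹ : ℝ) / x))) x :=
    analyticAt_const.mul ((analyticAt_qPochInf hp hp1 x).mul
      ((analyticAt_qPochInf hp hp1 _).comp (analyticAt_const.div analyticAt_id hx)))
  refine h.congr ?_
  filter_upwards [isOpen_ne.mem_nhds hx] with y hy
  exact (theta_eq_mul hq hy).symm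

lemma qPochInf_self_ne_zero {p : ℝ} (hp : 0 < p) (hp1 : p < 1) : qPochInf p p ≠ 0 :=
  qPochInf_ne_zero hp hp1 fun j h => one_sub_pow_ne_zero hp hp1 j (by rw [pow_succ, h, sub_self])

/-- On `ℂ \ {0}`, the function `Θ_q` has no zeros besides the integral powers of `q`. -/
lemma theta_ne_zero {q : ℝ} (hq : 1 < q) {x : ℂ} (hx : x ≠ 0) (h : ∀ k : ℤ, x ≠ (q : ℂ) ^ k) :
    theta q x ≠ 0 := by
  have hp : 0 < q⁻¹ := by positivity
  have hp1 : q⁻¹ < 1 := inv_lt_one_of_one_lt₀ hq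
  have hq0 : (q : ℂ) ≠ 0 := by exact_mod_cast (by linarith : q ≠ 0)
  rw [theta_eq_mul hq hx]
  refine mul_ne_zero (qPochInf_self_ne_zero hp hp1) (mul_ne_zero
    (qPochInf_ne_zero hp hp1 fun j hj => h j ?_)
    (qPochInf_ne_zero hp hp1 fun j hj => h (-(j + 1 : ℕ)) ?_))
  · rw [Complex.ofReal_inv, inv_pow, inv_mul_eq_one₀ (pow_ne_zero _ hq0)] at hj
    rw [zpow_natCast, hj]
  · rw [Complex.ofReal_inv, inv_pow, inv_mul_eq_one₀ (pow_ne_zero _ hq0), eq_div_iff hx] at hj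
    rw [zpow_neg, zpow_natCast, pow_succ, mul_inv, ← hj, inv_mul_cancel_left₀ (pow_ne_zero _ hq0)]

lemma theta_eq_neg_mul {q : ℝ} (hq : 1 < q) {x : ℂ} (hx : x ≠ 0) :
    theta q x = -x * theta q ((q⁻¹ : ℝ) * x) := by
  have hp : 0 < q⁻¹ := by positivity
  have hp1 : q⁻¹ < 1 := inv_lt_one_of_one_lt₀ hq
  have hp0 : ((q⁻¹ : ℝ) : ℂ) ≠ 0 := by exact_mod_cast hp.ne'
  rw [theta_eq_mul hq hx, theta_eq_mul hq (mul_ne_zero hp0 hx), qPochInf_eq_mul hp hp1 x,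
    show ((q⁻¹ : ℝ) : ℂ) / ((q⁻¹ : ℝ) * x) = x⁻¹ by rw [div_mul_eq_div_div, div_self hp0, one_div], qPochInf_eq_mul hp hp1 x⁻¹,
    div_eq_mul_inv]
  field_simp
  ring

lemma theta_div_theta {q : ℝ} (hq : 1 < q) {a x : ℂ} (ha : a ≠ 0) (hx : x ≠ 0) (n : ℕ) :
    theta q x / theta q (a * x) = (a ^ n)⁻¹ *
      (theta q (((q⁻¹ : ℝ) : ℂ) ^ n * x) / theta q (a * (((q⁻¹ : ℝ) : ℂ) ^ n * x))) := by
  have hp0 : ((q⁻¹ : ℝ) : ℂ) ≠ 0 := by exact_mod_cast (by positivity : q⁻¹ ≠ 0)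
  induction n with
  | zero => simp
  | succ n ih =>
    have hy : ((q⁻¹ : ℝ) : ℂ) ^ n * x ≠ 0 := mul_ne_zero (pow_ne_zero _ hp0) hx
    rw [ih, theta_eq_neg_mul hq hy, theta_eq_neg_mul hq (mul_ne_zero ha hy),
      show ((q⁻¹ : ℝ) : ℂ) * (((q⁻¹ : ℝ) : ℂ) ^ n * x) = ((q⁻¹ : ℝ) : ℂ) ^ (n + 1) * x by ring,
      show ((q⁻¹ : ℝ) : ℂ) * (a * (((q⁻¹ : ℝ) : ℂ) ^ n * x)) =
        a * (((q⁻¹ : ℝ) : ℂ) ^ (n + 1) * x) by ring, neg_mul, neg_mul, neg_div_neg_eq,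
      mul_div_mul_comm, mul_comm a, div_mul_cancel_left₀ hy, pow_succ a, mul_inv, mul_assoc]

/-- A quotient of infinite products as a quotient of theta functions. -/
lemma qPochInf_div_eq_theta_div {q : ℝ} (hq : 1 < q) {a u : ℂ} (ha : a ≠ 0) (hu : u ≠ 0)
    (h1 : qPochInf q⁻¹ ((q⁻¹ : ℝ) / u) ≠ 0) (h2 : qPochInf q⁻¹ ((q⁻¹ : ℝ) / (a * u)) ≠ 0) :
    qPochInf q⁻¹ u / qPochInf q⁻¹ (a * u) = theta q u / theta q (a * u) *
      (qPochInf q⁻¹ ((q⁻¹ : ℝ) / (a * u)) / qPochInf q⁻¹ ((q⁻¹ : ℝ) / u)) := by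
  have hp : 0 < q⁻¹ := by positivity
  have hp1 : q⁻¹ < 1 := inv_lt_one_of_one_lt₀ hq
  have h3 := qPochInf_self_ne_zero hp hp1
  rw [theta_eq_mul hq hu, theta_eq_mul hq (mul_ne_zero ha hu)]
  generalize q⁻¹ = p at *
  by_cases h4 : qPochInf p (a * u) = 0
  · simp [h4]
  · field_simp

/-! ### The half-line `q^c ℝ⁺` -/

lemma zero_mem_ray (q : ℝ) (c : ℂ) : (0 : ℂ) ∈ ray q c := ⟨0, le_rfl, by simp⟩

lemma isClosed_ray {q : ℝ} (hq : 1 < q) (c : ℂ) : IsClosed (ray q c) := by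
  have hq0 : (q : ℂ) ≠ 0 := by exact_mod_cast (by linarith : q ≠ 0)
  have hqc : (q : ℂ) ^ c ≠ 0 := by simp [Complex.cpow_eq_zero_iff, hq0]
  have h : ray q c = (fun x : ℂ => ((q : ℂ) ^ c)⁻¹ * x) ⁻¹' ((↑) '' Set.Ici (0 : ℝ)) := by
    ext x
    constructor
    · rintro ⟨t, ht, rfl⟩
      exact ⟨t, ht, by field_simp⟩
    · rintro ⟨t, ht, h⟩
      refine ⟨t, ht, ?_⟩
      simp only at h
      rw [h]
      field_simp
  rw [h]
  exact (Complex.isometry_ofReal.isClosedEmbedding.isClosedMap _ isClosed_Ici).preimage (by fun_prop)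

lemma isOpen_compl_ray {q : ℝ} (hq : 1 < q) (c : ℂ) : IsOpen (ray q c)ᶜ :=
  (isClosed_ray hq c).isOpen_compl

lemma ne_zero_of_notMem_ray {q : ℝ} {c x : ℂ} (hx : x ∈ (ray q c)ᶜ) : x ≠ 0 := by
  rintro rfl
  exact hx (zero_mem_ray q c)

lemma inv_cpow_mul_cpow {q : ℝ} (hq : 1 < q) (c : ℂ) :
    ((q⁻¹ : ℝ) : ℂ) ^ c * (q : ℂ) ^ c = 1 := by
  rw [← Complex.mul_cpow_ofReal_nonneg (by positivity) (by positivity), ← Complex.ofReal_mul,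
    inv_mul_cancel₀ (by positivity)]
  simp

lemma inv_cpow_eq_cpow_neg {q : ℝ} (hq : 1 < q) (c : ℂ) :
    ((q⁻¹ : ℝ) : ℂ) ^ c = (q : ℂ) ^ (-c) := by
  have hq0 : (q : ℂ) ≠ 0 := by exact_mod_cast (by linarith : q ≠ 0)
  have hqc : (q : ℂ) ^ c ≠ 0 := by simp [Complex.cpow_eq_zero_iff, hq0]
  rw [Complex.cpow_neg]
  exact eq_inv_of_mul_eq_one_left (inv_cpow_mul_cpow hq c)

/-- Outside the half-line `q^c ℝ⁺`, the product `p^c x` is not a nonnegative real number. -/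
lemma cpow_mul_ne_ofReal {q : ℝ} (hq : 1 < q) {c x : ℂ} (hx : x ∈ (ray q c)ᶜ) {r : ℝ}
    (hr : 0 ≤ r) : ((q⁻¹ : ℝ) : ℂ) ^ c * x ≠ r := by
  intro h
  refine hx ⟨r, hr, ?_⟩
  rw [← h, ← mul_assoc, mul_comm ((q : ℂ) ^ c), inv_cpow_mul_cpow hq, one_mul]

/-! ### The character for `q > 1`, `h > 0` -/

/-- The quotient of infinite products whose normal form is `e_c^{(q,h)}`, for `q > 1`, `h > 0`. -/
def rawChar (q h : ℝ) (c x : ℂ) : ℂ :=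
  ((h / (1 - q⁻¹) : ℝ) : ℂ) ^ c *
    (qPochInf q⁻¹ ((1 - (q⁻¹ : ℝ)) * (x / h) + (q⁻¹ : ℝ)) /
      qPochInf q⁻¹ (((q⁻¹ : ℝ) : ℂ) ^ c * ((1 - (q⁻¹ : ℝ)) * (x / h) + (q⁻¹ : ℝ))))

lemma qhChar_eq_rawChar {q h : ℝ} (hq : 1 < q) (hh : 0 < h) (c : ℂ) :
    qhChar q h c = toMeromorphicNFOn (rawChar q h c) Set.univ := by
  rw [qhChar, if_pos hq, if_pos hh]
  rfl

lemma meromorphicOn_rawChar {q : ℝ} (hq : 1 < q) (h : ℝ) (c : ℂ) :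
    MeromorphicOn (rawChar q h c) Set.univ := by
  have hp : 0 < q⁻¹ := by positivity
  have hp1 : q⁻¹ < 1 := inv_lt_one_of_one_lt₀ hq
  have hd := differentiable_qPochInf hp hp1
  intro x _
  refine (MeromorphicAt.const _ x).mul (MeromorphicAt.div (AnalyticAt.meromorphicAt ?_)
    (AnalyticAt.meromorphicAt ?_))
  · exact Differentiable.analyticAt
      (f := fun x : ℂ => qPochInf q⁻¹ ((1 - (q⁻¹ : ℝ)) * (x / h) + (q⁻¹ : ℝ))) (by fun_prop) x
  · exact Differentiable.analyticAt (f := fun x : ℂ => qPochInf q⁻¹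
      (((q⁻¹ : ℝ) : ℂ) ^ c * ((1 - (q⁻¹ : ℝ)) * (x / h) + (q⁻¹ : ℝ)))) (by fun_prop) x

lemma analyticAt_rawChar {q h : ℝ} (hq : 1 < q) {c x : ℂ}
    (hne : qPochInf q⁻¹ (((q⁻¹ : ℝ) : ℂ) ^ c * ((1 - (q⁻¹ : ℝ)) * (x / h) + (q⁻¹ : ℝ))) ≠ 0) :
    AnalyticAt ℂ (rawChar q h c) x := by
  have hp : 0 < q⁻¹ := by positivity
  have hp1 : q⁻¹ < 1 := inv_lt_one_of_one_lt₀ hq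
  have hd := differentiable_qPochInf hp hp1
  refine analyticAt_const.mul (AnalyticAt.div ?_ ?_ hne)
  · exact Differentiable.analyticAt
      (f := fun x : ℂ => qPochInf q⁻¹ ((1 - (q⁻¹ : ℝ)) * (x / h) + (q⁻¹ : ℝ))) (by fun_prop) x
  · exact Differentiable.analyticAt (f := fun x : ℂ => qPochInf q⁻¹
      (((q⁻¹ : ℝ) : ℂ) ^ c * ((1 - (q⁻¹ : ℝ)) * (x / h) + (q⁻¹ : ℝ)))) (by fun_prop) x

lemma qhChar_apply {q h : ℝ} (hq : 1 < q) (hh : 0 < h) {c x : ℂ}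
    (hne : qPochInf q⁻¹ (((q⁻¹ : ℝ) : ℂ) ^ c * ((1 - (q⁻¹ : ℝ)) * (x / h) + (q⁻¹ : ℝ))) ≠ 0) :
    qhChar q h c x = rawChar q h c x := by
  rw [qhChar_eq_rawChar hq hh]
  exact toMeromorphicNFOn_apply_of_analyticAt (meromorphicOn_rawChar hq h c) (mem_univ _)
    (analyticAt_rawChar hq hne)

lemma analyticAt_qhChar {q h : ℝ} (hq : 1 < q) (hh : 0 < h) {c x : ℂ}
    (hne : qPochInf q⁻¹ (((q⁻¹ : ℝ) : ℂ) ^ c * ((1 - (q⁻¹ : ℝ)) * (x / h) + (q⁻¹ : ℝ))) ≠ 0) :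
    AnalyticAt ℂ (qhChar q h c) x := by
  rw [qhChar_eq_rawChar hq hh]
  exact analyticAt_toMeromorphicNFOn (meromorphicOn_rawChar hq h c) (mem_univ _)
    (analyticAt_rawChar hq hne)

lemma ofReal_pow_cpow {r : ℝ} (hr : 0 ≤ r) (c : ℂ) (n : ℕ) :
    ((r ^ n : ℝ) : ℂ) ^ c = ((r : ℂ) ^ c) ^ n := by
  induction n with
  | zero => simp
  | succ n ih =>
    rw [pow_succ, Complex.ofReal_mul, Complex.mul_cpow_ofReal_nonneg (pow_nonneg hr n) hr, ih,
      pow_succ]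

lemma limitChar_eq {q : ℝ} (hq : 1 < q) (ξ : ℝ) (c x : ℂ) :
    limitChar q ξ c x = ((q⁻¹ ^ ξ : ℝ) : ℂ) ^ c *
      (theta q (((q⁻¹ ^ ξ)⁻¹ : ℝ) * x) /
        theta q (((q⁻¹ : ℝ) : ℂ) ^ c * (((q⁻¹ ^ ξ)⁻¹ : ℝ) * x))) := by
  have hp : 0 < q⁻¹ := by positivity
  have hp0 : ((q⁻¹ : ℝ) : ℂ) ≠ 0 := by exact_mod_cast hp.ne'
  have e1 : ((q⁻¹ : ℝ) : ℂ) ^ ((ξ : ℂ) * c) = ((q⁻¹ ^ ξ : ℝ) : ℂ) ^ c := by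
    rw [Complex.cpow_def_of_ne_zero hp0, Complex.cpow_def_of_ne_zero
      (by exact_mod_cast (Real.rpow_pos_of_pos hp ξ).ne'), ← Complex.ofReal_log hp.le,
      ← Complex.ofReal_log (Real.rpow_pos_of_pos hp ξ).le, Real.log_rpow hp]
    push_cast
    ring_nf
  have e2 : ((q⁻¹ : ℝ) : ℂ) ^ (ξ : ℂ) = ((q⁻¹ ^ ξ : ℝ) : ℂ) := (Complex.ofReal_cpow hp.le ξ).symm
  rw [limitChar, e1, thetaShift, thetaShift, e2, mul_inv, Complex.cpow_neg, inv_inv,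
    Complex.ofReal_inv (q⁻¹ ^ ξ), mul_comm (((q⁻¹ ^ ξ : ℝ) : ℂ)⁻¹) (_ ^ c), mul_assoc (_ ^ c)]

/-- For `h = (1-p) p^(ξ+n)` and `s = h / (q-1)`, the character is a value of the limit character
at the point `x + s`, up to a factor which tends to `1` with `s`. -/
lemma rawChar_eq_limitChar_mul {q : ℝ} (hq : 1 < q) (ξ : ℝ) (n : ℕ) {c x : ℂ} {h s : ℝ}
    (hh : h = (1 - q⁻¹) * q⁻¹ ^ (ξ + (n : ℝ))) (hs : s = q⁻¹ * q⁻¹ ^ (ξ + (n : ℝ)))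
    (hx : x + s ≠ 0) (h1 : qPochInf q⁻¹ (s / (x + s)) ≠ 0)
    (h2 : qPochInf q⁻¹ (((q⁻¹ : ℝ) : ℂ) ^ (-c) * (s / (x + s))) ≠ 0) :
    rawChar q h c x = limitChar q ξ c (x + s) *
      (qPochInf q⁻¹ (((q⁻¹ : ℝ) : ℂ) ^ (-c) * (s / (x + s))) / qPochInf q⁻¹ (s / (x + s))) := by
  have hp : 0 < q⁻¹ := by positivity
  have hp1 : q⁻¹ < 1 := inv_lt_one_of_one_lt₀ hq
  have hp0 : ((q⁻¹ : ℝ) : ℂ) ≠ 0 := by exact_mod_cast hp.ne'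
  have hpc : ((q⁻¹ : ℝ) : ℂ) ^ c ≠ 0 := by rw [Ne, Complex.cpow_eq_zero_iff]; tauto
  have hpξ := Real.rpow_pos_of_pos hp ξ
  have hr : q⁻¹ ^ (ξ + (n : ℝ)) = q⁻¹ ^ ξ * q⁻¹ ^ n := by
    rw [Real.rpow_add hp, Real.rpow_natCast]
  have hξ0 : ((q⁻¹ ^ ξ : ℝ) : ℂ) ≠ 0 := by exact_mod_cast hpξ.ne'
  have hu : (1 - (q⁻¹ : ℝ)) * (x / h) + (q⁻¹ : ℝ) =
      (((q⁻¹ : ℝ) : ℂ) ^ n)⁻¹ * (((q⁻¹ ^ ξ)⁻¹ : ℝ) * (x + s)) := by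
    have h1p : (1 : ℂ) - ((q⁻¹ : ℝ) : ℂ) ≠ 0 := by
      rw [sub_ne_zero]; exact_mod_cast hp1.ne'
    rw [hh, hs, hr, Complex.ofReal_inv (q⁻¹ ^ ξ)]
    generalize q⁻¹ = p at *
    push_cast at *
    generalize ((p ^ ξ : ℝ) : ℂ) = a at *
    field_simp
  set u : ℂ := (1 - (q⁻¹ : ℝ)) * (x / h) + (q⁻¹ : ℝ) with hudef
  have hu0 : u ≠ 0 := by
    rw [hu]
    refine mul_ne_zero (inv_ne_zero (pow_ne_zero _ hp0)) (mul_ne_zero ?_ hx)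
    rw [Complex.ofReal_inv]
    exact inv_ne_zero hξ0
  have e1 : ((q⁻¹ : ℝ) : ℂ) / u = s / (x + s) := by
    rw [hu, hs, hr, Complex.ofReal_inv (q⁻¹ ^ ξ)]
    generalize q⁻¹ = p at *
    push_cast
    field_simp
  have e2 : ((q⁻¹ : ℝ) : ℂ) / (((q⁻¹ : ℝ) : ℂ) ^ c * u) =
      ((q⁻¹ : ℝ) : ℂ) ^ (-c) * (s / (x + s)) := by
    rw [← e1, Complex.cpow_neg, div_mul_eq_div_div_swap, div_eq_inv_mul]
  rw [rawChar, ← hudef, qPochInf_div_eq_theta_div hq hpc hu0 (by rwa [e1]) (by rwa [e2]), e1, e2,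
    theta_div_theta hq hpc hu0 n, limitChar_eq hq, hu, mul_inv_cancel_left₀ (pow_ne_zero _ hp0)]
  have e3 : ((h / (1 - q⁻¹) : ℝ) : ℂ) ^ c =
      ((q⁻¹ ^ ξ : ℝ) : ℂ) ^ c * (((q⁻¹ : ℝ) : ℂ) ^ c) ^ n := by
    rw [hh, hr, mul_div_cancel_left₀ _ (by linarith : 1 - q⁻¹ ≠ 0), Complex.ofReal_mul,
      Complex.mul_cpow_ofReal_nonneg hpξ.le (by positivity), ofReal_pow_cpow hp.le]
  rw [e3]
  generalize ((q⁻¹ : ℝ) : ℂ) ^ c = a at *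
  have ha : a ^ n ≠ 0 := pow_ne_zero _ hpc
  rw [mul_assoc _ (a ^ n), mul_assoc (a ^ n)⁻¹, mul_inv_cancel_left₀ ha, mul_assoc]

/-! ### Degeneration to theta quotients as `h → 0` -/

lemma qPochInf_ne_zero_of_norm_lt_one {p : ℝ} (hp : 0 < p) (hp1 : p < 1) {x : ℂ} (hx : ‖x‖ < 1) :
    qPochInf p x ≠ 0 := by
  refine qPochInf_ne_zero hp hp1 fun j h => ?_
  have h1 : ‖(p : ℂ) ^ j * x‖ < 1 := by
    rw [norm_mul, norm_pow, Complex.norm_real, Real.norm_of_nonneg hp.le]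
    calc p ^ j * ‖x‖ ≤ 1 * ‖x‖ := by gcongr; exact pow_le_one₀ hp.le hp1.le
      _ < 1 := by rwa [one_mul]
  rw [h, norm_one] at h1
  exact lt_irrefl _ h1

lemma theta_cpow_mul_ne_zero {q : ℝ} (hq : 1 < q) {c x : ℂ} (hx : x ∈ (ray q c)ᶜ) {r : ℝ}
    (hr : 0 < r) : theta q (((q⁻¹ : ℝ) : ℂ) ^ c * (r * x)) ≠ 0 := by
  have hr0 : (r : ℂ) ≠ 0 := by exact_mod_cast hr.ne'
  have key : ∀ t : ℝ, 0 ≤ t → ((q⁻¹ : ℝ) : ℂ) ^ c * (r * x) ≠ t := by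
    intro t ht h
    refine cpow_mul_ne_ofReal hq hx (r := r⁻¹ * t) (by positivity) ?_
    rw [Complex.ofReal_mul, ← h, Complex.ofReal_inv r, mul_left_comm, inv_mul_cancel_left₀ hr0]
  refine theta_ne_zero hq ?_ fun k hk => ?_
  · simpa using key 0 le_rfl
  · exact key (q ^ k) (zpow_nonneg (by linarith) k) (by rw [hk]; push_cast; rfl)

lemma continuousAt_limitChar {q : ℝ} (hq : 1 < q) {c : ℂ} (ξ : ℝ) {x : ℂ}
    (hx : x ∈ (ray q c)ᶜ) :
    ContinuousAt (fun z : ℝ × ℂ => limitChar q z.1 c z.2) (ξ, x) := by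
  have hp : 0 < q⁻¹ := by positivity
  have hx0 := ne_zero_of_notMem_ray hx
  have hpc : ((q⁻¹ : ℝ) : ℂ) ^ c ≠ 0 := by
    have hp0 : ((q⁻¹ : ℝ) : ℂ) ≠ 0 := by exact_mod_cast hp.ne'
    rw [Ne, Complex.cpow_eq_zero_iff]; tauto
  have hpos : ∀ ξ : ℝ, 0 < q⁻¹ ^ ξ := fun ξ => Real.rpow_pos_of_pos hp ξ
  have hr : Continuous fun ξ : ℝ => q⁻¹ ^ ξ := Real.continuous_const_rpow hp.ne'
  have h1 : ContinuousAt (fun z : ℝ × ℂ => ((q⁻¹ ^ z.1 : ℝ) : ℂ)) (ξ, x) :=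
    (Complex.continuous_ofReal.comp (hr.comp continuous_fst)).continuousAt
  have h2 : ContinuousAt (fun z : ℝ × ℂ => (((q⁻¹ ^ z.1)⁻¹ : ℝ) : ℂ) * z.2) (ξ, x) :=
    ((Complex.continuous_ofReal.comp ((hr.inv₀ fun ξ => (hpos ξ).ne').comp
      continuous_fst)).mul continuous_snd).continuousAt
  have hne : (((q⁻¹ ^ ξ)⁻¹ : ℝ) : ℂ) * x ≠ 0 :=
    mul_ne_zero (by exact_mod_cast (inv_pos.2 (hpos ξ)).ne') hx0
  simp_rw [limitChar_eq hq]
  refine (ContinuousAt.cpow h1 continuousAt_const (by simp [hpos])).mul (ContinuousAt.div ?_ ?_ ?_)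
  · exact ContinuousAt.comp (g := theta q) (f := fun z : ℝ × ℂ => (((q⁻¹ ^ z.1)⁻¹ : ℝ) : ℂ) * z.2)
      (analyticAt_theta hq hne).continuousAt h2
  · exact ContinuousAt.comp (g := theta q) (f := fun z : ℝ × ℂ =>
      ((q⁻¹ : ℝ) : ℂ) ^ c * ((((q⁻¹ ^ z.1)⁻¹ : ℝ) : ℂ) * z.2))
      (analyticAt_theta hq (mul_ne_zero hpc hne)).continuousAt (continuousAt_const.mul h2)
  · exact theta_cpow_mul_ne_zero hq hx (inv_pos.2 (hpos ξ))

lemma analyticAt_limitChar {q : ℝ} (hq : 1 < q) {c : ℂ} (ξ : ℝ) {x : ℂ}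
    (hx : x ∈ (ray q c)ᶜ) : AnalyticAt ℂ (limitChar q ξ c) x := by
  have hp : 0 < q⁻¹ := by positivity
  have hx0 := ne_zero_of_notMem_ray hx
  have hpc : ((q⁻¹ : ℝ) : ℂ) ^ c ≠ 0 := by
    have hp0 : ((q⁻¹ : ℝ) : ℂ) ≠ 0 := by exact_mod_cast hp.ne'
    rw [Ne, Complex.cpow_eq_zero_iff]; tauto
  have hpos : 0 < q⁻¹ ^ ξ := Real.rpow_pos_of_pos hp ξ
  have hne : (((q⁻¹ ^ ξ)⁻¹ : ℝ) : ℂ) * x ≠ 0 :=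
    mul_ne_zero (by exact_mod_cast (inv_pos.2 hpos).ne') hx0
  rw [funext (limitChar_eq hq ξ c)]
  refine analyticAt_const.mul (AnalyticAt.div ?_ ?_ ?_)
  · exact AnalyticAt.fun_comp (analyticAt_theta hq hne) (analyticAt_const.mul analyticAt_id)
  · exact AnalyticAt.fun_comp (analyticAt_theta hq (mul_ne_zero hpc hne))
      (analyticAt_const.mul (analyticAt_const.mul analyticAt_id))
  · exact theta_cpow_mul_ne_zero hq hx (inv_pos.2 hpos)

lemma limitChar_one_eq_limitChar_zero {q : ℝ} (hq : 1 < q) {c x : ℂ} (hx : x ≠ 0) :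
    limitChar q 1 c x = limitChar q 0 c x := by
  have hp : 0 < q⁻¹ := by positivity
  have hp0 : ((q⁻¹ : ℝ) : ℂ) ≠ 0 := by exact_mod_cast hp.ne'
  have hq0 : (q : ℂ) ≠ 0 := by exact_mod_cast (by linarith : q ≠ 0)
  have hpc : ((q⁻¹ : ℝ) : ℂ) ^ c ≠ 0 := by rw [Ne, Complex.cpow_eq_zero_iff]; tauto
  rw [limitChar_eq hq, limitChar_eq hq, Real.rpow_one, Real.rpow_zero, inv_inv,
    theta_div_theta hq hpc (mul_ne_zero hq0 hx) 1, pow_one, pow_one, Complex.ofReal_inv,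
    inv_mul_cancel_left₀ hq0]
  rw [Complex.ofReal_inv] at hpc
  simp [hpc]

/-- Uniformity in the step `h`: on a compact set avoiding the half-line, `e_c^{(q,h)}` is
holomorphic for small `h`, and close to the limit character with the exponent `ξ` of `h`. -/
lemma eventually_qhChar_close {q : ℝ} (hq : 1 < q) {c : ℂ} {K : Set ℂ} (hK : K ⊆ (ray q c)ᶜ)
    (hKc : IsCompact K) {δ : ℝ} (hδ : 0 < δ) :
    ∀ᶠ h in 𝓝[>] (0 : ℝ), ∀ x ∈ K, AnalyticAt ℂ (qhChar q h c) x ∧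
      ∀ ξ ∈ Icc (0 : ℝ) 1, ∀ n : ℕ, h = (1 - q⁻¹) * q⁻¹ ^ (ξ + (n : ℝ)) →
        ‖qhChar q h c x - limitChar q ξ c x‖ < δ := by
  have hp : 0 < q⁻¹ := by positivity
  have hp1 : q⁻¹ < 1 := inv_lt_one_of_one_lt₀ hq
  have hp0 : ((q⁻¹ : ℝ) : ℂ) ≠ 0 := by exact_mod_cast hp.ne'
  set b : ℂ := ((q⁻¹ : ℝ) : ℂ) ^ (-c) with hb
  have key : ∀ᶠ s : ℝ in 𝓝 (0 : ℝ), ∀ z ∈ Icc (0 : ℝ) 1 ×ˢ K, z.2 + (s : ℂ) ∈ (ray q c)ᶜ ∧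
      ‖(s : ℂ) / (z.2 + s)‖ < 1 ∧ ‖b * ((s : ℂ) / (z.2 + s))‖ < 1 ∧
      ‖limitChar q z.1 c (z.2 + s) * (qPochInf q⁻¹ (b * (s / (z.2 + s))) /
        qPochInf q⁻¹ (s / (z.2 + s))) - limitChar q z.1 c z.2‖ < δ := by
    refine (isCompact_Icc.prod hKc).eventually_forall_of_forall_eventually ?_
    rintro ⟨ξ, x⟩ ⟨-, hxK⟩
    have hx : x ∈ (ray q c)ᶜ := hK hxK
    have hx0 := ne_zero_of_notMem_ray hx
    have c1 : ContinuousAt (fun y : ℝ × ℝ × ℂ => y.2.2 + (y.1 : ℂ)) (0, ξ, x) := by fun_prop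
    have c2 : ContinuousAt (fun y : ℝ × ℝ × ℂ => (y.1 : ℂ) / (y.2.2 + (y.1 : ℂ))) (0, ξ, x) :=
      ContinuousAt.div (by fun_prop) c1 (by simpa using hx0)
    have c3 : ContinuousAt (fun y : ℝ × ℝ × ℂ => b * ((y.1 : ℂ) / (y.2.2 + (y.1 : ℂ))))
      (0, ξ, x) := continuousAt_const.mul c2
    have c4 : ContinuousAt (fun y : ℝ × ℝ × ℂ => limitChar q y.2.1 c y.2.2) (0, ξ, x) :=
      ContinuousAt.comp (g := fun z : ℝ × ℂ => limitChar q z.1 c z.2)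
        (f := fun y : ℝ × ℝ × ℂ => y.2) (continuousAt_limitChar hq ξ hx) continuousAt_snd
    have c5 : ContinuousAt (fun y : ℝ × ℝ × ℂ => limitChar q y.2.1 c (y.2.2 + (y.1 : ℂ)))
        (0, ξ, x) :=
      ContinuousAt.comp (g := fun z : ℝ × ℂ => limitChar q z.1 c z.2)
        (f := fun y : ℝ × ℝ × ℂ => (y.2.1, y.2.2 + (y.1 : ℂ)))
        (by simpa using continuousAt_limitChar hq ξ hx)
        (ContinuousAt.prodMk (by fun_prop) c1)
    have hqc := continuous_qPochInf hp hp1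
    have c6 : ContinuousAt (fun y : ℝ × ℝ × ℂ =>
        qPochInf q⁻¹ ((y.1 : ℂ) / (y.2.2 + (y.1 : ℂ)))) (0, ξ, x) :=
      hqc.continuousAt.comp c2
    have c7 : ContinuousAt (fun y : ℝ × ℝ × ℂ =>
        qPochInf q⁻¹ (b * ((y.1 : ℂ) / (y.2.2 + (y.1 : ℂ))))) (0, ξ, x) :=
      hqc.continuousAt.comp c3
    have c8 : ContinuousAt (fun y : ℝ × ℝ × ℂ => ‖limitChar q y.2.1 c (y.2.2 + (y.1 : ℂ)) *
        (qPochInf q⁻¹ (b * ((y.1 : ℂ) / (y.2.2 + (y.1 : ℂ)))) /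
          qPochInf q⁻¹ ((y.1 : ℂ) / (y.2.2 + (y.1 : ℂ)))) - limitChar q y.2.1 c y.2.2‖)
        (0, ξ, x) := ((c5.mul (c7.div c6 (by simp))).sub c4).norm
    have e1 := c1.eventually_mem ((isOpen_compl_ray hq c).mem_nhds (by simpa using hx))
    have e2 := c2.norm.eventually_lt continuousAt_const (g := fun _ => (1 : ℝ)) (by simp)
    have e3 := c3.norm.eventually_lt continuousAt_const (g := fun _ => (1 : ℝ)) (by simp)
    have e4 := c8.eventually_lt continuousAt_const (g := fun _ => δ) (by simpa using hδ)
    filter_upwards [e1, e2, e3, e4] with y h1 h2 h3 h4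
    exact ⟨h1, h2, h3, h4⟩
  have hlim : Tendsto (fun h : ℝ => h / (q - 1)) (𝓝[>] 0) (𝓝 0) := by
    have : Tendsto (fun h : ℝ => h / (q - 1)) (𝓝 0) (𝓝 (0 / (q - 1))) :=
      tendsto_id.div_const _
    rw [zero_div] at this
    exact this.mono_left nhdsWithin_le_nhds
  filter_upwards [hlim.eventually key, self_mem_nhdsWithin] with h hs hh x hx
  rw [mem_Ioi] at hh
  have hu : (1 - ((q⁻¹ : ℝ) : ℂ)) * (x / h) + ((q⁻¹ : ℝ) : ℂ) =
      ((1 - q⁻¹) / h : ℝ) * (x + ((h / (q - 1) : ℝ) : ℂ)) := by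
    have hq1 : (q : ℂ) - 1 ≠ 0 := by rw [sub_ne_zero]; exact_mod_cast hq.ne'
    have hq0 : (q : ℂ) ≠ 0 := by exact_mod_cast (by linarith : q ≠ 0)
    have hh0 : (h : ℂ) ≠ 0 := by exact_mod_cast hh.ne'
    push_cast
    field_simp
  have hne : qPochInf q⁻¹ (((q⁻¹ : ℝ) : ℂ) ^ c * ((1 - (q⁻¹ : ℝ)) * (x / h) + (q⁻¹ : ℝ))) ≠ 0 := by
    obtain ⟨hray, -⟩ := hs (0, x) ⟨by simp, hx⟩
    have hr : 0 < (1 - q⁻¹) / h := div_pos (by linarith) hh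
    refine qPochInf_ne_zero hp hp1 fun j hj => ?_
    refine cpow_mul_ne_ofReal hq hray (r := (q⁻¹ ^ j * ((1 - q⁻¹) / h))⁻¹) (by positivity) ?_
    rw [hu] at hj
    have : ((q⁻¹ ^ j * ((1 - q⁻¹) / h) : ℝ) : ℂ) ≠ 0 := by
      exact_mod_cast (by positivity : q⁻¹ ^ j * ((1 - q⁻¹) / h) ≠ 0)
    refine mul_left_cancel₀ this ?_
    rw [Complex.ofReal_inv (_ * _), mul_inv_cancel₀ this, ← hj, Complex.ofReal_mul,
      Complex.ofReal_pow]
    ring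
  refine ⟨analyticAt_qhChar hq hh hne, fun ξ hξ n hn => ?_⟩
  obtain ⟨h1, h2, h3, h4⟩ := hs (ξ, x) ⟨hξ, hx⟩
  rw [qhChar_apply hq hh hne, rawChar_eq_limitChar_mul hq ξ n (s := h / (q - 1)) hn ?_
    (ne_zero_of_notMem_ray h1) (qPochInf_ne_zero_of_norm_lt_one hp hp1 h2)
    (qPochInf_ne_zero_of_norm_lt_one hp hp1 h3)]
  · exact h4
  · rw [hn]
    have hq1 : q - 1 ≠ 0 := by linarith
    have hq0 : q ≠ 0 := by linarith
    generalize q⁻¹ ^ (ξ + (n : ℝ)) = y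
    field_simp

/-- Every step `h ≤ 1 - p` is of the form `(1-p) p^(ξ+n)`, where `ξ` and `n` are the fractional and
the integral part of `log_p (h/(1-p))`. -/
lemma exists_exponent {q : ℝ} (hq : 1 < q) {h : ℝ} (hh : 0 < h) (hh1 : h ≤ 1 - q⁻¹) :
    ∃ ξ ∈ Ico (0 : ℝ) 1, ∃ n : ℕ, h = (1 - q⁻¹) * q⁻¹ ^ (ξ + (n : ℝ)) := by
  have hp : 0 < q⁻¹ := by positivity
  have hp1 : q⁻¹ < 1 := inv_lt_one_of_one_lt₀ hq
  have h1p : 0 < 1 - q⁻¹ := by linarith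
  have hy : 0 < h / (1 - q⁻¹) := by positivity
  have hy1 : h / (1 - q⁻¹) ≤ 1 := (div_le_one h1p).2 hh1
  set L := Real.logb q⁻¹ (h / (1 - q⁻¹)) with hL
  have hL0 : 0 ≤ L := (Real.logb_nonneg_iff_of_base_lt_one hp hp1 hy).2 hy1
  refine ⟨L - ⌊L⌋₊, ⟨sub_nonneg.2 (Nat.floor_le hL0), ?_⟩, ⌊L⌋₊, ?_⟩
  · linarith [Nat.lt_floor_add_one L]
  · rw [sub_add_cancel, hL, Real.rpow_logb hp hp1.ne hy, mul_div_cancel₀ _ h1p.ne']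

lemma exists_bound_limitChar {q : ℝ} (hq : 1 < q) {c : ℂ} {K : Set ℂ} (hK : K ⊆ (ray q c)ᶜ)
    (hKc : IsCompact K) :
    ∃ M : ℝ, ∀ ξ ∈ Icc (0 : ℝ) 1, ∀ x ∈ K, ‖limitChar q ξ c x‖ ≤ M := by
  obtain ⟨M, hM⟩ := ((isCompact_Icc (a := (0 : ℝ)) (b := 1)).prod hKc).exists_bound_of_continuousOn
    (f := fun z : ℝ × ℂ => limitChar q z.1 c z.2)
    fun z hz => (continuousAt_limitChar hq z.1 (hK hz.2)).continuousWithinAt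
  exact ⟨M, fun ξ hξ x hx => hM (ξ, x) ⟨hξ, hx⟩⟩

/-- Local boundedness of `e_c^{(q,h)}` for small `h`. -/
lemma exists_bound_qhChar {q : ℝ} (hq : 1 < q) {c : ℂ} {K : Set ℂ} (hK : K ⊆ (ray q c)ᶜ)
    (hKc : IsCompact K) :
    ∃ η > (0 : ℝ), ∃ M : ℝ, ∀ h ∈ Set.Ioc (0 : ℝ) η,
      ∀ x ∈ K, AnalyticAt ℂ (qhChar q h c) x ∧ ‖qhChar q h c x‖ ≤ M := by
  obtain ⟨M, hM⟩ := exists_bound_limitChar hq hK hKc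
  have h := eventually_qhChar_close hq hK hKc one_pos
  rw [eventually_nhdsWithin_iff, Metric.eventually_nhds_iff] at h
  obtain ⟨η, hη, hh⟩ := h
  have hp1 : q⁻¹ < 1 := inv_lt_one_of_one_lt₀ hq
  refine ⟨min (η / 2) (1 - q⁻¹), lt_min (by positivity) (by linarith), M + 1, ?_⟩
  rintro h ⟨h0, h1⟩ x hx
  have h2 : dist h 0 < η := by
    rw [Real.dist_0_eq_abs, abs_of_pos h0]
    linarith [min_le_left (η / 2) (1 - q⁻¹)]
  obtain ⟨ha, hb⟩ := hh h2 h0 x hx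
  obtain ⟨ξ, hξ, n, hn⟩ := exists_exponent hq h0 (h1.trans (min_le_right _ _))
  refine ⟨ha, ?_⟩
  have := hb ξ ⟨hξ.1, hξ.2.le⟩ n hn
  have h3 := hM ξ ⟨hξ.1, hξ.2.le⟩ x hx
  calc ‖qhChar q h c x‖ = ‖limitChar q ξ c x + (qhChar q h c x - limitChar q ξ c x)‖ := by
        congr 1; ring
    _ ≤ _ := (norm_add_le _ _).trans (by linarith)

lemma tendsto_step {q : ℝ} (hq : 1 < q) (ξ : ℝ) :
    Tendsto (fun n : ℕ => (1 - q⁻¹) * q⁻¹ ^ (ξ + (n : ℝ))) atTop (𝓝[>] 0) := by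
  have hp : 0 < q⁻¹ := by positivity
  have hp1 : q⁻¹ < 1 := inv_lt_one_of_one_lt₀ hq
  refine tendsto_nhdsWithin_iff.2 ⟨?_, .of_forall fun n =>
    mul_pos (by linarith) (Real.rpow_pos_of_pos hp _)⟩
  have h := ((tendsto_pow_atTop_nhds_zero_of_lt_one hp.le hp1).const_mul
    (q⁻¹ ^ ξ)).const_mul (1 - q⁻¹)
  simp only [mul_zero] at h
  refine h.congr fun n => ?_
  rw [Real.rpow_add hp, Real.rpow_natCast]

lemma tendstoUniformlyOn_qhChar_limitChar {q : ℝ} (hq : 1 < q) {c : ℂ} {ξ : ℝ}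
    (hξ : ξ ∈ Ico (0 : ℝ) 1) {K : Set ℂ} (hK : K ⊆ (ray q c)ᶜ) (hKc : IsCompact K) :
    TendstoUniformlyOn (fun n : ℕ => qhChar q ((1 - q⁻¹) * q⁻¹ ^ (ξ + (n : ℝ))) c)
      (limitChar q ξ c) atTop K := by
  rw [Metric.tendstoUniformlyOn_iff]
  intro δ hδ
  filter_upwards [(tendsto_step hq ξ).eventually (eventually_qhChar_close hq hK hKc hδ)]
    with n hn x hx
  rw [dist_comm, dist_eq_norm]
  exact (hn x hx).2 ξ ⟨hξ.1, hξ.2.le⟩ n rfl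

/-- Every sequence of steps tending to `0` has a subsequence along which the characters converge,
locally uniformly, to one of the limit characters. -/
lemma exists_subseq_qhChar {q : ℝ} (hq : 1 < q) (c : ℂ) {h : ℕ → ℝ} (h0 : ∀ n, 0 < h n)
    (hlim : Tendsto h atTop (𝓝 0)) :
    ∃ φ : ℕ → ℕ, StrictMono φ ∧ ∃ ξ ∈ Ico (0 : ℝ) 1, ∀ K ⊆ (ray q c)ᶜ, IsCompact K →
      ∀ δ > 0, ∀ᶠ n in atTop, ∀ x ∈ K, AnalyticAt ℂ (qhChar q (h (φ n)) c) x ∧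
        ‖qhChar q (h (φ n)) c x - limitChar q ξ c x‖ < δ := by
  have hp1 : q⁻¹ < 1 := inv_lt_one_of_one_lt₀ hq
  have hlim' : Tendsto h atTop (𝓝[>] 0) :=
    tendsto_nhdsWithin_iff.2 ⟨hlim, .of_forall h0⟩
  have hex : ∀ n, ∃ ξ ∈ Icc (0 : ℝ) 1, h n ≤ 1 - q⁻¹ →
      ∃ m : ℕ, h n = (1 - q⁻¹) * q⁻¹ ^ (ξ + (m : ℝ)) := by
    intro n
    by_cases hn : h n ≤ 1 - q⁻¹
    · obtain ⟨ξ, hξ, m, hm⟩ := exists_exponent hq (h0 n) hn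
      exact ⟨ξ, ⟨hξ.1, hξ.2.le⟩, fun _ => ⟨m, hm⟩⟩
    · exact ⟨0, by simp, fun h => absurd h hn⟩
  choose ξ hξ hm using hex
  obtain ⟨ξ₀, hξ₀, φ, hφ, hφlim⟩ := isCompact_Icc.tendsto_subseq hξ
  have main : ∀ K ⊆ (ray q c)ᶜ, IsCompact K →
      ∀ δ > 0, ∀ᶠ n in atTop, ∀ x ∈ K, AnalyticAt ℂ (qhChar q (h (φ n)) c) x ∧
        ‖qhChar q (h (φ n)) c x - limitChar q ξ₀ c x‖ < δ := by
    intro K hK hKc δ hδ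
    have e1 := (hlim'.comp hφ.tendsto_atTop).eventually
      (eventually_qhChar_close hq hK hKc (half_pos hδ))
    have e2 : ∀ᶠ n in atTop, h (φ n) ≤ 1 - q⁻¹ :=
      (hlim.comp hφ.tendsto_atTop).eventually_le_const (by linarith)
    have e3 : ∀ᶠ ζ in 𝓝 ξ₀, ∀ x ∈ K, ‖limitChar q ζ c x - limitChar q ξ₀ c x‖ < δ / 2 := by
      refine hKc.eventually_forall_of_forall_eventually fun x hx => ?_
      have c1 := continuousAt_limitChar hq ξ₀ (hK hx)
      have c2 : ContinuousAt (fun z : ℝ × ℂ => limitChar q ξ₀ c z.2) (ξ₀, x) :=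
        ContinuousAt.comp (g := limitChar q ξ₀ c) (f := fun z : ℝ × ℂ => z.2)
          (analyticAt_limitChar hq ξ₀ (hK hx)).continuousAt continuousAt_snd
      exact (c1.sub c2).norm.eventually_lt continuousAt_const (g := fun _ => δ / 2)
        (by simpa using hδ)
    filter_upwards [e1, e2, hφlim.eventually e3] with n h1 h2 h3 x hx
    obtain ⟨ha, hb⟩ := h1 x hx
    obtain ⟨m, hm⟩ := hm _ h2
    have h4 := hb _ (hξ _) m hm
    have h5 := h3 x hx
    refine ⟨ha, ?_⟩
    calc ‖qhChar q (h (φ n)) c x - limitChar q ξ₀ c x‖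
        = ‖(qhChar q (h (φ n)) c x - limitChar q (ξ (φ n)) c x) +
          (limitChar q (ξ (φ n)) c x - limitChar q ξ₀ c x)‖ := by congr 1; ring
      _ < δ := (norm_add_le _ _).trans_lt (by simp only [Function.comp] at h4 h5; linarith)
  rcases hξ₀.2.eq_or_lt with h1 | h1
  · refine ⟨φ, hφ, 0, by simp, fun K hK hKc δ hδ => ?_⟩
    filter_upwards [main K hK hKc δ hδ] with n hn x hx
    rw [← limitChar_one_eq_limitChar_zero hq (ne_zero_of_notMem_ray (hK hx)), ← h1]
    exact hn x hx
  · exact ⟨φ, hφ, ξ₀, ⟨hξ₀.1, h1⟩, main⟩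

/-- Every pointwise limit for `h → 0` is one of the limit characters. -/
lemma exists_eq_limitChar {q : ℝ} (hq : 1 < q) (c : ℂ) {h : ℕ → ℝ} {g : ℂ → ℂ} (h0 : ∀ n, 0 < h n)
    (hlim : Tendsto h atTop (𝓝 0))
    (hg : ∀ x ∈ (ray q c)ᶜ, Tendsto (fun n => qhChar q (h n) c x) atTop (𝓝 (g x))) :
    ∃ ξ ∈ Set.Ico (0 : ℝ) 1, ∀ x ∈ (ray q c)ᶜ, g x = limitChar q ξ c x := by
  obtain ⟨φ, hφ, ξ, hξ, H⟩ := exists_subseq_qhChar hq c h0 hlim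
  refine ⟨ξ, hξ, fun x hx => tendsto_nhds_unique ((hg x hx).comp hφ.tendsto_atTop) ?_⟩
  rw [Metric.tendsto_nhds]
  intro δ hδ
  filter_upwards [H {x} (by simpa using hx) isCompact_singleton δ hδ] with n hn
  rw [dist_eq_norm]
  exact (hn x rfl).2

/-- The second expression of the limit character, in terms of the characters for `h = 0`. -/
lemma limitChar_eventuallyEq {q : ℝ} (hq : 1 < q) (c : ℂ) (ξ : ℝ) :
    limitChar q ξ c =ᶠ[codiscreteWithin {(0 : ℂ)}ᶜ]
      fun x => ((q⁻¹ : ℝ) : ℂ) ^ ((ξ : ℂ) * c) *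
        (qhChar q 0 (c - ξ) x / qhChar q 0 (-ξ) x) := by
  have hq0 : (q : ℂ) ≠ 0 := by exact_mod_cast (by linarith : q ≠ 0)
  have hcpow : ∀ d : ℂ, (q : ℂ) ^ d ≠ 0 := fun d => by rw [Ne, Complex.cpow_eq_zero_iff]; tauto
  have hm : ∀ d : ℂ, MeromorphicOn (fun x : ℂ => theta q x / thetaShift q ((q : ℂ) ^ d) x)
      {(0 : ℂ)}ᶜ := by
    intro d x hx
    have hx0 : x ≠ 0 := hx
    refine (analyticAt_theta hq hx0).meromorphicAt.div (AnalyticAt.meromorphicAt ?_)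
    exact AnalyticAt.fun_comp (f := fun x => ((q : ℂ) ^ d)⁻¹ * x)
      (analyticAt_theta hq (mul_ne_zero (inv_ne_zero (hcpow d)) hx0))
      (analyticAt_const.mul analyticAt_id)
  have hq' : ∀ d : ℂ, qhChar q 0 d =ᶠ[codiscreteWithin {(0 : ℂ)}ᶜ]
      fun x : ℂ => theta q x / thetaShift q ((q : ℂ) ^ d) x := by
    intro d
    rw [qhChar, if_pos hq, if_neg (lt_irrefl _)]
    exact (toMeromorphicNFOn_eqOn_codiscrete (hm d)).symm
  have hz : ∀ᶠ x in codiscreteWithin {(0 : ℂ)}ᶜ, theta q x ≠ 0 := by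
    have hpre : IsPreconnected ({(0 : ℂ)}ᶜ : Set ℂ) :=
      (isConnected_compl_singleton_of_one_lt_rank (by simp) 0).isPreconnected
    have han : AnalyticOnNhd ℂ (theta q) {(0 : ℂ)}ᶜ := fun x hx => analyticAt_theta hq hx
    refine (han.eqOn_zero_or_eventually_ne_zero_of_preconnected hpre).resolve_left fun h0 => ?_
    refine theta_ne_zero hq (x := -1) (by simp) (fun k hk => ?_) (h0 (by simp : (-1 : ℂ) ∈ _))
    have h1 : (-1 : ℝ) = q ^ k := by exact_mod_cast hk
    have h2 : 0 < q ^ k := zpow_pos (by linarith) k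
    linarith
  filter_upwards [hq' (c - ξ), hq' (-ξ), hz] with x h1 h2 h3
  rw [h1, h2, limitChar, inv_cpow_eq_cpow_neg hq ξ, inv_cpow_eq_cpow_neg hq (-c), neg_neg,
    ← Complex.cpow_add _ _ hq0, neg_add_eq_sub, div_div_div_cancel_left' _ _ h3]

/-! ### Homogeneous coordinates on the Riemann sphere and normality -/

open Classical in
/-- The point `[a : b]` of the Riemann sphere. -/
def spherePoint (a b : ℂ) : OnePoint ℂ :=
  if b = 0 then OnePoint.infty else OnePoint.some (a / b)

lemma chordalDist_spherePoint {a b a' b' : ℂ} (h : ¬(a = 0 ∧ b = 0)) (h' : ¬(a' = 0 ∧ b' = 0)) :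
    chordalDist (spherePoint a b) (spherePoint a' b') =
      2 * ‖a * b' - a' * b‖ / (√(‖a‖ ^ 2 + ‖b‖ ^ 2) * √(‖a'‖ ^ 2 + ‖b'‖ ^ 2)) := by
  have key : ∀ a b : ℂ, b ≠ 0 → √(‖a‖ ^ 2 + ‖b‖ ^ 2) = ‖b‖ * √(1 + ‖a / b‖ ^ 2) := by
    intro a b hb
    have hb' : 0 < ‖b‖ := norm_pos_iff.2 hb
    rw [← Real.sqrt_sq hb'.le, ← Real.sqrt_mul (sq_nonneg _), Real.sqrt_sq hb'.le, norm_div]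
    congr 1
    field_simp
    ring
  have pos : ∀ z : ℂ, 0 < √(1 + ‖z‖ ^ 2) := fun z => Real.sqrt_pos.2 (by positivity)
  by_cases hb : b = 0 <;> by_cases hb' : b' = 0
  · simp [spherePoint, hb, hb', chordalDist]
  · have ha : 0 < ‖a‖ := norm_pos_iff.2 fun h0 => h ⟨h0, hb⟩
    have hn : 0 < ‖b'‖ := norm_pos_iff.2 hb'
    have := pos (a' / b')
    rw [key a' b' hb']
    simp only [spherePoint, hb, hb', if_true, if_false, chordalDist, norm_zero, mul_zero, sub_zero,
      norm_mul]
    rw [zero_pow two_ne_zero, add_zero, Real.sqrt_sq ha.le]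
    field_simp
  · have ha : 0 < ‖a'‖ := norm_pos_iff.2 fun h0 => h' ⟨h0, hb'⟩
    have hn : 0 < ‖b‖ := norm_pos_iff.2 hb
    have := pos (a / b)
    rw [key a b hb]
    simp only [spherePoint, hb, hb', if_true, if_false, chordalDist, norm_zero, mul_zero, zero_sub,
      norm_mul, norm_neg]
    rw [zero_pow two_ne_zero, add_zero, Real.sqrt_sq ha.le]
    field_simp
  · have hn : 0 < ‖b‖ := norm_pos_iff.2 hb
    have hn' : 0 < ‖b'‖ := norm_pos_iff.2 hb'
    have := pos (a / b)
    have := pos (a' / b')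
    rw [key a b hb, key a' b' hb']
    simp only [spherePoint, hb, hb', if_false, chordalDist]
    rw [show a * b' - a' * b = b * b' * (a / b - a' / b') by field_simp, norm_mul, norm_mul]
    field_simp

lemma sphereValue_of_analyticAt {f : ℂ → ℂ} {x : ℂ} (hf : AnalyticAt ℂ f x) :
    sphereValue f x = OnePoint.some (f x) :=
  if_neg (not_lt.2 hf.meromorphicOrderAt_nonneg)

/-- The sphere value of a function in normal form which is locally a quotient of two analytic
functions without common zero. -/
lemma sphereValue_eq_spherePoint {f A B : ℂ → ℂ} {x : ℂ} (hf : MeromorphicNFAt f x)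
    (hA : AnalyticAt ℂ A x) (hB : AnalyticAt ℂ B x) (h0 : ¬(A x = 0 ∧ B x = 0))
    (hB0 : ∀ᶠ y in 𝓝[≠] x, B y ≠ 0) (hfAB : f =ᶠ[𝓝[≠] x] fun y => A y / B y) :
    sphereValue f x = spherePoint (A x) (B x) := by
  have ho : meromorphicOrderAt f x = meromorphicOrderAt (fun y => A y / B y) x :=
    meromorphicOrderAt_congr hfAB
  by_cases hb : B x = 0
  · have ha : A x ≠ 0 := fun h => h0 ⟨h, hb⟩
    have oA : meromorphicOrderAt A x = 0 := by
      rw [hA.meromorphicNFAt.meromorphicOrderAt_eq_zero_iff]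
      exact ha
    have oB1 : 0 ≤ meromorphicOrderAt B x := hB.meromorphicOrderAt_nonneg
    have oB2 : meromorphicOrderAt B x ≠ 0 := by
      rw [Ne, hB.meromorphicNFAt.meromorphicOrderAt_eq_zero_iff]
      simpa using hb
    have oB3 : meromorphicOrderAt B x ≠ ⊤ := by
      rw [Ne, meromorphicOrderAt_eq_top_iff]
      intro h
      obtain ⟨y, hy1, hy2⟩ := (h.and hB0).exists
      exact hy2 hy1
    have hneg : meromorphicOrderAt f x < 0 := by
      rw [ho, show (fun y => A y / B y) = A * B⁻¹ from funext fun y => div_eq_mul_inv _ _,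
        meromorphicOrderAt_mul hA.meromorphicAt hB.meromorphicAt.inv, oA, meromorphicOrderAt_inv]
      lift meromorphicOrderAt B x to ℤ using oB3 with k hk
      have h1 : (0 : ℤ) ≤ k := by exact_mod_cast oB1
      have h2 : k ≠ 0 := by exact_mod_cast oB2
      have h3 : -k < 0 := by omega
      rw [zero_add]
      exact_mod_cast h3
    rw [sphereValue, if_pos hneg, spherePoint, if_pos hb]
  · have hAB : AnalyticAt ℂ (fun y => A y / B y) x := hA.div hB hb
    have hfx := (hf.eventuallyEq_nhdsNE_iff_eventuallyEq_nhds hAB.meromorphicNFAt).1 hfAB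
    rw [sphereValue_of_analyticAt (hAB.congr hfx.symm), spherePoint, if_neg hb, hfx.eq_of_nhds]

/-- A meromorphic function is locally a quotient of analytic functions without common zero. -/
lemma exists_eventuallyEq_div {R : ℂ → ℂ} {x : ℂ} (hR : MeromorphicAt R x) :
    ∃ A B : ℂ → ℂ, AnalyticAt ℂ A x ∧ AnalyticAt ℂ B x ∧ ¬(A x = 0 ∧ B x = 0) ∧
      (∀ᶠ y in 𝓝[≠] x, B y ≠ 0) ∧ R =ᶠ[𝓝[≠] x] fun y => A y / B y := by
  have hne : ∀ n : ℕ, ∀ᶠ y in 𝓝[≠] x, (y - x) ^ n ≠ 0 := fun n => by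
    filter_upwards [self_mem_nhdsWithin] with y hy
    exact pow_ne_zero _ (sub_ne_zero.2 hy)
  by_cases htop : meromorphicOrderAt R x = ⊤
  · refine ⟨0, 1, analyticAt_const, analyticAt_const, by simp, by simp, ?_⟩
    filter_upwards [meromorphicOrderAt_eq_top_iff.1 htop] with y hy
    simp [hy]
  · obtain ⟨n, hn⟩ := WithTop.ne_top_iff_exists.1 htop
    obtain ⟨g, hg, hg0, hRg⟩ := (meromorphicOrderAt_eq_int_iff hR).1 hn.symm
    have hpow : ∀ m : ℕ, AnalyticAt ℂ (fun y : ℂ => (y - x) ^ m) x := fun m => by fun_prop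
    rcases n with m | m
    · refine ⟨fun y => (y - x) ^ m * g y, 1, (hpow m).mul hg, analyticAt_const, by simp, by simp, ?_⟩
      filter_upwards [hRg] with y hy
      simpa using hy
    · refine ⟨g, fun y => (y - x) ^ (m + 1), hg, hpow _, by simp [hg0], hne _, ?_⟩
      filter_upwards [hRg] with y hy
      rw [hy, zpow_negSucc, smul_eq_mul, div_eq_inv_mul]

/-- The quotient `(u;p)_∞ / (p^c u;p)_∞`. -/
def qPochQuot (q : ℝ) (c u : ℂ) : ℂ := qPochInf q⁻¹ u / qPochInf q⁻¹ (((q⁻¹ : ℝ) : ℂ) ^ c * u)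

/-- The argument `(1-p) x/h + p` of the infinite product. -/
def affineArg (q h : ℝ) (x : ℂ) : ℂ := (1 - (q⁻¹ : ℝ)) * (x / h) + (q⁻¹ : ℝ)

lemma rawChar_eq_qPochQuot (q h : ℝ) (c x : ℂ) :
    rawChar q h c x = ((h / (1 - q⁻¹) : ℝ) : ℂ) ^ c * qPochQuot q c (affineArg q h x) := rfl

lemma meromorphicAt_qPochQuot {q : ℝ} (hq : 1 < q) (c u : ℂ) :
    MeromorphicAt (qPochQuot q c) u := by
  have hp : 0 < q⁻¹ := by positivity
  have hp1 : q⁻¹ < 1 := inv_lt_one_of_one_lt₀ hq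
  have hd := differentiable_qPochInf hp hp1
  refine (analyticAt_qPochInf hp hp1 u).meromorphicAt.div (AnalyticAt.meromorphicAt ?_)
  exact Differentiable.analyticAt
    (f := fun u : ℂ => qPochInf q⁻¹ (((q⁻¹ : ℝ) : ℂ) ^ c * u)) (by fun_prop) u

/-- Continuity of `e_c^{(q,h)}` in `h > 0`, locally uniformly for the chordal distance. -/
lemma eventually_chordalDist_qhChar_lt {q : ℝ} (hq : 1 < q) (c : ℂ) {h₀ : ℝ} (hh₀ : 0 < h₀)
    {K : Set ℂ} (hK : IsCompact K) {δ : ℝ} (hδ : 0 < δ) :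
    ∀ᶠ h in 𝓝 h₀, ∀ x ∈ K,
      chordalDist (sphereValue (qhChar q h c) x) (sphereValue (qhChar q h₀ c) x) < δ := by
  have hp : 0 < q⁻¹ := by positivity
  have hp1 : q⁻¹ < 1 := inv_lt_one_of_one_lt₀ hq
  have h1p : 0 < 1 - q⁻¹ := by linarith
  refine hK.eventually_forall_of_forall_eventually fun x₀ _ => ?_
  set u₀ := affineArg q h₀ x₀ with hu₀
  obtain ⟨A, B, hA, hB, h0, hB0, hR⟩ := exists_eventuallyEq_div (meromorphicAt_qPochQuot hq c u₀)
  have hC0 : ∀ h : ℝ, 0 < h → ((h / (1 - q⁻¹) : ℝ) : ℂ) ^ c ≠ 0 := fun h hh => by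
    have : ((h / (1 - q⁻¹) : ℝ) : ℂ) ≠ 0 := by exact_mod_cast (div_pos hh h1p).ne'
    rw [Ne, Complex.cpow_eq_zero_iff]; tauto
  have h0' : ∀ᶠ v in 𝓝 u₀, ¬(A v = 0 ∧ B v = 0) := by
    rw [not_and_or] at h0
    rcases h0 with h | h
    · filter_upwards [hA.continuousAt.eventually_ne h] with v hv using fun h => hv h.1
    · filter_upwards [hB.continuousAt.eventually_ne h] with v hv using fun h => hv h.2
  have hall : ∀ᶠ v in 𝓝 u₀, AnalyticAt ℂ A v ∧ AnalyticAt ℂ B v ∧ ¬(A v = 0 ∧ B v = 0) ∧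
      (v ≠ u₀ → B v ≠ 0 ∧ qPochQuot q c v = A v / B v) := by
    filter_upwards [hA.eventually_analyticAt, hB.eventually_analyticAt, h0',
      eventually_nhdsWithin_iff.1 hB0, eventually_nhdsWithin_iff.1 hR] with v h1 h2 h3 h4 h5
    exact ⟨h1, h2, h3, fun hv => ⟨h4 hv, h5 hv⟩⟩
  obtain ⟨V, hV, hVo, hu₀V⟩ := eventually_nhds_iff.1 hall
  -- on the neighbourhood `V` the sphere value is read off from `A` and `B`
  have hval : ∀ h : ℝ, 0 < h → ∀ x, affineArg q h x ∈ V → sphereValue (qhChar q h c) x =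
      spherePoint (((h / (1 - q⁻¹) : ℝ) : ℂ) ^ c * A (affineArg q h x)) (B (affineArg q h x)) := by
    intro h hh x hx
    have hd : Differentiable ℂ (affineArg q h) := by unfold affineArg; fun_prop
    have hinj : ∀ y, y ≠ x → affineArg q h y ≠ affineArg q h x := by
      intro y hy he
      have hh0 : (h : ℂ) ≠ 0 := by exact_mod_cast hh.ne'
      have h1p' : (1 : ℂ) - ((q⁻¹ : ℝ) : ℂ) ≠ 0 := by exact_mod_cast h1p.ne'
      simp only [affineArg, add_left_inj, mul_right_inj' h1p', div_left_inj' hh0] at he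
      exact hy he
    have hev : ∀ᶠ y in 𝓝[≠] x, affineArg q h y ∈ V ∧ affineArg q h y ≠ u₀ := by
      have e1 : ∀ᶠ y in 𝓝[≠] x, affineArg q h y ∈ V :=
        (hd.continuous.continuousAt.eventually_mem (hVo.mem_nhds hx)).filter_mono
          nhdsWithin_le_nhds
      refine e1.and ?_
      by_cases hxu : affineArg q h x = u₀
      · filter_upwards [self_mem_nhdsWithin] with y hy
        rw [← hxu]
        exact hinj y hy
      · exact (hd.continuous.continuousAt.eventually_ne hxu).filter_mono nhdsWithin_le_nhds
    obtain ⟨v1, v2, v3, -⟩ := hV _ hx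
    refine sphereValue_eq_spherePoint
      (A := fun y => ((h / (1 - q⁻¹) : ℝ) : ℂ) ^ c * A (affineArg q h y))
      (B := fun y => B (affineArg q h y)) ?_
      (analyticAt_const.mul (v1.fun_comp (hd.analyticAt x))) (v2.fun_comp (hd.analyticAt x)) ?_ ?_ ?_
    · rw [qhChar_eq_rawChar hq hh]
      exact meromorphicNFOn_toMeromorphicNFOn _ _ (mem_univ x)
    · rwa [mul_eq_zero_iff_left (hC0 h hh)]
    · filter_upwards [hev] with y hy
      exact ((hV _ hy.1).2.2.2 hy.2).1
    · rw [qhChar_eq_rawChar hq hh]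
      filter_upwards [hev, (meromorphicOn_rawChar hq h c).toMeromorphicNFOn_eq_self_on_nhdsNE
        (mem_univ x)] with y hy1 hy2
      rw [hy2, rawChar_eq_qPochQuot, ((hV _ hy1.1).2.2.2 hy1.2).2, mul_div_assoc]
  have hh₀' : (h₀ : ℂ) ≠ 0 := by exact_mod_cast hh₀.ne'
  have cu : ContinuousAt (fun z : ℝ × ℂ => affineArg q z.1 z.2) (h₀, x₀) := by
    unfold affineArg
    exact (continuousAt_const.mul (ContinuousAt.div (f := fun z : ℝ × ℂ => z.2)
      (g := fun z : ℝ × ℂ => (z.1 : ℂ)) (by fun_prop) (by fun_prop) hh₀')).add continuousAt_const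
  have cu' : ContinuousAt (fun z : ℝ × ℂ => affineArg q h₀ z.2) (h₀, x₀) := by
    unfold affineArg; fun_prop
  have cC : ContinuousAt (fun z : ℝ × ℂ => ((z.1 / (1 - q⁻¹) : ℝ) : ℂ) ^ c) (h₀, x₀) := by
    refine ContinuousAt.cpow (by fun_prop) continuousAt_const ?_
    rw [Complex.ofReal_mem_slitPlane]
    positivity
  have cA : ContinuousAt (fun z : ℝ × ℂ => A (affineArg q z.1 z.2)) (h₀, x₀) :=
    ContinuousAt.comp (g := A) (f := fun z : ℝ × ℂ => affineArg q z.1 z.2) hA.continuousAt cu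
  have cB : ContinuousAt (fun z : ℝ × ℂ => B (affineArg q z.1 z.2)) (h₀, x₀) :=
    ContinuousAt.comp (g := B) (f := fun z : ℝ × ℂ => affineArg q z.1 z.2) hB.continuousAt cu
  have cA' : ContinuousAt (fun z : ℝ × ℂ => A (affineArg q h₀ z.2)) (h₀, x₀) :=
    ContinuousAt.comp (g := A) (f := fun z : ℝ × ℂ => affineArg q h₀ z.2) hA.continuousAt cu'
  have cB' : ContinuousAt (fun z : ℝ × ℂ => B (affineArg q h₀ z.2)) (h₀, x₀) :=
    ContinuousAt.comp (g := B) (f := fun z : ℝ × ℂ => affineArg q h₀ z.2) hB.continuousAt cu'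
  have hpos : ∀ a b : ℂ, ¬(a = 0 ∧ b = 0) → √(‖a‖ ^ 2 + ‖b‖ ^ 2) ≠ 0 := by
    intro a b hab
    refine (Real.sqrt_pos.2 ?_).ne'
    rw [not_and_or] at hab
    rcases hab with h | h
    · have := norm_pos_iff.2 h
      positivity
    · have := norm_pos_iff.2 h
      positivity
  have hne1 : ∀ h : ℝ, 0 < h → ∀ x, affineArg q h x ∈ V →
      ¬(((h / (1 - q⁻¹) : ℝ) : ℂ) ^ c * A (affineArg q h x) = 0 ∧ B (affineArg q h x) = 0) := by
    intro h hh x hx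
    rw [mul_eq_zero_iff_left (hC0 h hh)]
    exact (hV _ hx).2.2.1
  have cD : ContinuousAt (fun z : ℝ × ℂ =>
      2 * ‖((z.1 / (1 - q⁻¹) : ℝ) : ℂ) ^ c * A (affineArg q z.1 z.2) * B (affineArg q h₀ z.2) -
        ((h₀ / (1 - q⁻¹) : ℝ) : ℂ) ^ c * A (affineArg q h₀ z.2) * B (affineArg q z.1 z.2)‖ /
      (√(‖((z.1 / (1 - q⁻¹) : ℝ) : ℂ) ^ c * A (affineArg q z.1 z.2)‖ ^ 2 +
          ‖B (affineArg q z.1 z.2)‖ ^ 2) *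
        √(‖((h₀ / (1 - q⁻¹) : ℝ) : ℂ) ^ c * A (affineArg q h₀ z.2)‖ ^ 2 +
          ‖B (affineArg q h₀ z.2)‖ ^ 2))) (h₀, x₀) := by
    refine ContinuousAt.div ?_ ?_ ?_
    · exact continuousAt_const.mul (((cC.mul cA).mul cB').sub
        ((continuousAt_const.mul cA').mul cB)).norm
    · exact ((((cC.mul cA).norm.pow 2).add (cB.norm.pow 2)).sqrt).mul
        (((continuousAt_const.mul cA').norm.pow 2).add (cB'.norm.pow 2)).sqrt
    · exact mul_ne_zero (hpos _ _ (hne1 h₀ hh₀ x₀ hu₀V)) (hpos _ _ (hne1 h₀ hh₀ x₀ hu₀V))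
  have eD := cD.eventually_lt continuousAt_const (g := fun _ => δ) (by simpa using hδ)
  have e1 := cu.eventually_mem (hVo.mem_nhds hu₀V)
  have e2 := cu'.eventually_mem (hVo.mem_nhds hu₀V)
  have e3 : ∀ᶠ z : ℝ × ℂ in 𝓝 (h₀, x₀), 0 < z.1 :=
    (isOpen_lt continuous_const continuous_fst).mem_nhds hh₀
  filter_upwards [eD, e1, e2, e3] with z hz h1 h2 h3
  rw [hval z.1 h3 z.2 h1, hval h₀ hh₀ z.2 h2,
    chordalDist_spherePoint (hne1 _ h3 _ h1) (hne1 _ hh₀ _ h2)]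
  exact hz

lemma chordalDist_some_le (z w : ℂ) :
    chordalDist (OnePoint.some z) (OnePoint.some w) ≤ 2 * ‖z - w‖ := by
  have h : ∀ z : ℂ, 1 ≤ √(1 + ‖z‖ ^ 2) := fun z => Real.one_le_sqrt.2 (by nlinarith [norm_nonneg z])
  exact div_le_self (by positivity) (one_le_mul_of_one_le_of_one_le (h z) (h w))

/-- Normality of the family of the characters with bounded steps. -/
lemma meromorphicNormalOn_qhChar {q : ℝ} (hq : 1 < q) (c : ℂ) (ε : ℝ) :
    MeromorphicNormalOn (fun h : Set.Ioc (0 : ℝ) ε => qhChar q h c) (ray q c)ᶜ := by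
  have hNF : ∀ h : ℝ, 0 < h → MeromorphicNFOn (qhChar q h c) (ray q c)ᶜ := fun h hh x _ => by
    rw [qhChar_eq_rawChar hq hh]
    exact meromorphicNFOn_toMeromorphicNFOn _ _ (mem_univ x)
  refine ⟨fun h => hNF h h.2.1, fun s => ?_⟩
  obtain ⟨h₀, hh₀, φ, hφ, hlim⟩ := isCompact_Icc.tendsto_subseq
    (x := fun n => ((s n : ℝ))) fun n => (⟨(s n).2.1.le, (s n).2.2⟩ : (s n : ℝ) ∈ Icc (0 : ℝ) ε)
  rcases hh₀.1.eq_or_lt with h0 | h0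
  · obtain ⟨ψ, hψ, ξ, -, H⟩ := exists_subseq_qhChar hq c (h := fun n => (s (φ n) : ℝ))
      (fun n => (s (φ n)).2.1) (hlim.trans (by rw [← h0]))
    refine ⟨φ ∘ ψ, hφ.comp hψ, sphereValue (limitChar q ξ c), Or.inl ⟨limitChar q ξ c,
      fun x hx => (analyticAt_limitChar hq ξ hx).meromorphicNFAt, fun _ _ => rfl⟩, ?_⟩
    intro K hK hKc δ hδ
    filter_upwards [H K hK hKc (δ / 2) (half_pos hδ)] with n hn x hx
    obtain ⟨ha, hb⟩ := hn x hx
    rw [sphereValue_of_analyticAt (analyticAt_limitChar hq ξ (hK hx))]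
    simp only [Function.comp_apply]
    rw [sphereValue_of_analyticAt ha]
    linarith [chordalDist_some_le (qhChar q (s (φ (ψ n))) c x) (limitChar q ξ c x)]
  · refine ⟨φ, hφ, sphereValue (qhChar q h₀ c), Or.inl ⟨_, hNF h₀ h0, fun _ _ => rfl⟩, ?_⟩
    intro K hK hKc δ hδ
    exact hlim.eventually (eventually_chordalDist_qhChar_lt hq c h0 hKc hδ)

/-! ### An Euler product common to the cases `q > 1` and `q = 1` -/

/-- The `p`-number `[c]_p = (1-p^c)/(1-p)`, with the value `c` for `p = 1`. -/
def qNumber (p : ℝ) (c : ℂ) : ℂ := if p = 1 then c else (1 - (p : ℂ) ^ c) / (1 - p)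

/-- The factor `[j+1]_p - p^j x/h` of the numerator of the Euler product. -/
def eulerBase (p h : ℝ) (x : ℂ) (j : ℕ) : ℂ :=
  ((∑ i ∈ Finset.range (j + 1), p ^ i : ℝ) : ℂ) - (p : ℂ) ^ j * (x / h)

/-- The increment of `eulerBase`. -/
def eulerStep (p h : ℝ) (x : ℂ) (j : ℕ) : ℂ := (p : ℂ) ^ j * (p + (1 - p) * (x / h))

/-- The `N`-th approximation of `e_c^{(q,h)}(x)`, for `p = 1/q` and `d = [c]_p`. The power
`(eulerBase p h x N) ^ c` stands for the missing factors of the product. -/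
def eulerApprox (c d : ℂ) (p h : ℝ) (x : ℂ) (N : ℕ) : ℂ :=
  (h : ℂ) ^ c * (∏ j ∈ Finset.range N, eulerBase p h x j /
    (eulerBase p h x j + d * eulerStep p h x j)) * eulerBase p h x N ^ c

lemma eulerBase_succ (p h : ℝ) (x : ℂ) (j : ℕ) :
    eulerBase p h x (j + 1) = eulerBase p h x j + eulerStep p h x j := by
  rw [eulerBase, eulerBase, eulerStep, Finset.sum_range_succ _ (j + 1)]
  push_cast
  ring

/-! #### First-order expansion of powers -/

lemma norm_one_add_cpow_sub_le {c ρ : ℂ} (h1 : ‖ρ‖ ≤ 1 / 2) (h2 : 2 * ‖c‖ * ‖ρ‖ ≤ 1) :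
    ‖(1 + ρ) ^ c - 1 - c * ρ‖ ≤ (4 * ‖c‖ ^ 2 + ‖c‖) * ‖ρ‖ ^ 2 := by
  have hρ : ‖ρ‖ < 1 := by linarith
  have hne : 1 + ρ ≠ 0 := fun h => by
    rw [show ρ = -1 by linear_combination h] at h1
    norm_num at h1
  set L := Complex.log (1 + ρ) with hL
  have hL1 : ‖L - ρ‖ ≤ ‖ρ‖ ^ 2 := by
    refine (Complex.norm_log_one_add_sub_self_le hρ).trans ?_
    have : (1 - ‖ρ‖)⁻¹ ≤ 2 := by
      rw [inv_le_comm₀ (by linarith) (by norm_num)]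
      linarith
    nlinarith [sq_nonneg ‖ρ‖]
  have hL2 : ‖L‖ ≤ 2 * ‖ρ‖ := by
    have h := norm_add_le (L - ρ) ρ
    rw [sub_add_cancel] at h
    nlinarith [norm_nonneg ρ]
  have hcL : ‖L * c‖ ≤ 2 * ‖c‖ * ‖ρ‖ := by
    rw [norm_mul]
    nlinarith [norm_nonneg c]
  have he := Complex.norm_exp_sub_one_sub_id_le (hcL.trans h2)
  rw [Complex.cpow_def_of_ne_zero hne, ← hL]
  have h3 : ‖L * c‖ ^ 2 ≤ (2 * ‖c‖ * ‖ρ‖) ^ 2 := pow_le_pow_left₀ (norm_nonneg _) hcL 2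
  have h4 : ‖c * (L - ρ)‖ ≤ ‖c‖ * ‖ρ‖ ^ 2 := by
    rw [norm_mul]
    exact mul_le_mul_of_nonneg_left hL1 (norm_nonneg c)
  calc ‖Complex.exp (L * c) - 1 - c * ρ‖
      = ‖(Complex.exp (L * c) - 1 - L * c) + c * (L - ρ)‖ := by congr 1; ring
    _ ≤ _ := (norm_add_le _ _).trans (by nlinarith)

lemma norm_qNumber_sub_le {c : ℂ} {p : ℝ} (h1 : |1 - p| ≤ 1 / 2) (h2 : 2 * ‖c‖ * |1 - p| ≤ 1) :
    ‖qNumber p c - c‖ ≤ (4 * ‖c‖ ^ 2 + ‖c‖) * |1 - p| := by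
  by_cases hp : p = 1
  · simp [qNumber, hp]
  · have hp' : (1 : ℂ) - p ≠ 0 := by
      rw [sub_ne_zero]; exact_mod_cast Ne.symm hp
    have hn : ‖((-(1 - p) : ℝ) : ℂ)‖ = |1 - p| := by
      rw [Complex.norm_real, Real.norm_eq_abs, abs_neg]
    have h := norm_one_add_cpow_sub_le (c := c) (ρ := ((-(1 - p) : ℝ) : ℂ))
      (by rwa [hn]) (by rwa [hn])
    rw [hn] at h
    have hpos : 0 < |1 - p| := abs_pos.2 (sub_ne_zero.2 (Ne.symm hp))
    have e : qNumber p c - c =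
        -((1 + ((-(1 - p) : ℝ) : ℂ)) ^ c - 1 - c * ((-(1 - p) : ℝ) : ℂ)) / ((1 - p : ℝ) : ℂ) := by
      rw [qNumber, if_neg hp]
      push_cast
      rw [show (1 : ℂ) + -(1 - (p : ℂ)) = p by ring]
      field_simp
      ring
    rw [e, norm_div, norm_neg, Complex.norm_real, Real.norm_eq_abs, div_le_iff₀ hpos]
    linarith [h, sq (|1 - p|)]

lemma norm_cpow_div_sub_one_le {c d ρ : ℂ} (h1 : ‖ρ‖ ≤ 1 / 2) (h2 : 2 * ‖c‖ * ‖ρ‖ ≤ 1)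
    (h3 : 2 * ‖d‖ * ‖ρ‖ ≤ 1) :
    1 + d * ρ ≠ 0 ∧ ‖(1 + ρ) ^ c / (1 + d * ρ) - 1‖ ≤
      2 * (4 * ‖c‖ ^ 2 + ‖c‖) * ‖ρ‖ ^ 2 + 2 * (‖d - c‖ * ‖ρ‖) := by
  have hd : ‖d * ρ‖ ≤ 1 / 2 := by rw [norm_mul]; linarith
  have hlow : 1 / 2 ≤ ‖1 + d * ρ‖ := by
    have h := norm_sub_norm_le (1 : ℂ) (-(d * ρ))
    rw [norm_one, norm_neg, sub_neg_eq_add] at h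
    linarith
  have hne : 1 + d * ρ ≠ 0 := norm_pos_iff.1 (by linarith)
  refine ⟨hne, ?_⟩
  have hnum : ‖(1 + ρ) ^ c - (1 + d * ρ)‖ ≤ (4 * ‖c‖ ^ 2 + ‖c‖) * ‖ρ‖ ^ 2 + ‖d - c‖ * ‖ρ‖ := by
    have h := norm_sub_le ((1 + ρ) ^ c - 1 - c * ρ) ((d - c) * ρ)
    rw [norm_mul] at h
    rw [show (1 + ρ) ^ c - (1 + d * ρ) = (1 + ρ) ^ c - 1 - c * ρ - (d - c) * ρ by ring]
    linarith [norm_one_add_cpow_sub_le h1 h2]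
  rw [div_sub_one hne, norm_div, div_le_iff₀ (by linarith)]
  have h0 : 0 ≤ (4 * ‖c‖ ^ 2 + ‖c‖) * ‖ρ‖ ^ 2 + ‖d - c‖ * ‖ρ‖ := by positivity
  nlinarith

lemma sum_inv_sq_le {B : ℝ} (hB : 1 ≤ B) (n : ℕ) :
    ∑ i ∈ Finset.range n, 1 / ((i : ℝ) + B) ^ 2 ≤ 2 / B := by
  have key : ∑ i ∈ Finset.range n, 1 / ((i : ℝ) + B) ^ 2 ≤ 2 / B - 2 / (n + B) := by
    induction n with
    | zero => simp
    | succ n ih =>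
      rw [Finset.sum_range_succ]
      have hn : (0 : ℝ) ≤ n := Nat.cast_nonneg n
      have hy : 1 ≤ (n : ℝ) + B := by linarith
      have h : 1 / ((n : ℝ) + B) ^ 2 ≤ 2 / (n + B) - 2 / (n + B + 1) := by
        rw [div_sub_div _ _ (by positivity) (by positivity),
          div_le_div_iff₀ (by positivity) (by positivity)]
        nlinarith
      push_cast
      rw [show (n : ℝ) + 1 + B = n + B + 1 by ring]
      linarith
  have : 0 ≤ 2 / ((n : ℝ) + B) := by positivity
  linarith

/-! #### The tail of the Euler product -/

/-- Control of the factors of index at least `N` of the Euler product: the ratios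
`eulerStep / eulerBase` are at most `D / (i + B)` and `D p^i / B`. -/
structure EulerTail (p h : ℝ) (x : ℂ) (N : ℕ) (D B : ℝ) : Prop where
  mem_slitPlane : ∀ i, eulerBase p h x (N + i) ∈ Complex.slitPlane
  le_div : ∀ i : ℕ, ‖eulerStep p h x (N + i)‖ * (i + B) ≤ D * ‖eulerBase p h x (N + i)‖
  le_pow : ∀ i : ℕ, ‖eulerStep p h x (N + i)‖ * B ≤ D * p ^ i * ‖eulerBase p h x (N + i)‖

/-- The sum of the relative errors of the factors of the tail is `O((D² + D)/B)`. The bound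
`D/(i + B)` serves for the terms of order `ρ²`; the term `(d - c) ρ`, where `d - c = O(1 - p)`,
is of size `(1-p) p^i D/B`, and the sum over `i` of these is at most `D/B`. -/
lemma exists_sum_error_le (c : ℂ) : ∃ C > (0 : ℝ), ∃ r > (0 : ℝ), ∀ p : ℝ, 0 < p → p ≤ 1 →
    1 - r ≤ p → ∀ (ρ : ℕ → ℂ) (D B : ℝ), 0 ≤ D → 1 ≤ B → D ≤ r * B →
    (∀ i : ℕ, ‖ρ i‖ ≤ D / (i + B)) → (∀ i : ℕ, ‖ρ i‖ ≤ D * p ^ i / B) →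
    (∀ i, 1 + qNumber p c * ρ i ≠ 0) ∧ ∀ n, ∑ i ∈ Finset.range n,
      ‖(1 + ρ i) ^ c / (1 + qNumber p c * ρ i) - 1‖ ≤ C * (D ^ 2 + D) / B := by
  set A : ℝ := 4 * ‖c‖ ^ 2 + ‖c‖ with hA
  have hA0 : 0 ≤ A := by positivity
  refine ⟨4 * A + 1, by positivity, 1 / (2 * (A + ‖c‖ + 2)), by positivity, ?_⟩
  set r : ℝ := 1 / (2 * (A + ‖c‖ + 2)) with hr
  have hr0 : 0 < r := by positivity
  have hrA : r * (2 * (A + ‖c‖ + 2)) = 1 := by rw [hr]; field_simp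
  intro p hp hp1 hpr ρ D B hD hB hDB hρ1 hρ2
  have hcn := norm_nonneg c
  have hB0 : 0 < B := by linarith
  have hr2 : r ≤ 1 / 2 := by nlinarith
  have hpabs : |1 - p| = 1 - p := abs_of_nonneg (by linarith)
  have hdc : ‖qNumber p c - c‖ ≤ A * (1 - p) := by
    have := norm_qNumber_sub_le (c := c) (p := p) (by rw [hpabs]; linarith)
      (by rw [hpabs]; nlinarith)
    rwa [hpabs] at this
  have hdc1 : ‖qNumber p c - c‖ ≤ 1 := by nlinarith
  have hd : ‖qNumber p c‖ ≤ ‖c‖ + 1 := by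
    have h := norm_add_le (qNumber p c - c) c
    rw [sub_add_cancel] at h
    linarith
  have hρr : ∀ i, ‖ρ i‖ ≤ r := fun i => by
    refine (hρ1 i).trans ?_
    have hi : (0 : ℝ) ≤ i := Nat.cast_nonneg i
    rw [div_le_iff₀ (by positivity)]
    nlinarith
  have hterm := fun i => norm_cpow_div_sub_one_le (c := c) (d := qNumber p c) (ρ := ρ i)
    ((hρr i).trans hr2) (by nlinarith [hρr i, norm_nonneg (ρ i)])
    (by nlinarith [hρr i, norm_nonneg (ρ i), norm_nonneg (qNumber p c)])
  refine ⟨fun i => (hterm i).1, fun n => ?_⟩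
  have hsq : ∑ i ∈ Finset.range n, ‖ρ i‖ ^ 2 ≤ D ^ 2 * (2 / B) := by
    refine le_trans (Finset.sum_le_sum fun i _ => ?_)
      ((Finset.mul_sum _ _ (D ^ 2)).symm.le.trans
        (mul_le_mul_of_nonneg_left (sum_inv_sq_le hB n) (sq_nonneg D)))
    calc ‖ρ i‖ ^ 2 ≤ (D / (i + B)) ^ 2 := pow_le_pow_left₀ (norm_nonneg _) (hρ1 i) 2
      _ = D ^ 2 * (1 / ((i : ℝ) + B) ^ 2) := by rw [div_pow]; ring
  have hlin : (1 - p) * ∑ i ∈ Finset.range n, ‖ρ i‖ ≤ D / B := by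
    have hg : (1 - p) * ∑ i ∈ Finset.range n, p ^ i ≤ 1 := by
      rw [mul_neg_geom_sum]
      linarith [pow_pos hp n]
    calc (1 - p) * ∑ i ∈ Finset.range n, ‖ρ i‖
        ≤ (1 - p) * ∑ i ∈ Finset.range n, D / B * p ^ i := by
          refine mul_le_mul_of_nonneg_left (Finset.sum_le_sum fun i _ => ?_) (by linarith)
          rw [div_mul_eq_mul_div]
          exact hρ2 i
      _ = D / B * ((1 - p) * ∑ i ∈ Finset.range n, p ^ i) := by rw [← Finset.mul_sum]; ring
      _ ≤ D / B * 1 := mul_le_mul_of_nonneg_left hg (by positivity)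
      _ = D / B := mul_one _
  calc ∑ i ∈ Finset.range n, ‖(1 + ρ i) ^ c / (1 + qNumber p c * ρ i) - 1‖
      ≤ ∑ i ∈ Finset.range n, (2 * A * ‖ρ i‖ ^ 2 + 2 * (‖qNumber p c - c‖ * ‖ρ i‖)) :=
        Finset.sum_le_sum fun i _ => (hterm i).2
    _ = 2 * A * ∑ i ∈ Finset.range n, ‖ρ i‖ ^ 2 +
        2 * (‖qNumber p c - c‖ * ∑ i ∈ Finset.range n, ‖ρ i‖) := by
        rw [Finset.sum_add_distrib, ← Finset.mul_sum, ← Finset.mul_sum, ← Finset.mul_sum]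
    _ ≤ 2 * A * (D ^ 2 * (2 / B)) + 2 * (A * (D / B)) := by
        have h0 : 0 ≤ ∑ i ∈ Finset.range n, ‖ρ i‖ := Finset.sum_nonneg fun i _ => norm_nonneg _
        have h1 : ‖qNumber p c - c‖ * ∑ i ∈ Finset.range n, ‖ρ i‖ ≤ A * (D / B) := by
          calc _ ≤ A * (1 - p) * ∑ i ∈ Finset.range n, ‖ρ i‖ :=
                mul_le_mul_of_nonneg_right hdc h0
            _ = A * ((1 - p) * ∑ i ∈ Finset.range n, ‖ρ i‖) := by ring
            _ ≤ _ := mul_le_mul_of_nonneg_left hlin hA0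
        have h2 := mul_le_mul_of_nonneg_left hsq (by positivity : 0 ≤ 2 * A)
        linarith
    _ ≤ (4 * A + 1) * (D ^ 2 + D) / B := by
        rw [show 2 * A * (D ^ 2 * (2 / B)) + 2 * (A * (D / B)) =
          (4 * A * D ^ 2 + 2 * A * D) / B by ring]
        gcongr
        nlinarith [sq_nonneg D, mul_nonneg hA0 hD]

/-- Multiplicativity of the principal power: the arguments of `w` and `w + k` have the same sign, so
that their difference lies in `]-π, π[`. -/
lemma cpow_eq_cpow_mul_one_add {w k c : ℂ} (hw : w ∈ Complex.slitPlane)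
    (hwk : w + k ∈ Complex.slitPlane) (him : 0 ≤ w.im ↔ 0 ≤ (w + k).im) :
    (w + k) ^ c = w ^ c * (1 + k / w) ^ c := by
  have hw0 := Complex.slitPlane_ne_zero hw
  have hwk0 := Complex.slitPlane_ne_zero hwk
  have harg : Complex.arg (w + k) + Complex.arg w⁻¹ ∈ Ioc (-Real.pi) Real.pi := by
    have hwpi := Complex.mem_slitPlane_iff_arg.1 hw
    have hwkpi := Complex.mem_slitPlane_iff_arg.1 hwk
    rw [Complex.arg_inv, if_neg hwpi.1]
    have a1 := Complex.arg_mem_Ioc w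
    have a2 := Complex.arg_mem_Ioc (w + k)
    by_cases h : 0 ≤ w.im
    · have b1 := Complex.arg_nonneg_iff.2 h
      have b2 := Complex.arg_nonneg_iff.2 (him.1 h)
      have b3 := lt_of_le_of_ne a1.2 hwpi.1
      exact ⟨by linarith, by linarith [a2.2]⟩
    · have b1 := Complex.arg_neg_iff.2 (not_le.1 h)
      have b2 := Complex.arg_neg_iff.2 (not_le.1 fun h' => h (him.2 h'))
      exact ⟨by linarith [a2.1], by linarith [a1.1]⟩
  have hlog : Complex.log (1 + k / w) = Complex.log (w + k) - Complex.log w := by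
    rw [show 1 + k / w = (w + k) * w⁻¹ by field_simp,
      (Complex.log_mul_eq_add_log_iff hwk0 (inv_ne_zero hw0)).2 harg,
      Complex.log_inv _ (Complex.mem_slitPlane_iff_arg.1 hw).1, sub_eq_add_neg]
  have h1 : 1 + k / w ≠ 0 := by
    rw [show 1 + k / w = (w + k) * w⁻¹ by field_simp]
    exact mul_ne_zero hwk0 (inv_ne_zero hw0)
  rw [Complex.cpow_def_of_ne_zero hwk0, Complex.cpow_def_of_ne_zero hw0,
    Complex.cpow_def_of_ne_zero h1, hlog, ← Complex.exp_add]
  ring_nf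

lemma eulerBase_im_nonneg_iff {p h : ℝ} (hp : 0 < p) (hh : 0 < h) (x : ℂ) (j : ℕ) :
    0 ≤ (eulerBase p h x j).im ↔ x.im ≤ 0 := by
  have e : (eulerBase p h x j).im = -(p ^ j / h * x.im) := by
    rw [eulerBase, show (p : ℂ) ^ j * (x / h) = ((p ^ j / h : ℝ) : ℂ) * x by push_cast; ring,
      Complex.sub_im, Complex.ofReal_im, Complex.im_ofReal_mul, zero_sub]
  rw [e, neg_nonneg, ← not_lt, mul_pos_iff_of_pos_left (by positivity), not_lt]

/-- All later approximations differ from the `N`-th one by a relative error which is small with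
`(D² + D)/B`. -/
lemma exists_norm_eulerApprox_sub_le (c : ℂ) : ∃ C > (0 : ℝ), ∃ r > (0 : ℝ), ∀ p : ℝ, 0 < p →
    p ≤ 1 → 1 - r ≤ p → ∀ (h : ℝ) (x : ℂ) (N : ℕ) (D B : ℝ), 0 < h → 0 ≤ D → 1 ≤ B →
    D ≤ r * B → EulerTail p h x N D B →
    (∀ i, eulerBase p h x (N + i) + qNumber p c * eulerStep p h x (N + i) ≠ 0) ∧
    ∀ n, ‖eulerApprox c (qNumber p c) p h x (N + n) - eulerApprox c (qNumber p c) p h x N‖ ≤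
      ‖eulerApprox c (qNumber p c) p h x N‖ * (Real.exp (C * (D ^ 2 + D) / B) - 1) := by
  obtain ⟨C, hC, r, hr, H⟩ := exists_sum_error_le c
  refine ⟨C, hC, r, hr, ?_⟩
  intro p hp hp1 hpr h x N D B hh hD hB hDB hT
  set d := qNumber p c with hd
  set w : ℕ → ℂ := fun i => eulerBase p h x (N + i) with hw
  set k : ℕ → ℂ := fun i => eulerStep p h x (N + i) with hk
  have hw0 : ∀ i, w i ≠ 0 := fun i => Complex.slitPlane_ne_zero (hT.mem_slitPlane i)
  have hwn : ∀ i, 0 < ‖w i‖ := fun i => norm_pos_iff.2 (hw0 i)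
  have hB0 : 0 < B := by linarith
  obtain ⟨H1, H2⟩ := H p hp hp1 hpr (fun i => k i / w i) D B hD hB hDB
    (fun i => by
      rw [norm_div, div_le_div_iff₀ (hwn i) (by positivity)]
      exact hT.le_div i)
    (fun i => by
      rw [norm_div, div_le_div_iff₀ (hwn i) hB0]
      exact hT.le_pow i)
  have hden : ∀ i, w i + d * k i = w i * (1 + d * (k i / w i)) := fun i => by
    field_simp [hw0 i]
  refine ⟨fun i => ?_, fun n => ?_⟩
  · have := mul_ne_zero (hw0 i) (H1 i)
    rwa [← hden] at this
  · set ε : ℕ → ℂ := fun i => (1 + k i / w i) ^ c / (1 + d * (k i / w i)) - 1 with hε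
    have hprod : eulerApprox c d p h x (N + n) =
        eulerApprox c d p h x N * ∏ i ∈ Finset.range n, (1 + ε i) := by
      induction n with
      | zero => simp
      | succ n ih =>
        rw [Finset.prod_range_succ, ← mul_assoc, ← ih]
        have hs : eulerBase p h x (N + (n + 1)) = w n + k n := eulerBase_succ p h x (N + n)
        have hpow : (w n + k n) ^ c = w n ^ c * (1 + k n / w n) ^ c := by
          refine cpow_eq_cpow_mul_one_add (hT.mem_slitPlane n)
            (hs ▸ hT.mem_slitPlane (n + 1)) ?_
          rw [← hs, eulerBase_im_nonneg_iff hp hh, eulerBase_im_nonneg_iff hp hh]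
        rw [eulerApprox, eulerApprox, hs, hpow, ← add_assoc, Finset.prod_range_succ]
        change _ * (_ * (w n / (w n + d * k n))) * _ = _ * _ * w n ^ c * (1 + ε n)
        rw [hden, hε]
        have := hw0 n
        have := H1 n
        simp only [add_sub_cancel]
        field_simp
    rw [hprod, ← mul_sub_one, norm_mul]
    refine mul_le_mul_of_nonneg_left ?_ (norm_nonneg _)
    refine (Finset.norm_prod_one_add_sub_one_le _ _).trans ?_
    gcongr
    exact H2 n

/-! #### The limit of the Euler product -/

lemma tendsto_eulerApprox_of_one_lt {q h : ℝ} (hq : 1 < q) (hh : 0 < h) {c x : ℂ}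
    (hne : ∀ j, eulerBase q⁻¹ h x j + qNumber q⁻¹ c * eulerStep q⁻¹ h x j ≠ 0) :
    qPochInf q⁻¹ (((q⁻¹ : ℝ) : ℂ) ^ c * ((1 - (q⁻¹ : ℝ)) * (x / h) + (q⁻¹ : ℝ))) ≠ 0 ∧
    Tendsto (eulerApprox c (qNumber q⁻¹ c) q⁻¹ h x) atTop (𝓝 (rawChar q h c x)) := by
  have hp : 0 < q⁻¹ := by positivity
  have hp1 : q⁻¹ < 1 := inv_lt_one_of_one_lt₀ hq
  rw [rawChar]
  generalize q⁻¹ = p at *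
  have h1p : (1 : ℂ) - p ≠ 0 := by rw [sub_ne_zero]; exact_mod_cast hp1.ne'
  set u : ℂ := (1 - p) * (x / h) + p with hu
  set d := qNumber p c with hd
  have hd' : (1 - p) * d = 1 - (p : ℂ) ^ c := by
    rw [hd, qNumber, if_neg hp1.ne]
    field_simp
  have hbase : ∀ j, (1 - (p : ℂ)) * eulerBase p h x j = 1 - (p : ℂ) ^ j * u := by
    intro j
    have hg : (1 - (p : ℂ)) * ((∑ i ∈ Finset.range (j + 1), p ^ i : ℝ) : ℂ) =
        1 - (p : ℂ) ^ (j + 1) := by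
      have := mul_neg_geom_sum p (j + 1)
      exact_mod_cast this
    rw [eulerBase, mul_sub, hg, hu]
    ring
  have hstep : ∀ j, eulerStep p h x j = (p : ℂ) ^ j * u := by
    intro j
    rw [eulerStep, hu, add_comm]
  have hden : ∀ j, (1 - (p : ℂ)) * (eulerBase p h x j + d * eulerStep p h x j) =
      1 - (p : ℂ) ^ j * ((p : ℂ) ^ c * u) := by
    intro j
    rw [mul_add, hbase, ← mul_assoc, hd', hstep]
    ring
  have hP : qPochInf p ((p : ℂ) ^ c * u) ≠ 0 := by
    refine qPochInf_ne_zero hp hp1 fun j hj => hne j ?_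
    have := hden j
    rw [hj, sub_self, mul_eq_zero] at this
    exact this.resolve_left h1p
  refine ⟨hP, ?_⟩
  have hprod : Tendsto (fun N => ∏ j ∈ Finset.range N, eulerBase p h x j /
      (eulerBase p h x j + d * eulerStep p h x j)) atTop
      (𝓝 (qPochInf p u / qPochInf p ((p : ℂ) ^ c * u))) := by
    refine ((tendsto_prod_qPochInf hp hp1 u).div
      (tendsto_prod_qPochInf hp hp1 ((p : ℂ) ^ c * u)) hP).congr fun N => ?_
    simp only [Pi.div_apply]
    rw [← Finset.prod_div_distrib]
    refine Finset.prod_congr rfl fun j _ => ?_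
    rw [← hbase, ← hden, mul_div_mul_left _ _ h1p]
  have hbl : Tendsto (fun N => eulerBase p h x N) atTop (𝓝 ((1 - (p : ℂ))⁻¹)) := by
    have h0 : Tendsto (fun N : ℕ => (p : ℂ) ^ N) atTop (𝓝 0) :=
      tendsto_pow_atTop_nhds_zero_of_norm_lt_one
        (by rwa [Complex.norm_real, Real.norm_of_nonneg hp.le])
    have h1 := ((h0.mul_const u).const_sub 1).const_mul ((1 - (p : ℂ))⁻¹)
    rw [zero_mul, sub_zero, mul_one] at h1
    refine h1.congr fun N => ?_
    rw [← hbase, inv_mul_cancel_left₀ h1p]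
  have hinv : (1 - (p : ℂ))⁻¹ = (((1 - p)⁻¹ : ℝ) : ℂ) := by push_cast; rfl
  have hpow : Tendsto (fun N => eulerBase p h x N ^ c) atTop (𝓝 ((((1 - p)⁻¹ : ℝ) : ℂ) ^ c)) := by
    rw [← hinv]
    refine hbl.cpow tendsto_const_nhds ?_
    rw [hinv, Complex.ofReal_mem_slitPlane]
    exact inv_pos.2 (by linarith)
  have hall := (hprod.const_mul ((h : ℂ) ^ c)).mul hpow
  have e : ((h / (1 - p) : ℝ) : ℂ) ^ c = (h : ℂ) ^ c * (((1 - p)⁻¹ : ℝ) : ℂ) ^ c := by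
    rw [div_eq_mul_inv, Complex.ofReal_mul, Complex.mul_cpow_ofReal_nonneg hh.le
      (inv_nonneg.2 (by linarith))]
  rw [e]
  refine (hall.congr fun N => ?_).trans_eq ?_
  · rfl
  · congr 1; ring

lemma ofReal_mul_cpow {r : ℝ} (hr : 0 < r) (z c : ℂ) :
    ((r : ℂ) * z) ^ c = (r : ℂ) ^ c * z ^ c := by
  have hr0 : (r : ℂ) ≠ 0 := by exact_mod_cast hr.ne'
  by_cases hz : z = 0
  · by_cases hc : c = 0 <;> simp [hz, hc]
  · rw [Complex.cpow_def_of_ne_zero (mul_ne_zero hr0 hz), Complex.cpow_def_of_ne_zero hr0,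
      Complex.cpow_def_of_ne_zero hz, Complex.log_ofReal_mul hr hz, ← Complex.ofReal_log hr.le,
      ← Complex.exp_add]
    ring_nf

/-- Euler's limit formula for a quotient of two values of the Gamma function. -/
lemma tendsto_prod_div_mul_cpow {a b : ℂ} (hb : ∀ j : ℕ, b + j ≠ 0) :
    Tendsto (fun N : ℕ => (∏ j ∈ Finset.range N, (a + j) / (b + j)) * (a + N) ^ (b - a)) atTop
      (𝓝 (Complex.Gamma b / Complex.Gamma a)) := by
  by_cases ha : ∃ m : ℕ, a + m = 0
  · obtain ⟨m, hm⟩ := ha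
    have h0 : Complex.Gamma a = 0 :=
      Complex.Gamma_eq_zero_iff _ |>.2 ⟨m, by linear_combination hm⟩
    rw [h0, div_zero]
    refine tendsto_const_nhds.congr' ?_
    filter_upwards [eventually_gt_atTop m] with N hN
    rw [Finset.prod_eq_zero (Finset.mem_range.2 hN) (by rw [hm, zero_div]), zero_mul]
  · push Not at ha
    have hGa : Complex.Gamma a ≠ 0 :=
      Complex.Gamma_ne_zero fun m hm => ha m (by rw [hm]; ring)
    have h1 := (Complex.GammaSeq_tendsto_Gamma b).div (Complex.GammaSeq_tendsto_Gamma a) hGa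
    have h2 : Tendsto (fun N : ℕ => (1 + (a + 1) * ((N : ℂ))⁻¹) ^ (b - a)) atTop (𝓝 1) := by
      have hinv : Tendsto (fun N : ℕ => ((N : ℂ))⁻¹) atTop (𝓝 0) := tendsto_inv_atTop_nhds_zero_nat
      have h := ((hinv.const_mul (a + 1)).const_add 1)
      rw [mul_zero, add_zero] at h
      simpa using h.cpow (tendsto_const_nhds (x := b - a)) (by simp)
    have h3 := h1.mul h2
    rw [mul_one] at h3
    refine (tendsto_add_atTop_iff_nat 1).1 (h3.congr' ?_)
    filter_upwards [eventually_gt_atTop 0] with N hN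
    have hN0 : (N : ℂ) ≠ 0 := by exact_mod_cast hN.ne'
    have hf : ((N.factorial : ℕ) : ℂ) ≠ 0 := by exact_mod_cast N.factorial_ne_zero
    have hA : ∏ j ∈ Finset.range (N + 1), (a + j) ≠ 0 := Finset.prod_ne_zero_iff.2 fun j _ => ha j
    have hB : ∏ j ∈ Finset.range (N + 1), (b + j) ≠ 0 := Finset.prod_ne_zero_iff.2 fun j _ => hb j
    have e1 : (a + ((N + 1 : ℕ) : ℂ)) ^ (b - a) =
        (N : ℂ) ^ (b - a) * (1 + (a + 1) * ((N : ℂ))⁻¹) ^ (b - a) := by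
      have h := ofReal_mul_cpow (Nat.cast_pos.2 hN : (0 : ℝ) < N) (1 + (a + 1) * ((N : ℂ))⁻¹) (b - a)
      rw [Complex.ofReal_natCast] at h
      rw [← h]
      congr 1
      push_cast
      field_simp
      ring
    rw [e1, Complex.cpow_sub _ _ hN0, Finset.prod_div_distrib]
    have hNa : (N : ℂ) ^ a ≠ 0 := by rw [Ne, Complex.cpow_eq_zero_iff]; tauto
    simp only [Pi.div_apply, Complex.GammaSeq]
    field_simp

/-- The quotient of Gamma functions whose normal form is `e_c^{(1,h)}`. -/
def rawCharOne (h : ℝ) (c x : ℂ) : ℂ :=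
  (h : ℂ) ^ c * (Complex.Gamma (1 + c - x / h) / Complex.Gamma (1 - x / h))

lemma qhChar_one_eq {h : ℝ} (hh : 0 < h) (c : ℂ) :
    qhChar 1 h c = toMeromorphicNFOn (rawCharOne h c) Set.univ := by
  rw [qhChar, if_neg (lt_irrefl _), if_pos hh]
  rfl

lemma analyticAt_Gamma {s : ℂ} (hs : ∀ m : ℕ, s ≠ -m) : AnalyticAt ℂ Complex.Gamma s := by
  have h := ((Complex.differentiable_one_div_Gamma).analyticAt s).inv
    (inv_ne_zero (Complex.Gamma_ne_zero hs))
  exact h.congr (.of_forall fun z => by simp)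

lemma meromorphicOn_rawCharOne (h : ℝ) (c : ℂ) : MeromorphicOn (rawCharOne h c) Set.univ := by
  intro x _
  refine (MeromorphicAt.const _ x).mul (MeromorphicAt.div ?_ ?_)
  · exact (Meromorphic.Gamma (1 + c - x / h)).comp_analyticAt
      (g := fun x : ℂ => 1 + c - x / h) (Differentiable.analyticAt (by fun_prop) x)
  · exact (Meromorphic.Gamma (1 - x / h)).comp_analyticAt
      (g := fun x : ℂ => 1 - x / h) (Differentiable.analyticAt (by fun_prop) x)

lemma analyticAt_rawCharOne {h : ℝ} {c x : ℂ} (hx : ∀ m : ℕ, 1 + c - x / h ≠ -m) :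
    AnalyticAt ℂ (rawCharOne h c) x := by
  have h1 : AnalyticAt ℂ (fun x : ℂ => Complex.Gamma (1 + c - x / h)) x :=
    (analyticAt_Gamma hx).fun_comp
      (g := Complex.Gamma) (f := fun x : ℂ => 1 + c - x / h) (Differentiable.analyticAt (by fun_prop) x)
  have h2 : AnalyticAt ℂ (fun x : ℂ => (Complex.Gamma (1 - x / h))⁻¹) x := by
    have hd := Complex.differentiable_one_div_Gamma
    exact Differentiable.analyticAt (f := fun x : ℂ => (Complex.Gamma (1 - x / h))⁻¹)
      (hd.comp (g := fun s => (Complex.Gamma s)⁻¹) (f := fun x : ℂ => 1 - x / h) (by fun_prop)) x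
  have h3 : rawCharOne h c = fun x : ℂ => (h : ℂ) ^ c *
      (Complex.Gamma (1 + c - x / h) * (Complex.Gamma (1 - x / h))⁻¹) := by
    funext y
    rw [rawCharOne, div_eq_mul_inv]
  rw [h3]
  exact analyticAt_const.mul (h1.mul h2)

/-- At a point where no factor of the Euler product has a pole, the character is the limit of the
Euler product. -/
lemma tendsto_eulerApprox {q h : ℝ} (hq : 1 ≤ q) (hh : 0 < h) {c x : ℂ}
    (hne : ∀ j, eulerBase q⁻¹ h x j + qNumber q⁻¹ c * eulerStep q⁻¹ h x j ≠ 0) :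
    AnalyticAt ℂ (qhChar q h c) x ∧
    Tendsto (eulerApprox c (qNumber q⁻¹ c) q⁻¹ h x) atTop (𝓝 (qhChar q h c x)) := by
  rcases hq.eq_or_lt with rfl | hq
  · have hbase : ∀ j, eulerBase (1 : ℝ)⁻¹ h x j = 1 - x / h + j := fun j => by
      simp [eulerBase]; ring
    have hstep : ∀ j, eulerStep (1 : ℝ)⁻¹ h x j = 1 := fun j => by simp [eulerStep]
    have hnum : qNumber (1 : ℝ)⁻¹ c = c := by simp [qNumber]
    simp only [hbase, hstep, hnum, mul_one] at hne
    have hb : ∀ j : ℕ, 1 + c - x / h + j ≠ 0 := fun j h0 => hne j (by linear_combination h0)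
    have hx : ∀ m : ℕ, 1 + c - x / h ≠ -m := fun m h0 => hb m (by rw [h0]; ring)
    rw [qhChar_one_eq hh]
    refine ⟨analyticAt_toMeromorphicNFOn (meromorphicOn_rawCharOne h c) (mem_univ x)
      (analyticAt_rawCharOne hx), ?_⟩
    rw [toMeromorphicNFOn_apply_of_analyticAt (meromorphicOn_rawCharOne h c) (mem_univ x)
      (analyticAt_rawCharOne hx)]
    have h1 := (tendsto_prod_div_mul_cpow (a := 1 - x / h) hb).const_mul ((h : ℂ) ^ c)
    refine h1.congr fun N => ?_
    rw [eulerApprox, hnum, mul_assoc]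
    simp only [hbase, hstep, mul_one]
    congr 2
    · refine Finset.prod_congr rfl fun j _ => ?_
      ring_nf
    · ring_nf
  · obtain ⟨h1, h2⟩ := tendsto_eulerApprox_of_one_lt hq hh hne
    refine ⟨analyticAt_qhChar hq hh h1, ?_⟩
    rwa [qhChar_apply hq hh h1]

/-- Comparison of the character with the `N`-th approximation of its Euler product. -/
lemma exists_norm_qhChar_sub_le (c : ℂ) : ∃ C > (0 : ℝ), ∃ r > (0 : ℝ), ∀ q : ℝ, 1 ≤ q →
    1 - r ≤ q⁻¹ → ∀ (h : ℝ) (x : ℂ) (N : ℕ) (D B : ℝ), 0 < h → 0 ≤ D → 1 ≤ B →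
    D ≤ r * B → EulerTail q⁻¹ h x N D B →
    (∀ j < N, eulerBase q⁻¹ h x j + qNumber q⁻¹ c * eulerStep q⁻¹ h x j ≠ 0) →
    AnalyticAt ℂ (qhChar q h c) x ∧
    ‖qhChar q h c x - eulerApprox c (qNumber q⁻¹ c) q⁻¹ h x N‖ ≤
      ‖eulerApprox c (qNumber q⁻¹ c) q⁻¹ h x N‖ * (Real.exp (C * (D ^ 2 + D) / B) - 1) := by
  obtain ⟨C, hC, r, hr, H⟩ := exists_norm_eulerApprox_sub_le c
  refine ⟨C, hC, r, hr, ?_⟩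
  intro q hq hqr h x N D B hh hD hB hDB hT hN
  obtain ⟨H1, H2⟩ := H q⁻¹ (by positivity) (inv_le_one_of_one_le₀ hq) hqr h x N D B hh hD hB hDB hT
  have hne : ∀ j, eulerBase q⁻¹ h x j + qNumber q⁻¹ c * eulerStep q⁻¹ h x j ≠ 0 := by
    intro j
    rcases lt_or_ge j N with hj | hj
    · exact hN j hj
    · obtain ⟨i, rfl⟩ := Nat.exists_eq_add_of_le hj
      exact H1 i
  obtain ⟨h1, h2⟩ := tendsto_eulerApprox hq hh hne
  refine ⟨h1, le_of_tendsto ((h2.comp (tendsto_add_atTop_nat N)).sub_const _).norm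
    (.of_forall fun n => ?_)⟩
  simpa [add_comm n N] using H2 n

/-! ### The confluence `q → 1` with a positive step -/

lemma mul_pow_le_geom_sum {p : ℝ} (hp : 0 < p) (hp1 : p ≤ 1) (n : ℕ) :
    ((n : ℝ) + 1) * p ^ n ≤ ∑ i ∈ Finset.range (n + 1), p ^ i := by
  have h := Finset.card_nsmul_le_sum (Finset.range (n + 1)) (fun i => p ^ i) (p ^ n) fun i hi =>
    pow_le_pow_of_le_one hp.le hp1 (Nat.lt_succ_iff.1 (Finset.mem_range.1 hi))
  simpa using h

lemma norm_eulerStep {p : ℝ} (hp : 0 < p) (h : ℝ) (x : ℂ) (j : ℕ) :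
    ‖eulerStep p h x j‖ = p ^ j * ‖(p : ℂ) + (1 - p) * (x / h)‖ := by
  rw [eulerStep, norm_mul, norm_pow, Complex.norm_real, Real.norm_of_nonneg hp.le]

/-- If `x/h` is bounded, the factors of large index have a large positive real part. -/
lemma eulerTail_of_norm_le {p h X : ℝ} (hp : 0 < p) (hp1 : p ≤ 1) {x : ℂ} (hX : ‖x / (h : ℂ)‖ ≤ X)
    {N : ℕ} (hN : 1 ≤ N + 1 - X) : EulerTail p h x N (1 + X) (N + 1 - X) := by
  have hX0 : 0 ≤ X := (norm_nonneg _).trans hX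
  have hre : ∀ j, (∑ i ∈ Finset.range (j + 1), p ^ i) - p ^ j * X ≤ (eulerBase p h x j).re := by
    intro j
    have h1 : ‖(p : ℂ) ^ j * (x / h)‖ ≤ p ^ j * X := by
      rw [norm_mul, norm_pow, Complex.norm_real, Real.norm_of_nonneg hp.le]
      gcongr
    rw [eulerBase, Complex.sub_re, Complex.ofReal_re]
    linarith [Complex.re_le_norm ((p : ℂ) ^ j * (x / h))]
  have hlow1 : ∀ i : ℕ, p ^ (N + i) * (i + (N + 1 - X)) ≤ (eulerBase p h x (N + i)).re := by
    intro i
    have h1 := mul_pow_le_geom_sum hp hp1 (N + i)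
    push_cast at h1
    linarith [hre (N + i)]
  have hlow2 : ∀ i : ℕ, p ^ N * (N + 1 - X) ≤ (eulerBase p h x (N + i)).re := by
    intro i
    have h1 := mul_pow_le_geom_sum hp hp1 N
    have h2 : ∑ i ∈ Finset.range (N + 1), p ^ i ≤ ∑ i ∈ Finset.range (N + i + 1), p ^ i :=
      Finset.sum_le_sum_of_subset_of_nonneg (Finset.range_mono (by omega))
        fun k _ _ => pow_nonneg hp.le k
    have h3 : p ^ (N + i) * X ≤ p ^ N * X :=
      mul_le_mul_of_nonneg_right (pow_le_pow_of_le_one hp.le hp1 (by omega)) hX0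
    linarith [hre (N + i)]
  have hstep : ∀ j, ‖eulerStep p h x j‖ ≤ p ^ j * (1 + X) := by
    intro j
    rw [norm_eulerStep hp]
    refine mul_le_mul_of_nonneg_left ?_ (pow_nonneg hp.le j)
    have h1 := norm_add_le (p : ℂ) ((1 - p) * (x / h))
    have h2 : ‖(1 - (p : ℂ)) * (x / h)‖ ≤ 1 * X := by
      rw [norm_mul]
      refine mul_le_mul ?_ hX (norm_nonneg _) zero_le_one
      rw [← Complex.ofReal_one, ← Complex.ofReal_sub, Complex.norm_real,
        Real.norm_of_nonneg (by linarith)]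
      linarith
    rw [Complex.norm_real, Real.norm_of_nonneg hp.le] at h1
    linarith
  refine ⟨fun i => Or.inl ?_, fun i => ?_, fun i => ?_⟩
  · exact lt_of_lt_of_le (mul_pos (pow_pos hp N) (by linarith)) (hlow2 i)
  · have hi : (0 : ℝ) ≤ i := Nat.cast_nonneg i
    calc ‖eulerStep p h x (N + i)‖ * (i + (N + 1 - X))
        ≤ p ^ (N + i) * (1 + X) * (i + (N + 1 - X)) :=
          mul_le_mul_of_nonneg_right (hstep _) (by linarith)
      _ = (1 + X) * (p ^ (N + i) * (i + (N + 1 - X))) := by ring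
      _ ≤ (1 + X) * ‖eulerBase p h x (N + i)‖ :=
          mul_le_mul_of_nonneg_left ((hlow1 i).trans (Complex.re_le_norm _)) (by linarith)
  · have hpi := pow_nonneg hp.le i
    calc ‖eulerStep p h x (N + i)‖ * (N + 1 - X)
        ≤ p ^ (N + i) * (1 + X) * (N + 1 - X) :=
          mul_le_mul_of_nonneg_right (hstep _) (by linarith)
      _ = (1 + X) * p ^ i * (p ^ N * (N + 1 - X)) := by rw [pow_add]; ring
      _ ≤ (1 + X) * p ^ i * ‖eulerBase p h x (N + i)‖ :=
          mul_le_mul_of_nonneg_left ((hlow2 i).trans (Complex.re_le_norm _)) (by positivity)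

lemma qNumber_one (c : ℂ) : qNumber 1 c = c := if_pos rfl

lemma tendsto_qNumber (c : ℂ) : Tendsto (fun p : ℝ => qNumber p c) (𝓝 1) (𝓝 c) := by
  have hlim : ∀ a : ℝ, Tendsto (fun p : ℝ => a * |1 - p|) (𝓝 1) (𝓝 0) := fun a =>
    Continuous.tendsto' (by fun_prop) _ _ (by simp)
  rw [tendsto_iff_norm_sub_tendsto_zero]
  refine squeeze_zero' (.of_forall fun _ => norm_nonneg _) ?_ (hlim (4 * ‖c‖ ^ 2 + ‖c‖))
  filter_upwards [(hlim 1).eventually_le_const (by norm_num : (0 : ℝ) < 1 / 2),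
    (hlim (2 * ‖c‖)).eventually_le_const one_pos] with p h1 h2
  exact norm_qNumber_sub_le (by simpa using h1) h2

lemma continuousAt_eulerBase {d₀ : ℂ} {p₀ h₀ : ℝ} (hh₀ : h₀ ≠ 0) (x₀ : ℂ) (j : ℕ) :
    ContinuousAt (fun z : (ℂ × ℝ × ℝ) × ℂ => eulerBase z.1.2.1 z.1.2.2 z.2 j)
      ((d₀, p₀, h₀), x₀) := by
  have h1 : ContinuousAt (fun z : (ℂ × ℝ × ℝ) × ℂ => z.2 / (z.1.2.2 : ℂ)) ((d₀, p₀, h₀), x₀) :=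
    ContinuousAt.div (by fun_prop) (by fun_prop) (by exact_mod_cast hh₀)
  have h2 : Continuous fun z : (ℂ × ℝ × ℝ) × ℂ =>
      ((∑ i ∈ Finset.range (j + 1), z.1.2.1 ^ i : ℝ) : ℂ) := by fun_prop
  have h3 : Continuous fun z : (ℂ × ℝ × ℝ) × ℂ => (z.1.2.1 : ℂ) ^ j := by fun_prop
  exact h2.continuousAt.sub (h3.continuousAt.mul h1)

lemma continuousAt_eulerStep {d₀ : ℂ} {p₀ h₀ : ℝ} (hh₀ : h₀ ≠ 0) (x₀ : ℂ) (j : ℕ) :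
    ContinuousAt (fun z : (ℂ × ℝ × ℝ) × ℂ => eulerStep z.1.2.1 z.1.2.2 z.2 j)
      ((d₀, p₀, h₀), x₀) := by
  have h1 : ContinuousAt (fun z : (ℂ × ℝ × ℝ) × ℂ => z.2 / (z.1.2.2 : ℂ)) ((d₀, p₀, h₀), x₀) :=
    ContinuousAt.div (by fun_prop) (by fun_prop) (by exact_mod_cast hh₀)
  have h2 : Continuous fun z : (ℂ × ℝ × ℝ) × ℂ => (z.1.2.1 : ℂ) := by fun_prop
  exact (h2.pow j).continuousAt.mul (h2.continuousAt.add
    ((continuous_const.sub h2).continuousAt.mul h1))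

lemma continuousAt_eulerApprox {c d₀ : ℂ} {p₀ h₀ : ℝ} (hh₀ : 0 < h₀) {x₀ : ℂ} {N : ℕ}
    (hden : ∀ j < N, eulerBase p₀ h₀ x₀ j + d₀ * eulerStep p₀ h₀ x₀ j ≠ 0)
    (hN : eulerBase p₀ h₀ x₀ N ∈ Complex.slitPlane) :
    ContinuousAt (fun z : (ℂ × ℝ × ℝ) × ℂ => eulerApprox c z.1.1 z.1.2.1 z.1.2.2 z.2 N)
      ((d₀, p₀, h₀), x₀) := by
  have hb := fun j => continuousAt_eulerBase (d₀ := d₀) (p₀ := p₀) hh₀.ne' x₀ j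
  have hs := fun j => continuousAt_eulerStep (d₀ := d₀) (p₀ := p₀) hh₀.ne' x₀ j
  have hd : ContinuousAt (fun z : (ℂ × ℝ × ℝ) × ℂ => z.1.1) ((d₀, p₀, h₀), x₀) := by fun_prop
  have hh : ContinuousAt (fun z : (ℂ × ℝ × ℝ) × ℂ => (z.1.2.2 : ℂ)) ((d₀, p₀, h₀), x₀) := by
    fun_prop
  have hprod : ContinuousAt (fun z : (ℂ × ℝ × ℝ) × ℂ => ∏ j ∈ Finset.range N,
      eulerBase z.1.2.1 z.1.2.2 z.2 j / (eulerBase z.1.2.1 z.1.2.2 z.2 j +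
        z.1.1 * eulerStep z.1.2.1 z.1.2.2 z.2 j)) ((d₀, p₀, h₀), x₀) :=
    tendsto_finsetProd _ fun j hj =>
      (hb j).div ((hb j).add (hd.mul (hs j))) (hden j (Finset.mem_range.1 hj))
  exact ((hh.cpow continuousAt_const (by simpa using hh₀)).mul hprod).mul
    ((hb N).cpow continuousAt_const hN)

lemma tendsto_exp_sub_one_of_tendsto_zero {α : Type*} {l : Filter α} {f : α → ℝ}
    (hf : Tendsto f l (𝓝 0)) : Tendsto (fun a => Real.exp (f a) - 1) l (𝓝 0) := by
  have h := ((Real.continuous_exp.tendsto 0).comp hf).sub_const 1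
  simpa using h

/-- The confluence to the quotient of Gamma functions. -/
theorem tendstoUniformlyOn_qhChar_one (c : ℂ) {h₀ : ℝ} (hh₀ : 0 < h₀) {K : Set ℂ}
    (hK : K ⊆ (poleSet h₀ c)ᶜ) (hKc : IsCompact K) :
    TendstoUniformlyOn (fun a : ℝ × ℝ => qhChar a.1 a.2 c) (qhChar 1 h₀ c)
      (𝓝[paramQ] (1, h₀)) K := by
  obtain ⟨C, hC, r, hr, H⟩ := exists_norm_qhChar_sub_le c
  obtain ⟨R, hR⟩ := hKc.isBounded.exists_norm_le
  have hh0' : (h₀ : ℂ) ≠ 0 := by exact_mod_cast hh₀.ne'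
  -- no factor of the limit product has a pole on `K`
  have hden : ∀ x ∈ K, ∀ j, eulerBase 1 h₀ x j + c * eulerStep 1 h₀ x j ≠ 0 := by
    intro x hx j h0
    refine hK hx ⟨j + 1, by omega, ?_⟩
    simp only [eulerBase, eulerStep, one_pow, Finset.sum_const, Finset.card_range, nsmul_eq_mul,
      mul_one, Complex.ofReal_one, sub_self, zero_mul, add_zero, one_mul, Complex.ofReal_natCast]
      at h0
    push_cast at h0 ⊢
    field_simp at h0
    linear_combination -h0
  obtain ⟨M, hM⟩ : ∃ M, ∀ x ∈ K, ‖qhChar 1 h₀ c x‖ ≤ M := by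
    refine hKc.exists_bound_of_continuousOn fun x hx => ?_
    refine (tendsto_eulerApprox le_rfl hh₀ fun j => ?_).1.continuousAt.continuousWithinAt
    rw [inv_one, qNumber_one]
    exact hden x hx j
  set X : ℝ := |R| / (h₀ / 2) with hXdef
  have hX0 : 0 ≤ X := by positivity
  have hX : ∀ h : ℝ, h₀ / 2 ≤ h → ∀ x ∈ K, ‖x / (h : ℂ)‖ ≤ X := by
    intro h hh x hx
    have h0 : 0 < h := by linarith
    rw [norm_div, Complex.norm_real, Real.norm_of_nonneg h0.le]
    exact div_le_div₀ (abs_nonneg R) ((hR x hx).trans (le_abs_self R)) (by positivity) hh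
  rw [Metric.tendstoUniformlyOn_iff]
  intro δ hδ
  set M' : ℝ := |M| + 1 with hM'
  have hM'0 : 0 < M' := by positivity
  set θ₀ : ℝ := min (1 / 2) (δ / (8 * M')) with hθ₀
  have hθ₀0 : 0 < θ₀ := lt_min (by norm_num) (by positivity)
  -- the index `N` at which the product is cut
  have hBlim : Tendsto (fun N : ℕ => (N : ℝ) + 1 - X) atTop atTop := by
    simp_rw [add_sub_assoc]
    exact tendsto_atTop_add_const_right _ _ tendsto_natCast_atTop_atTop
  have hθlim := tendsto_exp_sub_one_of_tendsto_zero
    (hBlim.const_div_atTop (C * ((1 + X) ^ 2 + (1 + X))))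
  obtain ⟨N, hN1, hN2, hN3⟩ := ((hBlim.eventually_ge_atTop 1).and
    ((hBlim.eventually_ge_atTop ((1 + X) / r)).and (hθlim.eventually_le_const hθ₀0))).exists
  rw [div_le_iff₀ hr, mul_comm] at hN2
  set θ : ℝ := Real.exp (C * ((1 + X) ^ 2 + (1 + X)) / (N + 1 - X)) - 1 with hθ
  have hθ1 : θ ≤ 1 / 2 := hN3.trans (min_le_left _ _)
  have hθ2 : θ * (8 * M') ≤ δ := by
    rw [← le_div_iff₀ (by positivity)]
    exact hN3.trans (min_le_right _ _)
  have hθ0 : 0 ≤ θ := by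
    rw [hθ, sub_nonneg, Real.one_le_exp_iff]
    exact div_nonneg (by positivity) (by linarith)
  have hone : ∀ x ∈ K, ‖qhChar 1 h₀ c x - eulerApprox c c 1 h₀ x N‖ ≤
      ‖eulerApprox c c 1 h₀ x N‖ * θ := by
    intro x hx
    have h := (H 1 le_rfl (by rw [inv_one]; linarith) h₀ x N (1 + X) (N + 1 - X) hh₀
      (by linarith) hN1 hN2 (eulerTail_of_norm_le (by norm_num) (by norm_num)
        (hX h₀ (by linarith) x hx) hN1)
      (fun j _ => by rw [inv_one, qNumber_one]; exact hden x hx j)).2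
    rwa [inv_one, qNumber_one] at h
  have hE : ∀ x ∈ K, ‖eulerApprox c c 1 h₀ x N‖ ≤ 2 * M' := by
    intro x hx
    have h1 := norm_sub_norm_le (eulerApprox c c 1 h₀ x N) (qhChar 1 h₀ c x)
    rw [norm_sub_rev] at h1
    have h2 := hone x hx
    have h3 := hM x hx
    have h4 := le_abs_self M
    nlinarith [norm_nonneg (eulerApprox c c 1 h₀ x N)]
  have key : ∀ᶠ y : ℂ × ℝ × ℝ in 𝓝 (c, 1, h₀), ∀ x ∈ K,
      ‖eulerApprox c y.1 y.2.1 y.2.2 x N - eulerApprox c c 1 h₀ x N‖ < min 1 (δ / 4) ∧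
      ∀ j < N, eulerBase y.2.1 y.2.2 x j + y.1 * eulerStep y.2.1 y.2.2 x j ≠ 0 := by
    refine hKc.eventually_forall_of_forall_eventually fun x hx => ?_
    have hslit : eulerBase 1 h₀ x N ∈ Complex.slitPlane :=
      (eulerTail_of_norm_le (p := 1) (by norm_num) (by norm_num)
        (hX h₀ (by linarith) x hx) hN1).mem_slitPlane 0
    have c1 := continuousAt_eulerApprox (c := c) hh₀ (fun j _ => hden x hx j) hslit (N := N)
    have c2 : ContinuousAt (fun z : (ℂ × ℝ × ℝ) × ℂ => eulerApprox c c 1 h₀ z.2 N)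
        ((c, 1, h₀), x) :=
      ContinuousAt.comp (g := fun z : (ℂ × ℝ × ℝ) × ℂ => eulerApprox c z.1.1 z.1.2.1 z.1.2.2 z.2 N)
        (f := fun z : (ℂ × ℝ × ℝ) × ℂ => (((c, 1, h₀) : ℂ × ℝ × ℝ), z.2)) c1 (by fun_prop)
    have e1 := (c1.sub c2).norm.eventually_lt continuousAt_const (g := fun _ => min 1 (δ / 4))
      (by simpa using hδ)
    have e2 : ∀ᶠ z : (ℂ × ℝ × ℝ) × ℂ in 𝓝 ((c, 1, h₀), x), ∀ j ∈ Finset.range N,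
        eulerBase z.1.2.1 z.1.2.2 z.2 j + z.1.1 * eulerStep z.1.2.1 z.1.2.2 z.2 j ≠ 0 := by
      rw [Filter.eventually_all_finset]
      intro j _
      have hd : ContinuousAt (fun z : (ℂ × ℝ × ℝ) × ℂ => z.1.1) ((c, 1, h₀), x) := by fun_prop
      exact ((continuousAt_eulerBase hh₀.ne' x j).add
        (hd.mul (continuousAt_eulerStep hh₀.ne' x j))).eventually_ne (hden x hx j)
    filter_upwards [e1, e2] with z h1 h2
    exact ⟨h1, fun j hj => h2 j (Finset.mem_range.2 hj)⟩
  have hinv : Tendsto (fun a : ℝ × ℝ => a.1⁻¹) (𝓝[paramQ] (1, h₀)) (𝓝 1) := by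
    have h : ContinuousAt (fun a : ℝ × ℝ => a.1⁻¹) (1, h₀) :=
      continuousAt_fst.inv₀ one_ne_zero
    have h' : Tendsto (fun a : ℝ × ℝ => a.1⁻¹) (𝓝 (1, h₀)) (𝓝 1) := by
      simpa [ContinuousAt] using h
    exact h'.mono_left nhdsWithin_le_nhds
  have hsnd : Tendsto (fun a : ℝ × ℝ => a.2) (𝓝[paramQ] (1, h₀)) (𝓝 h₀) :=
    (continuous_snd.tendsto ((1, h₀) : ℝ × ℝ)).mono_left nhdsWithin_le_nhds
  have hT : Tendsto (fun a : ℝ × ℝ => (qNumber a.1⁻¹ c, a.1⁻¹, a.2)) (𝓝[paramQ] (1, h₀))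
      (𝓝 (c, 1, h₀)) :=
    ((tendsto_qNumber c).comp hinv).prodMk_nhds (hinv.prodMk_nhds hsnd)
  filter_upwards [hT.eventually key, self_mem_nhdsWithin,
    hinv.eventually_const_le (by linarith : 1 - r < 1),
    hsnd.eventually_const_le (by linarith : h₀ / 2 < h₀)] with a ha1 ha2 ha3 ha4 x hx
  obtain ⟨b1, b2⟩ := ha1 x hx
  have hq : 1 < a.1 := ha2.1
  have h := (H a.1 hq.le ha3 a.2 x N (1 + X) (N + 1 - X) ha2.2 (by linarith) hN1 hN2
    (eulerTail_of_norm_le (by positivity) (inv_le_one_of_one_le₀ hq.le) (hX a.2 ha4 x hx) hN1)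
    b2).2
  rw [dist_eq_norm]
  set e₁ := qhChar 1 h₀ c x
  set e₂ := qhChar a.1 a.2 c x
  set E₁ := eulerApprox c c 1 h₀ x N
  set E₂ := eulerApprox c (qNumber a.1⁻¹ c) a.1⁻¹ a.2 x N
  have hE1 : ‖E₁‖ ≤ 2 * M' := hE x hx
  have b3 : ‖E₂ - E₁‖ < 1 := b1.trans_le (min_le_left _ _)
  have b4 : ‖E₂ - E₁‖ < δ / 4 := b1.trans_le (min_le_right _ _)
  have hE2 : ‖E₂‖ ≤ 2 * M' + 1 := by
    have := norm_sub_norm_le E₂ E₁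
    linarith
  have h1 := hone x hx
  have hMge : 1 ≤ M' := by rw [hM']; linarith [abs_nonneg M]
  have t1 : ‖e₁ - E₁‖ ≤ δ / 4 := by
    calc _ ≤ ‖E₁‖ * θ := h1
      _ ≤ 2 * M' * θ := mul_le_mul_of_nonneg_right hE1 hθ0
      _ ≤ δ / 4 := by linarith
  have t2 : ‖e₂ - E₂‖ ≤ 3 * δ / 8 := by
    calc _ ≤ ‖E₂‖ * θ := h
      _ ≤ (2 * M' + 1) * θ := mul_le_mul_of_nonneg_right hE2 hθ0
      _ ≤ (3 * M') * θ := mul_le_mul_of_nonneg_right (by linarith) hθ0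
      _ ≤ 3 * δ / 8 := by linarith
  calc ‖e₁ - e₂‖ = ‖(e₁ - E₁) - (E₂ - E₁) - (e₂ - E₂)‖ := by congr 1; ring
    _ ≤ ‖e₁ - E₁‖ + ‖E₂ - E₁‖ + ‖e₂ - E₂‖ :=
      (norm_sub_le _ _).trans (add_le_add_left (norm_sub_le _ _) _)
    _ < δ := by linarith

/-! ### The confluence to `(-x)^c` -/

/-- The points `a - b x`, for `a, b ≥ 0` and `x` in a compact set avoiding `ℝ⁺`, are uniformly
far from the origin. -/
lemma exists_mul_add_le_norm_sub {K : Set ℂ} (hK : K ⊆ posRealAxisᶜ) (hKc : IsCompact K) :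
    ∃ κ > (0 : ℝ), ∀ x ∈ K, ∀ a b : ℝ, 0 ≤ a → 0 ≤ b → κ * (a + b) ≤ ‖(a : ℂ) - b * x‖ := by
  rcases K.eq_empty_or_nonempty with rfl | hne
  · exact ⟨1, one_pos, by simp⟩
  have hne' : (Icc (0 : ℝ) 1 ×ˢ K).Nonempty := Set.Nonempty.prod ⟨0, by simp⟩ hne
  have hcont : Continuous fun z : ℝ × ℂ => ‖((1 - z.1 : ℝ) : ℂ) - z.1 * z.2‖ := by fun_prop
  obtain ⟨⟨t, x⟩, ⟨ht, hx⟩, hmin⟩ :=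
    ((isCompact_Icc (a := (0 : ℝ)) (b := 1)).prod hKc).exists_isMinOn hne' hcont.continuousOn
  refine ⟨‖((1 - t : ℝ) : ℂ) - t * x‖, norm_pos_iff.2 fun h0 => ?_, fun y hy a b ha hb => ?_⟩
  · simp only at ht hx
    rcases ht.1.eq_or_lt with rfl | ht0
    · simp at h0
    · refine hK hx ⟨(1 - t) / t, div_nonneg (by linarith [ht.2]) ht0.le, ?_⟩
      have ht' : (t : ℂ) ≠ 0 := by exact_mod_cast ht0.ne'
      rw [Complex.ofReal_div, eq_div_iff ht']
      linear_combination -h0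
  · rcases (add_nonneg ha hb).eq_or_lt with h | h
    · rw [← h, mul_zero]
      exact norm_nonneg _
    · have h1 := isMinOn_iff.1 hmin (b / (a + b), y)
        ⟨⟨by positivity, (div_le_one h).2 (by linarith)⟩, hy⟩
      have h' : (a : ℂ) + b ≠ 0 := by exact_mod_cast h.ne'
      have e : (a : ℂ) - b * y =
          ((a + b : ℝ) : ℂ) * (((1 - b / (a + b) : ℝ) : ℂ) - ((b / (a + b) : ℝ) : ℂ) * y) := by
        push_cast
        field_simp
        ring
      rw [e, norm_mul, Complex.norm_real, Real.norm_of_nonneg h.le, mul_comm]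
      exact mul_le_mul_of_nonneg_left h1 h.le

/-- For `x` away from `ℝ⁺` and `q - 1` at most of the order of `h`, the tail condition holds from
the first factor on, with `B = 1/h`. -/
lemma eulerTail_zero {p h κ l X : ℝ} {x : ℂ} (hp : 0 < p) (hp1 : p ≤ 1) (hh : 0 < h) (hκ : 0 < κ)
    (hx : ∀ a b : ℝ, 0 ≤ a → 0 ≤ b → κ * (a + b) ≤ ‖(a : ℂ) - b * x‖) (hxr : x ∈ posRealAxisᶜ)
    (hX : ‖x‖ ≤ X) (hl : 0 < l) (hl1 : l ≤ 1) (hlp : l * (1 - p) ≤ p * h) :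
    EulerTail p h x 0 ((1 + X / l) / (κ * l)) (1 / h) := by
  have hX0 : 0 ≤ X := (norm_nonneg _).trans hX
  set S : ℕ → ℝ := fun j => ∑ i ∈ Finset.range (j + 1), p ^ i with hS
  have hSpos : ∀ j, (j + 1) * p ^ j ≤ S j := fun j => mul_pow_le_geom_sum hp hp1 j
  have hbase : ∀ j, eulerBase p h x j = ((S j : ℝ) : ℂ) - ((p ^ j / h : ℝ) : ℂ) * x := by
    intro j
    rw [eulerBase, Complex.ofReal_div, Complex.ofReal_pow]
    ring
  have hS0 : ∀ j, 0 < S j := fun j => lt_of_lt_of_le (by positivity) (hSpos j)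
  have hlow : ∀ j, κ * (S j + p ^ j / h) ≤ ‖eulerBase p h x j‖ := fun j => by
    rw [hbase]
    exact hx _ _ (hS0 j).le (by positivity)
  have hstep : ∀ j, ‖eulerStep p h x j‖ ≤ p ^ j * (1 + X / l) := by
    intro j
    rw [norm_eulerStep hp]
    refine mul_le_mul_of_nonneg_left ?_ (pow_nonneg hp.le j)
    have h1 := norm_add_le (p : ℂ) ((1 - p) * (x / h))
    have h2 : ‖(1 - (p : ℂ)) * (x / h)‖ ≤ X / l := by
      rw [norm_mul, norm_div, ← Complex.ofReal_one, ← Complex.ofReal_sub, Complex.norm_real,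
        Complex.norm_real, Real.norm_of_nonneg (by linarith), Real.norm_of_nonneg hh.le,
        ← mul_div_assoc, div_le_div_iff₀ hh hl]
      calc (1 - p) * ‖x‖ * l = ‖x‖ * (l * (1 - p)) := by ring
        _ ≤ X * (1 * h) := by
            refine mul_le_mul hX (hlp.trans ?_) (mul_nonneg hl.le (by linarith)) hX0
            gcongr
        _ = X * h := by rw [one_mul]
    rw [Complex.norm_real, Real.norm_of_nonneg hp.le] at h1
    linarith
  have hA : 0 < 1 + X / l := by positivity
  refine ⟨fun i => ?_, fun i => ?_, fun i => ?_⟩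
  · rw [zero_add, hbase, Complex.mem_slitPlane_iff]
    by_cases him : x.im = 0
    · left
      have hre : x.re < 0 := by
        by_contra hre
        exact hxr ⟨x.re, not_lt.1 hre, Complex.ext rfl (by simpa using him)⟩
      rw [Complex.sub_re, Complex.ofReal_re, Complex.re_ofReal_mul]
      have h1 : p ^ i / h * x.re ≤ 0 := mul_nonpos_of_nonneg_of_nonpos (by positivity) hre.le
      linarith [hS0 i]
    · right
      rw [Complex.sub_im, Complex.ofReal_im, Complex.im_ofReal_mul, zero_sub, neg_ne_zero]
      exact mul_ne_zero (by positivity) him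
  · rw [zero_add]
    have h1 : κ * (p ^ i * (i + 1 / h)) ≤ ‖eulerBase p h x i‖ := by
      refine le_trans (mul_le_mul_of_nonneg_left ?_ hκ.le) (hlow i)
      have := hSpos i
      have := pow_pos hp i
      rw [mul_add, mul_one_div]
      nlinarith
    have hi : (0 : ℝ) ≤ i + 1 / h := by positivity
    calc ‖eulerStep p h x i‖ * (i + 1 / h) ≤ p ^ i * (1 + X / l) * (i + 1 / h) :=
          mul_le_mul_of_nonneg_right (hstep i) hi
      _ = (1 + X / l) / κ * (κ * (p ^ i * (i + 1 / h))) := by field_simp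
      _ ≤ (1 + X / l) / κ * ‖eulerBase p h x i‖ := mul_le_mul_of_nonneg_left h1 (by positivity)
      _ ≤ (1 + X / l) / (κ * l) * ‖eulerBase p h x i‖ := by
          refine mul_le_mul_of_nonneg_right ?_ (norm_nonneg _)
          exact div_le_div_of_nonneg_left hA.le (by positivity) (mul_le_of_le_one_right hκ.le hl1)
  · rw [zero_add]
    have h1 : κ * (l / h) ≤ ‖eulerBase p h x i‖ := by
      refine le_trans (mul_le_mul_of_nonneg_left ?_ hκ.le) (hlow i)
      -- `[i+1]_p + p^i/h ≥ l/h`, as `l (1 - p^i) = l (1-p) [i]_p ≤ h [i]_p`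
      have hg : (1 - p) * ∑ k ∈ Finset.range i, p ^ k = 1 - p ^ i := mul_neg_geom_sum p i
      have hSi : ∑ k ∈ Finset.range i, p ^ k ≤ S i :=
        Finset.sum_le_sum_of_subset_of_nonneg (Finset.range_mono (by omega))
          fun k _ _ => pow_nonneg hp.le k
      have hs0 : 0 ≤ ∑ k ∈ Finset.range i, p ^ k := Finset.sum_nonneg fun k _ => pow_nonneg hp.le k
      rw [div_le_iff₀ hh, add_mul, div_mul_cancel₀ _ hh.ne']
      have h2 : l * (1 - p ^ i) ≤ S i * h := by
        calc l * (1 - p ^ i) = l * (1 - p) * ∑ k ∈ Finset.range i, p ^ k := by rw [← hg]; ring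
          _ ≤ h * ∑ k ∈ Finset.range i, p ^ k :=
              mul_le_mul_of_nonneg_right (hlp.trans (by nlinarith)) hs0
          _ ≤ S i * h := by nlinarith
      have h3 : l * p ^ i ≤ p ^ i := mul_le_of_le_one_left (pow_nonneg hp.le i) hl1
      linarith
    calc ‖eulerStep p h x i‖ * (1 / h) ≤ p ^ i * (1 + X / l) * (1 / h) :=
          mul_le_mul_of_nonneg_right (hstep i) (by positivity)
      _ = (1 + X / l) / (κ * l) * p ^ i * (κ * (l / h)) := by field_simp
      _ ≤ (1 + X / l) / (κ * l) * p ^ i * ‖eulerBase p h x i‖ :=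
          mul_le_mul_of_nonneg_left h1 (by positivity)

lemma eulerApprox_zero {h : ℝ} (hh : 0 < h) (c d : ℂ) (p : ℝ) (x : ℂ) :
    eulerApprox c d p h x 0 = (h - x) ^ c := by
  have hh0 : (h : ℂ) ≠ 0 := by exact_mod_cast hh.ne'
  rw [eulerApprox, Finset.prod_range_zero, mul_one, ← ofReal_mul_cpow hh]
  congr 1
  simp only [eulerBase, zero_add, Finset.range_one, Finset.sum_singleton, pow_zero, one_mul,
    Complex.ofReal_one]
  field_simp

lemma neg_mem_slitPlane_of_notMem {x : ℂ} (hx : x ∈ posRealAxisᶜ) : -x ∈ Complex.slitPlane := by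
  rw [Complex.mem_slitPlane_iff]
  by_cases him : x.im = 0
  · left
    have hre : x.re < 0 := by
      by_contra hre
      exact hx ⟨x.re, not_lt.1 hre, Complex.ext rfl (by simpa using him)⟩
    simpa using hre
  · right
    simpa using him

/-- Uniform closeness to `(-x)^c` for small steps `h` of at least the order of `q - 1`. -/
lemma eventually_norm_qhChar_sub_neg_cpow_lt (c : ℂ) {K : Set ℂ} (hK : K ⊆ posRealAxisᶜ)
    (hKc : IsCompact K) {l : ℝ} (hl : 0 < l) (hl1 : l ≤ 1) {δ : ℝ} (hδ : 0 < δ) :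
    ∀ᶠ h in 𝓝[>] (0 : ℝ), ∀ q : ℝ, 1 ≤ q → l * (q - 1) ≤ h → ∀ x ∈ K,
      ‖qhChar q h c x - (-x) ^ c‖ < δ := by
  obtain ⟨C, hC, r, hr, H⟩ := exists_norm_qhChar_sub_le c
  obtain ⟨R, hR⟩ := hKc.isBounded.exists_norm_le
  obtain ⟨κ, hκ, hκK⟩ := exists_mul_add_le_norm_sub hK hKc
  set X : ℝ := |R|
  set D : ℝ := (1 + X / l) / (κ * l) with hD
  have hD0 : 0 ≤ D := by positivity
  have hcpow : ∀ x ∈ K, ContinuousAt (fun z : ℝ × ℂ => ((z.1 : ℂ) - z.2) ^ c) (0, x) := by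
    intro x hx
    exact ContinuousAt.cpow (by fun_prop) continuousAt_const
      (by simpa using neg_mem_slitPlane_of_notMem (hK hx))
  have hcpow' : ∀ x ∈ K, ContinuousAt (fun z : ℂ => (-z) ^ c) x := by
    intro x hx
    exact ContinuousAt.cpow (by fun_prop) continuousAt_const (neg_mem_slitPlane_of_notMem (hK hx))
  obtain ⟨M, hM⟩ := hKc.exists_bound_of_continuousOn
    fun x hx => (hcpow' x hx).continuousWithinAt
  set M' : ℝ := |M| + 1
  have hM'0 : 0 < M' := by positivity
  have e1 : ∀ᶠ h : ℝ in 𝓝 (0 : ℝ), ∀ x ∈ K, ‖((h : ℂ) - x) ^ c - (-x) ^ c‖ < min 1 (δ / 2) := by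
    refine hKc.eventually_forall_of_forall_eventually fun x hx => ?_
    have c2 : ContinuousAt (fun z : ℝ × ℂ => (-z.2) ^ c) (0, x) :=
      ContinuousAt.comp (g := fun z : ℂ => (-z) ^ c) (f := fun z : ℝ × ℂ => z.2)
        (hcpow' x hx) continuousAt_snd
    exact ((hcpow x hx).sub c2).norm.eventually_lt continuousAt_const
      (g := fun _ => min 1 (δ / 2)) (by simpa using hδ)
  have hlim : ∀ a : ℝ, Tendsto (fun h : ℝ => a * h) (𝓝 0) (𝓝 0) := fun a =>
    Continuous.tendsto' (by fun_prop) _ _ (by simp)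
  have e2 := (tendsto_exp_sub_one_of_tendsto_zero (hlim (C * (D ^ 2 + D)))).eventually_lt_const
    (by positivity : 0 < δ / (2 * M'))
  have e3 := (hlim l⁻¹).eventually_le_const hr
  have e4 := (hlim D).eventually_le_const hr
  have e5 := (hlim 1).eventually_le_const one_pos
  filter_upwards [e1.filter_mono nhdsWithin_le_nhds, e2.filter_mono nhdsWithin_le_nhds,
    e3.filter_mono nhdsWithin_le_nhds, e4.filter_mono nhdsWithin_le_nhds,
    e5.filter_mono nhdsWithin_le_nhds, self_mem_nhdsWithin] with h h1 h2 h3 h4 h5 hh q hq hqh x hx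
  rw [mem_Ioi] at hh
  rw [one_mul] at h5
  have hp : 0 < q⁻¹ := by positivity
  have hp1 : q⁻¹ ≤ 1 := inv_le_one_of_one_le₀ hq
  have hqp : q * q⁻¹ = 1 := mul_inv_cancel₀ (by positivity)
  have hqr : q - 1 ≤ r := by
    refine le_trans ?_ h3
    rw [inv_mul_eq_div, le_div_iff₀ hl]
    linarith
  have hB : 1 ≤ 1 / h := (one_le_div hh).2 h5
  have hDr : D ≤ r * (1 / h) := by
    rw [mul_one_div, le_div_iff₀ hh]
    exact h4
  have hlp : l * (1 - q⁻¹) ≤ q⁻¹ * h := by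
    have := mul_le_mul_of_nonneg_left hqh hp.le
    have e : q⁻¹ * (l * (q - 1)) = l * (q * q⁻¹ - q⁻¹) := by ring
    rw [e, hqp] at this
    exact this
  have hT := eulerTail_zero hp hp1 hh hκ (hκK x hx) (hK hx) ((hR x hx).trans (le_abs_self R)) hl hl1
    hlp
  have hmain := (H q hq (by nlinarith) h x 0 D (1 / h) hh hD0 hB hDr hT (by simp)).2
  rw [eulerApprox_zero hh, div_div_eq_mul_div, div_one] at hmain
  have b1 := h1 x hx
  have b2 : ‖((h : ℂ) - x) ^ c‖ ≤ M' := by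
    have := norm_sub_norm_le (((h : ℂ) - x) ^ c) ((-x) ^ c)
    have := b1.trans_le (min_le_left _ _)
    have := hM x hx
    have := le_abs_self M
    linarith
  have b3 : ‖qhChar q h c x - ((h : ℂ) - x) ^ c‖ ≤ δ / 2 := by
    refine hmain.trans ?_
    have hθ0 : 0 ≤ Real.exp (C * (D ^ 2 + D) * h) - 1 := by
      rw [sub_nonneg, Real.one_le_exp_iff]
      positivity
    calc _ ≤ M' * (Real.exp (C * (D ^ 2 + D) * h) - 1) := mul_le_mul_of_nonneg_right b2 hθ0
      _ ≤ M' * (δ / (2 * M')) := mul_le_mul_of_nonneg_left h2.le hM'0.le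
      _ = δ / 2 := by field_simp
  calc ‖qhChar q h c x - (-x) ^ c‖
      = ‖(qhChar q h c x - ((h : ℂ) - x) ^ c) + (((h : ℂ) - x) ^ c - (-x) ^ c)‖ := by
        congr 1; ring
    _ ≤ _ := norm_add_le _ _
    _ < δ := by linarith [b1.trans_le (min_le_right _ _)]

/-- The confluence to `(-x)^c`. A positive limit `ℓ` of `h/(q-1)` is used only through a positive
lower bound `l` of this ratio. -/
theorem tendstoUniformlyOn_qhChar_neg_cpow (c : ℂ) {ℓ : ENNReal} (hℓ : ℓ ≠ 0) {K : Set ℂ}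
    (hK : K ⊆ posRealAxisᶜ) (hKc : IsCompact K) :
    TendstoUniformlyOn (fun a : ℝ × ℝ => qhChar a.1 a.2 c) (qhChar 1 0 c)
      (𝓝[paramQStar] (1, 0) ⊓ comap confluenceRatio (𝓝 ℓ)) K := by
  obtain ⟨l, hl, hl1, hlℓ⟩ : ∃ l : ℝ, 0 < l ∧ l ≤ 1 ∧ ENNReal.ofReal l < ℓ := by
    obtain ⟨m, hm0, hm⟩ := ENNReal.lt_iff_exists_nnreal_btwn.1
      (lt_min (pos_iff_ne_zero.2 hℓ) one_pos : 0 < min ℓ 1)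
    refine ⟨m, by exact_mod_cast hm0, ?_, ?_⟩
    · exact_mod_cast (hm.trans_le (min_le_right _ _)).le
    · rw [ENNReal.ofReal_coe_nnreal]
      exact hm.trans_le (min_le_left _ _)
  rw [Metric.tendstoUniformlyOn_iff]
  intro δ hδ
  have key := eventually_norm_qhChar_sub_neg_cpow_lt c hK hKc hl hl1 hδ
  rw [eventually_nhdsWithin_iff] at key
  have hsnd : Tendsto (fun a : ℝ × ℝ => a.2) (𝓝[paramQStar] (1, 0)) (𝓝 0) :=
    (continuous_snd.tendsto ((1, 0) : ℝ × ℝ)).mono_left nhdsWithin_le_nhds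
  have e1 := (hsnd.eventually key).filter_mono
    (inf_le_left : _ ⊓ comap confluenceRatio (𝓝 ℓ) ≤ _)
  have e2 : ∀ᶠ a in 𝓝[paramQStar] (1, 0) ⊓ comap confluenceRatio (𝓝 ℓ), a ∈ paramQStar :=
    Eventually.filter_mono inf_le_left self_mem_nhdsWithin
  have e3 : ∀ᶠ a in 𝓝[paramQStar] (1, 0) ⊓ comap confluenceRatio (𝓝 ℓ),
      ENNReal.ofReal l < confluenceRatio a :=
    Eventually.filter_mono inf_le_right
      (tendsto_comap.eventually (lt_mem_nhds hlℓ))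
  filter_upwards [e1, e2, e3] with a h1 h2 h3 x hx
  obtain ⟨hq, -, -⟩ := h2
  -- the lower bound of the ratio forces `h > 0`
  have hpos : 0 < a.2 := by
    by_contra hneg
    rw [confluenceRatio, ENNReal.ofReal_of_nonpos (not_lt.1 hneg), ENNReal.zero_div] at h3
    exact not_lt_bot h3
  have hle : l * (a.1 - 1) ≤ a.2 := by
    rcases hq.eq_or_lt with h | h
    · rw [← h, sub_self, mul_zero]
      exact hpos.le
    · have h0 : 0 < a.1 - 1 := by linarith
      rw [confluenceRatio, ← ENNReal.ofReal_div_of_pos h0,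
        ENNReal.ofReal_lt_ofReal_iff (div_pos hpos h0), lt_div_iff₀ h0] at h3
      exact h3.le
  have h0 : qhChar 1 0 c x = (-x) ^ c := by
    rw [qhChar, if_neg (lt_irrefl _), if_neg (lt_irrefl _)]
  rw [dist_comm, dist_eq_norm, h0]
  exact h1 hpos a.1 hq hle x hx

end

theorem mainTheorem5 (c : ℂ) :
    -- C1
    (∀ q₀ : ℝ, 1 < q₀ →
      -- normality of the family on the complement of the half-line
      (∀ ε : ℝ, 0 < ε →
        MeromorphicNormalOn (fun h : Set.Ioc (0 : ℝ) ε => qhChar q₀ h c) (ray q₀ c)ᶜ) ∧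
      -- for small `h` the family is holomorphic near, and bounded on, each given compact set
      (∀ K ⊆ (ray q₀ c)ᶜ, IsCompact K → ∃ η > (0 : ℝ), ∃ M : ℝ, ∀ h ∈ Set.Ioc (0 : ℝ) η,
        ∀ x ∈ K, AnalyticAt ℂ (qhChar q₀ h c) x ∧ ‖qhChar q₀ h c x‖ ≤ M) ∧
      -- convergence along `h_n = (1 - p₀) p₀^(ξ + n)`, and the two expressions of the limit
      (∀ ξ ∈ Set.Ico (0 : ℝ) 1,
        (∀ K ⊆ (ray q₀ c)ᶜ, IsCompact K →
          TendstoUniformlyOn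
            (fun n : ℕ => qhChar q₀ ((1 - q₀⁻¹) * q₀⁻¹ ^ (ξ + (n : ℝ))) c)
            (limitChar q₀ ξ c) atTop K) ∧
        limitChar q₀ ξ c =ᶠ[codiscreteWithin {(0 : ℂ)}ᶜ]
          fun x => ((q₀⁻¹ : ℝ) : ℂ) ^ ((ξ : ℂ) * c) *
            (qhChar q₀ 0 (c - ξ) x / qhChar q₀ 0 (-ξ) x)) ∧
      -- every sequential limit is of this form
      (∀ (h : ℕ → ℝ) (g : ℂ → ℂ), (∀ n, 0 < h n) → Tendsto h atTop (𝓝 0) →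
        (∀ x ∈ (ray q₀ c)ᶜ, Tendsto (fun n => qhChar q₀ (h n) c x) atTop (𝓝 (g x))) →
        ∃ ξ ∈ Set.Ico (0 : ℝ) 1, ∀ x ∈ (ray q₀ c)ᶜ, g x = limitChar q₀ ξ c x)) ∧
    -- C2
    (∀ h₀ : ℝ, 0 < h₀ → ∀ K ⊆ (poleSet h₀ c)ᶜ, IsCompact K →
      TendstoUniformlyOn (fun a : ℝ × ℝ => qhChar a.1 a.2 c) (qhChar 1 h₀ c)
        (𝓝[paramQ] (1, h₀)) K) ∧
    -- C3
    (∀ ℓ : ENNReal, ℓ ≠ 0 → ∀ K ⊆ posRealAxisᶜ, IsCompact K →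
      TendstoUniformlyOn (fun a : ℝ × ℝ => qhChar a.1 a.2 c) (qhChar 1 0 c)
        (𝓝[paramQStar] (1, 0) ⊓ comap confluenceRatio (𝓝 ℓ)) K) := by
  refine ⟨fun q₀ hq => ⟨fun ε _ => meromorphicNormalOn_qhChar hq c ε,
    fun K hK hKc => exists_bound_qhChar hq hK hKc, fun ξ hξ =>
      ⟨fun K hK hKc => tendstoUniformlyOn_qhChar_limitChar hq hξ hK hKc,
        limitChar_eventuallyEq hq c ξ⟩,
    fun h g h0 hlim hg => exists_eq_limitChar hq c h0 hlim hg⟩,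
    fun h₀ hh₀ K hK hKc => tendstoUniformlyOn_qhChar_one c hh₀ hK hKc,
    fun ℓ hℓ K hK hKc => tendstoUniformlyOn_qhChar_neg_cpow c hℓ hK hKc⟩
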